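/- A \emph{hole} is a set $H = J \cup I \subset \mathbb{R}^2$, where $J$ (the \emph{boundary} of $H$) is a closed Jordan curve that is the union of finitely many axis-parallel segments and $I$ (the \emph{inner region}) is the bounded connected region of $\mathbb{R}^2 \setminus J$. The edges of $H$ are the maximal segments of $J$ (each identified with the set of its two end points), its vertices are the end points of its edges, and $nv(H)$ is the number of its vertices. Traverse $J$ clockwise (the inner region lies to the right of every edge), so that each edge is leftward, rightward, upward or downward. An edge $e$, with its predecessor and its successor, is called a \emph{leftmost edge} if the three edges are leftward, upward, rightward; a \emph{rightmost edge} if they are rightward, downward, leftward; a \emph{left notch} if they are rightward, upward, leftward; a \emph{right notch} if they are leftward, downward, rightward; a \emph{top notch} if they are downward, rightward, upward. A \emph{falling corner} is a vertex at which a downward edge ends and a rightward edge starts. A \emph{BLS-hole} is a hole with no right notch, no top notch and at most one falling corner. A \emph{nice hole} is a BLS-hole without left notches. Let $H$ be a BLS-hole. Then $H$ has a \emph{canonical ordering}: for a rightmost edge $R(H)$ of $H$ and some $k$, the leftmost edges of $H$ are $L_1(H),\dots,L_k(H)$ and the left notches of $H$ are $N_2(H),\dots,N_k(H)$, each family listed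 in the order of the clockwise traversal that starts at $R(H)$. For every canonical ordering the following holds. For $2 \le i \le k$ let $Q_i$ be the upper vertex of $N_i(H)$, let $QN_i$ be the first point of the boundary of $H$ on the open vertical ray going upward from $Q_i$, and let $QN_i^*$ be the upper vertex of $e$ if $QN_i$ is the lower vertex of a downward edge $e$ of $H$, and $QN_i^* = QN_i$ otherwise. After adding the segments $\mathrm{seg}(Q_i,QN_i)$ for all $i \in \{2,\dots,k\}$: (1) $H$ is partitioned into $k$ nice holes $S_1,\dots,S_k$: the connected regions of $I \setminus \bigcup_{i=2}^k \mathrm{seg}(Q_i,QN_i)$ are exactly the inner regions of $S_1,\dots,S_k$, which are pairwise distinct, and $S_1\cup\dots\cup S_k = H$. (2) Each leftmost edge $L_i(H)$ is an edge of exactly one of the holes $S_j$, and every $S_j$ has exactly one leftmost edge $L(S_j)$, which is $L_i(H)$ for exactly one $i \in \{1,\dots,k\}$. (3) Every $S_j$ has exactly one rightmost edge $R(S_j)$, and $$R(S_j) = \begin{cases} R(H) & \text{if } L(S_j) = L_1(H),\\ \{QN_i^*, Q_i\} & \text{if } L(S_j) = L_i(H) \text{ with } 2 \le i \le k. \end{cases}$$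 (4) $\sum_{j=1}^k nv(S_j) \le C \cdot nv(H)$ with an absolute constant $C$ (independent of $H$ and $k$), i.e. $\sum_{j=1}^k nv(S_j) = O(nv(H))$. -/

import Mathlib

open Set Filter Topology

noncomputable section

namespace BLS

/-- The plane. -/
abbrev Plane : Type := ℝ × ℝ

/-! A closed curve is traversed through a (periodic) sequence of vertices `v : ℤ → Plane`;
the edge with index `i` runs from `v i` to `v (i + 1)`. -/

/-- The edge from `v i` to `v (i + 1)` is horizontal and traversed from left to right. -/
def Rightward (v : ℤ → Plane) (i : ℤ) : Prop :=
  (v i).2 = (v (i + 1)).2 ∧ (v i).1 < (v (i + 1)).1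

/-- The edge from `v i` to `v (i + 1)` is horizontal and traversed from right to left. -/
def Leftward (v : ℤ → Plane) (i : ℤ) : Prop :=
  (v i).2 = (v (i + 1)).2 ∧ (v (i + 1)).1 < (v i).1

/-- The edge from `v i` to `v (i + 1)` is vertical and traversed upwards. -/
def Upward (v : ℤ → Plane) (i : ℤ) : Prop :=
  (v i).1 = (v (i + 1)).1 ∧ (v i).2 < (v (i + 1)).2

/-- The edge from `v i` to `v (i + 1)` is vertical and traversed downwards. -/
def Downward (v : ℤ → Plane) (i : ℤ) : Prop :=
  (v i).1 = (v (i + 1)).1 ∧ (v (i + 1)).2 < (v i).2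

/-- The edge is a nondegenerate horizontal segment. -/
def Horizontal (v : ℤ → Plane) (i : ℤ) : Prop := Rightward v i ∨ Leftward v i

/-- The edge is a nondegenerate vertical segment. -/
def Vertical (v : ℤ → Plane) (i : ℤ) : Prop := Upward v i ∨ Downward v i

/-- The piecewise linear curve that passes through the vertex `v i` at the integer time `i`. -/
def curve (v : ℤ → Plane) (t : ℝ) : Plane :=
  AffineMap.lineMap (v ⌊t⌋) (v (⌊t⌋ + 1)) (Int.fract t)

/-- The union of all edges. -/
def trace (v : ℤ → Plane) : Set Plane := ⋃ i : ℤ, segment ℝ (v i) (v (i + 1))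

/-- The inner region of `J`: the points off `J` whose connected region in the complement of `J`
is bounded. -/
def innerRegion (J : Set Plane) : Set Plane :=
  {p | p ∉ J ∧ Bornology.IsBounded (connectedComponentIn Jᶜ p)}

/-- The vector `d` turned by 90 degrees to the right. -/
def rightNormal (d : Plane) : Plane := (d.2, -d.1)

/-- The connected regions of a set `A`. -/
def regions (A : Set Plane) : Set (Set Plane) := {C | ∃ p ∈ A, C = connectedComponentIn A p}

/-- A hole, given by a clockwise traversal of its boundary. The boundary is a closed Jordan curve
consisting of `n` axis-parallel edges, horizontal and vertical ones in alternation (so that every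
edge is a maximal segment of the curve and every `v i` is a vertex of it). -/
structure Hole where
  /-- the number of vertices -/
  n : ℕ
  /-- the vertices in clockwise order -/
  v : ℤ → Plane
  n_pos : 0 < n
  periodic : ∀ i, v (i + n) = v i
  alternating : ∀ i,
    (Horizontal v i ∧ Vertical v (i + 1)) ∨ (Vertical v i ∧ Horizontal v (i + 1))
  /-- the closed curve is simple -/
  simple : Set.InjOn (curve v) (Set.Ico (0 : ℝ) n)
  /-- the traversal is clockwise: the inner region lies immediately to the right of each edge -/
  clockwise : ∀ i, ∀ p ∈ openSegment ℝ (v i) (v (i + 1)),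
    ∀ᶠ ε in 𝓝[>] (0 : ℝ), p + ε • rightNormal (v (i + 1) - v i) ∈ innerRegion (trace v)

namespace Hole

/-- The boundary of the hole. -/
def boundary (H : Hole) : Set Plane := trace H.v

/-- The inner region of the boundary. -/
def inner (H : Hole) : Set Plane := innerRegion H.boundary

/-- The hole as a set of points. -/
def carrier (H : Hole) : Set Plane := H.boundary ∪ H.inner

/-- The number of vertices. -/
def nv (H : Hole) : ℕ := H.n

/-- The `i`-th edge as the set of its two end points. -/
def edge (H : Hole) (i : ℤ) : Set Plane := {H.v i, H.v (i + 1)}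

/-- All edges. -/
def edges (H : Hole) : Set (Set Plane) := Set.range H.edge

/-- Leftmost edge: an upward edge whose two neighbours lie to its right. -/
def IsLeftmost (H : Hole) (i : ℤ) : Prop :=
  Leftward H.v (i - 1) ∧ Upward H.v i ∧ Rightward H.v (i + 1)

/-- Rightmost edge: a downward edge whose two neighbours lie to its left. -/
def IsRightmost (H : Hole) (i : ℤ) : Prop :=
  Rightward H.v (i - 1) ∧ Downward H.v i ∧ Leftward H.v (i + 1)

/-- Left notch: an upward edge whose two neighbours lie to its left. -/
def IsLeftNotch (H : Hole) (i : ℤ) : Prop :=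
  Rightward H.v (i - 1) ∧ Upward H.v i ∧ Leftward H.v (i + 1)

/-- Right notch: a downward edge whose two neighbours lie to its right. -/
def IsRightNotch (H : Hole) (i : ℤ) : Prop :=
  Leftward H.v (i - 1) ∧ Downward H.v i ∧ Rightward H.v (i + 1)

/-- Top notch: a rightward edge (the hole is below it) whose two neighbours lie above it. -/
def IsTopNotch (H : Hole) (i : ℤ) : Prop :=
  Downward H.v (i - 1) ∧ Rightward H.v i ∧ Upward H.v (i + 1)

/-- Falling corner: a vertex with a preceding downward and a succeeding rightward edge. -/
def IsFallingCorner (H : Hole) (i : ℤ) : Prop :=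
  Downward H.v (i - 1) ∧ Rightward H.v i

/-- BLS-hole: no right notch, no top notch and at most one falling corner. -/
def IsBLS (H : Hole) : Prop :=
  (∀ i, ¬ H.IsRightNotch i) ∧ (∀ i, ¬ H.IsTopNotch i) ∧
    ∀ i j, H.IsFallingCorner i → H.IsFallingCorner j → H.v i = H.v j

/-- Nice hole: a BLS-hole without left notches. -/
def IsNice (H : Hole) : Prop := H.IsBLS ∧ ∀ i, ¬ H.IsLeftNotch i

/-- The leftmost edges of the hole. -/
def leftmostEdges (H : Hole) : Set (Set Plane) := {e | ∃ i, H.IsLeftmost i ∧ e = H.edge i}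

/-- The rightmost edges of the hole. -/
def rightmostEdges (H : Hole) : Set (Set Plane) := {e | ∃ i, H.IsRightmost i ∧ e = H.edge i}

/-- The edge with index `r` is a rightmost edge `R`; in the clockwise traversal that starts at `R`
the leftmost edges are, in this order, those with indices `ℓ 1, …, ℓ k`, and the left notches are,
in this order, those with indices `ν 2, …, ν k`. -/
structure IsCanonicalOrdering (H : Hole) (k : ℕ) (r : ℤ) (ℓ ν : ℕ → ℤ) : Prop where
  rightmost : H.IsRightmost r
  leftmost_mono : StrictMonoOn ℓ (Set.Icc 1 k)
  leftmost_eq : ℓ '' Set.Icc 1 k = {m | m ∈ Set.Ioo r (r + H.n) ∧ H.IsLeftmost m}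
  notch_mono : StrictMonoOn ν (Set.Icc 2 k)
  notch_eq : ν '' Set.Icc 2 k = {m | m ∈ Set.Ioo r (r + H.n) ∧ H.IsLeftNotch m}

/-- `Q`: the upper vertex of the upward edge with index `m`. -/
def Q (H : Hole) (m : ℤ) : Plane := H.v (m + 1)

/-- `QN`: the first point of the boundary on the open vertical ray going up from `Q`. -/
def QN (H : Hole) (m : ℤ) : Plane :=
  ((H.Q m).1, sInf {y : ℝ | (H.Q m).2 < y ∧ ((H.Q m).1, y) ∈ H.boundary})

open Classical in
/-- `QN*`: the upper vertex of `e` if `QN` is the lower vertex of a downward edge `e`, and `QN`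
otherwise. -/
def QNstar (H : Hole) (m : ℤ) : Plane :=
  if h : ∃ i, Downward H.v i ∧ H.v (i + 1) = H.QN m then H.v h.choose else H.QN m

/-- The union of the segments from `Q_i` to `QN_i`, for `i = 2, …, k`. -/
def cuts (H : Hole) (k : ℕ) (ν : ℕ → ℤ) : Set Plane :=
  ⋃ i ∈ Set.Icc 2 k, segment ℝ (H.Q (ν i)) (H.QN (ν i))

end Hole

end BLS

end

open Set Filter Topology

noncomputable section

namespace BLS

/-! The proof is an induction on `k` that always cuts at the last left notch of the canonical
ordering (`Hole.exists_isPieces`). This cut splits the hole into a western and an eastern piece. The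
western piece is nice, its only leftmost edge is the last one, and its rightmost edge lies on the
cut. The eastern piece is again a BLS-hole; the remaining leftmost edges and left notches, with
shifted indices, form a canonical ordering of it with one notch fewer, and their cuts are the same
segments as before (`Cut.east_QN`, `Cut.east_QNstar`).

Topology enters through winding numbers, computed by counting crossings of a ray with the edges. A
local analysis at edges and corners gives the Jordan curve theorem for rectilinear curves
(`RectCurve.jordan`), so the inner region of a hole is the set of points with winding number 1.
Vertical segments do not cross vertical rays, so the winding numbers of the two pieces add up to
that of the hole (`Cut.wind_add`). Orientation of the pieces, disjointness of their inner regions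
and the partition all follow from this identity.

The number of leftmost and rightmost edges comes from two relations in the cyclic word of
directions. Switches between left and right balance out over a period, and by Hopf's theorem
(`RectCurve.sum_turn`) left turns minus right turns is 4 or -4. Without right notches this leaves
exactly one rightmost edge, and one left notch fewer than leftmost edges (`RectCurve.counts`).
Applied to the western piece, whose rightmost edge is the new one on the cut, it shows that the
rightmost edge of the hole goes east.

A vertical ray through the inner region can end inside a rightward edge, at a falling corner, or at
a corner from rightward to upward (`Hole.hit_cases`). `Hole.exists_cut` brings these cases into the
common form `Cut`. In the third case the eastern piece could get a new left notch, but only if the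
hole has another left notch further on; hence the choice of the last one.

Each cut adds at most two vertices, and `k` is at most the number of vertices, so the constant 3
suffices. -/

/-- A simple closed rectilinear curve with `n` vertices, without orientation requirement. -/
structure RectCurve (n : ℕ) (v : ℤ → Plane) : Prop where
  n_pos : 0 < n
  periodic : ∀ i, v (i + n) = v i
  alternating : ∀ i,
    (Horizontal v i ∧ Vertical v (i + 1)) ∨ (Vertical v i ∧ Horizontal v (i + 1))
  simple : Set.InjOn (curve v) (Set.Ico (0 : ℝ) n)

theorem Hole.rectCurve (H : Hole) : RectCurve H.n H.v :=
  ⟨H.n_pos, H.periodic, H.alternating, H.simple⟩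

/-! ### The piecewise linear parametrisation and its trace -/

theorem curve_add (v : ℤ → Plane) (i : ℤ) {t : ℝ} (h0 : 0 ≤ t) (h1 : t ≤ 1) :
    curve v (i + t) = AffineMap.lineMap (v i) (v (i + 1)) t := by
  rcases h1.lt_or_eq with h1 | rfl
  · have : ⌊(i : ℝ) + t⌋ = i := by
      rw [Int.floor_eq_iff]; constructor <;> linarith
    have h2 : Int.fract ((i : ℝ) + t) = t := by
      rw [Int.fract, this]; ring
    rw [curve, this, h2]
  · have h := Int.floor_intCast (R := ℝ) (i + 1)
    push_cast at h
    have h2 : Int.fract ((i : ℝ) + 1) = 0 := by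
      rw [Int.fract, h]; push_cast; ring
    rw [curve, h, h2]; simp

theorem curve_int (v : ℤ → Plane) (i : ℤ) : curve v i = v i := by
  have := curve_add v i le_rfl zero_le_one
  simpa using this

theorem curve_eq_lineMap (v : ℤ → Plane) (i : ℤ) {t : ℝ} (h : t ∈ Icc (i : ℝ) (i + 1)) :
    curve v t = AffineMap.lineMap (v i) (v (i + 1)) (t - i) := by
  have := curve_add v i (t := t - i) (by linarith [h.1]) (by linarith [h.2])
  rwa [add_sub_cancel] at this

theorem continuous_curve (v : ℤ → Plane) : Continuous (curve v) := by
  have hlf : LocallyFinite fun i : ℤ => Icc (i : ℝ) (i + 1) := by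
    refine locallyFinite_Icc_of_tendsto tendsto_intCast_atTop_atTop ?_
    exact tendsto_atBot_add_const_right _ _ (tendsto_intCast_atBot_iff.2 tendsto_id)
  refine hlf.continuous ?_ (fun i => isClosed_Icc) fun i => ?_
  · refine eq_univ_of_forall fun t => mem_iUnion.2 ⟨⌊t⌋, Int.floor_le t, (Int.lt_floor_add_one t).le⟩
  · refine ContinuousOn.congr (f := fun t : ℝ => AffineMap.lineMap (v i) (v (i + 1)) (t - i)) ?_
      fun t ht => curve_eq_lineMap v i ht
    exact (AffineMap.lineMap_continuous.comp (continuous_id.sub continuous_const)).continuousOn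

theorem mem_trace {v : ℤ → Plane} {p : Plane} : p ∈ trace v ↔ ∃ t, curve v t = p := by
  simp only [trace, mem_iUnion, segment_eq_image_lineMap, mem_image]
  constructor
  · rintro ⟨i, t, ht, rfl⟩
    exact ⟨i + t, curve_add v i ht.1 ht.2⟩
  · rintro ⟨t, rfl⟩
    exact ⟨⌊t⌋, Int.fract t, ⟨Int.fract_nonneg t, (Int.fract_lt_one t).le⟩, rfl⟩

theorem trace_eq_range (v : ℤ → Plane) : trace v = range (curve v) := by
  ext p; simp [mem_trace]

theorem curve_mem_trace (v : ℤ → Plane) (t : ℝ) : curve v t ∈ trace v := mem_trace.2 ⟨t, rfl⟩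

theorem isPreconnected_trace (v : ℤ → Plane) : IsPreconnected (trace v) := by
  rw [trace_eq_range]; exact isPreconnected_range (continuous_curve v)

/-! ### Coordinates along an edge -/

theorem lineMap_fst (a b : Plane) (t : ℝ) : (AffineMap.lineMap a b t : Plane).1 = a.1 + t * (b.1 - a.1) := by
  simp [AffineMap.lineMap_apply]; ring

theorem lineMap_snd (a b : Plane) (t : ℝ) : (AffineMap.lineMap a b t : Plane).2 = a.2 + t * (b.2 - a.2) := by
  simp [AffineMap.lineMap_apply]; ring

theorem Vertical.not_horizontal {v : ℤ → Plane} {i : ℤ} (h : Vertical v i) : ¬ Horizontal v i := by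
  rintro (h' | h') <;> rcases h with h | h <;> have := h.1 <;> have := h'.2 <;> linarith

theorem Horizontal.not_vertical {v : ℤ → Plane} {i : ℤ} (h : Horizontal v i) : ¬ Vertical v i :=
  fun h' => h'.not_horizontal h

theorem Rightward.not_leftward {v : ℤ → Plane} {i : ℤ} (h : Rightward v i) : ¬ Leftward v i :=
  fun h' => lt_asymm h.2 h'.2

theorem Upward.not_downward {v : ℤ → Plane} {i : ℤ} (h : Upward v i) : ¬ Downward v i :=
  fun h' => lt_asymm h.2 h'.2

/-! ### Alternation of directions, periodicity, injectivity modulo the period -/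

namespace RectCurve

variable {n : ℕ} {v : ℤ → Plane} (X : RectCurve n v)
include X

theorem horizontal_or_vertical (i : ℤ) : Horizontal v i ∨ Vertical v i := by
  rcases X.alternating i with h | h <;> simp [h.1]

theorem vertical_succ {i : ℤ} : Vertical v (i + 1) ↔ Horizontal v i := by
  rcases X.alternating i with h | h
  · simp [h.1, h.2]
  · simp [h.1.not_horizontal, h.2.not_vertical]

theorem horizontal_succ {i : ℤ} : Horizontal v (i + 1) ↔ Vertical v i := by
  rcases X.alternating i with h | h
  · simp [h.1.not_vertical, h.2.not_horizontal]
  · simp [h.1, h.2]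

theorem vertical_pred {i : ℤ} : Vertical v (i - 1) ↔ Horizontal v i := by
  have := X.horizontal_succ (i := i - 1); rw [sub_add_cancel] at this; exact this.symm

theorem horizontal_pred {i : ℤ} : Horizontal v (i - 1) ↔ Vertical v i := by
  have := X.vertical_succ (i := i - 1); rw [sub_add_cancel] at this; exact this.symm

theorem ne_succ (i : ℤ) : v i ≠ v (i + 1) := by
  intro h
  rcases X.horizontal_or_vertical i with (h' | h') | (h' | h') <;> have := h'.2 <;> rw [h] at this <;>
    exact lt_irrefl _ this

theorem periodic_int (i k : ℤ) : v (i + k * n) = v i := by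
  have : Function.Periodic v (n : ℤ) := X.periodic
  simpa using this.int_mul k i

theorem curve_periodic (t : ℝ) (k : ℤ) : curve v (t + k * n) = curve v t := by
  have h : ⌊t + k * n⌋ = ⌊t⌋ + k * n := by
    have := Int.floor_add_intCast t (k * n); push_cast at this; exact this
  have h2 : Int.fract (t + k * n) = Int.fract t := by
    have := Int.fract_add_intCast t (k * n); push_cast at this; exact this
  rw [curve, curve, h, h2, X.periodic_int, show ⌊t⌋ + k * n + 1 = ⌊t⌋ + 1 + k * n by ring,
    X.periodic_int]

omit X in
theorem exists_mem_Ico (hn : 0 < n) (a t : ℝ) : ∃ k : ℤ, t + k * n ∈ Ico a (a + n) := by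
  have hn' : (0 : ℝ) < n := by exact_mod_cast hn
  obtain ⟨k, hk, -⟩ := existsUnique_add_zsmul_mem_Ico hn' t a
  exact ⟨k, by simpa using hk⟩

omit X in
theorem exists_int_mem_Ico (hn : 0 < n) (a i : ℤ) : ∃ k : ℤ, i + k * n ∈ Ico a (a + n) := by
  obtain ⟨k, hk⟩ := exists_mem_Ico hn (a : ℝ) (i : ℝ)
  refine ⟨k, ?_, ?_⟩
  · exact_mod_cast hk.1
  · exact_mod_cast hk.2

theorem inj {s t : ℝ} (h : curve v s = curve v t) : ∃ k : ℤ, s = t + k * n := by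
  obtain ⟨a, ha⟩ := exists_mem_Ico X.n_pos 0 s
  obtain ⟨b, hb⟩ := exists_mem_Ico X.n_pos 0 t
  rw [zero_add] at ha hb
  have := X.simple ha hb (by rw [X.curve_periodic, X.curve_periodic, h])
  exact ⟨b - a, by push_cast; linarith⟩

theorem eq_of_curve_eq {s t a : ℝ} (h : curve v s = curve v t) (hs : s ∈ Ico a (a + n))
    (ht : t ∈ Ico a (a + n)) : s = t := by
  obtain ⟨k, hk⟩ := X.inj h
  have hn : (0 : ℝ) < n := by exact_mod_cast X.n_pos
  have h1 : (k : ℝ) < 1 := by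
    by_contra hc; push Not at hc; nlinarith [hs.1, hs.2, ht.1, ht.2]
  have h2 : (-1 : ℝ) < k := by
    by_contra hc; push Not at hc; nlinarith [hs.1, hs.2, ht.1, ht.2]
  have : k = 0 := by
    have h1' : k < 1 := by exact_mod_cast h1
    have h2' : -1 < k := by exact_mod_cast h2
    omega
  simpa [this] using hk

theorem trace_eq_image (a : ℝ) : trace v = curve v '' Ico a (a + n) := by
  ext p
  rw [mem_trace]
  constructor
  · rintro ⟨t, rfl⟩
    obtain ⟨k, hk⟩ := exists_mem_Ico X.n_pos a t
    exact ⟨_, hk, X.curve_periodic t k⟩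
  · rintro ⟨t, -, rfl⟩; exact ⟨t, rfl⟩

theorem isCompact_trace : IsCompact (trace v) := by
  have : trace v = curve v '' Icc 0 (0 + n) := by
    apply subset_antisymm
    · rw [X.trace_eq_image 0]; exact image_mono Ico_subset_Icc_self
    · rintro _ ⟨t, -, rfl⟩; exact curve_mem_trace v t
  rw [this]
  exact isCompact_Icc.image (continuous_curve v)

theorem isOpen_compl_trace : IsOpen (trace v)ᶜ := X.isCompact_trace.isClosed.isOpen_compl

/-- Points of the curve close to `curve v s` have parameters close to `s`. -/
theorem exists_ball (s : ℝ) {δ : ℝ} (hδ : 0 < δ) : ∃ r > 0, ∀ t, dist (curve v t) (curve v s) < r →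
    ∃ k : ℤ, |t + k * n - s| < δ := by
  -- Within one period the parameters at distance at least `δ / 2` from `s` form a compact interval.
  -- By injectivity its image misses `curve v s`, hence a whole ball around it.
  have hc : IsCompact (curve v '' Icc (s + δ / 2) (s - δ / 2 + n)) :=
    isCompact_Icc.image (continuous_curve v)
  have hn : (0 : ℝ) < n := by exact_mod_cast X.n_pos
  have hs : curve v s ∈ (curve v '' Icc (s + δ / 2) (s - δ / 2 + n))ᶜ := by
    rintro ⟨t, ht, h⟩
    have := X.eq_of_curve_eq (a := s) h ⟨by linarith [ht.1], by linarith [ht.2]⟩ ⟨le_rfl, by linarith⟩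
    linarith [ht.1]
  obtain ⟨r, hr, hb⟩ := Metric.isOpen_iff.1 hc.isClosed.isOpen_compl _ hs
  refine ⟨r, hr, fun t ht => ?_⟩
  obtain ⟨k, hk⟩ := exists_mem_Ico X.n_pos (s - δ / 2) t
  refine ⟨k, ?_⟩
  rw [← X.curve_periodic t k] at ht
  have hnot := hb ht
  by_contra hc
  rw [abs_lt] at hc
  refine hnot ⟨_, ⟨?_, by linarith [hk.2]⟩, rfl⟩
  by_contra hc2
  push Not at hc2
  exact hc ⟨by linarith [hk.1], by linarith⟩

end RectCurve

/-! ### Indicators and sums over integer intervals -/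

open Classical in
/-- The indicator of a proposition, as an integer. -/
def ind (P : Prop) : ℤ := if P then 1 else 0

theorem ind_true {P : Prop} (h : P) : ind P = 1 := if_pos h

theorem ind_false {P : Prop} (h : ¬ P) : ind P = 0 := if_neg h

theorem ind_congr {P Q : Prop} (h : P ↔ Q) : ind P = ind Q := by rw [propext h]

theorem ind_nonneg (P : Prop) : 0 ≤ ind P := by unfold ind; split_ifs <;> simp

theorem sum_Ico_succ_right (F : ℤ → ℤ) {a b : ℤ} (h : a ≤ b) :
    ∑ i ∈ Finset.Ico a (b + 1), F i = ∑ i ∈ Finset.Ico a b, F i + F b := by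
  have : Finset.Ico a (b + 1) = insert b (Finset.Ico a b) := by
    ext i; simp only [Finset.mem_Ico, Finset.mem_insert]; omega
  rw [this, Finset.sum_insert (by simp)]; ring

theorem sum_Ico_succ_left (F : ℤ → ℤ) {a b : ℤ} (h : a < b) :
    ∑ i ∈ Finset.Ico a b, F i = F a + ∑ i ∈ Finset.Ico (a + 1) b, F i := by
  have : Finset.Ico a b = insert a (Finset.Ico (a + 1) b) := by
    ext i; simp only [Finset.mem_Ico, Finset.mem_insert]; omega
  rw [this, Finset.sum_insert (by simp)]

theorem sum_Ico_append (F : ℤ → ℤ) {a b c : ℤ} (h : a ≤ b) (h' : b ≤ c) :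
    ∑ i ∈ Finset.Ico a b, F i + ∑ i ∈ Finset.Ico b c, F i = ∑ i ∈ Finset.Ico a c, F i := by
  rw [← Finset.sum_union]
  · congr 1; ext i; simp only [Finset.mem_union, Finset.mem_Ico]; omega
  · rw [Finset.disjoint_left]; intro i; simp only [Finset.mem_Ico]; omega

theorem sum_Ico_telescope (F : ℤ → ℤ) {a b : ℤ} (h : a ≤ b) :
    ∑ i ∈ Finset.Ico a b, (F (i + 1) - F i) = F b - F a := by
  induction b, h using Int.leInduction with
  | base => simp
  | succ b hb ih => rw [sum_Ico_succ_right _ hb, ih]; ring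

theorem sum_Ico_shift (F : ℤ → ℤ) (a b c : ℤ) :
    ∑ i ∈ Finset.Ico a b, F (i + c) = ∑ i ∈ Finset.Ico (a + c) (b + c), F i := by
  refine Finset.sum_bij (fun i _ => i + c) ?_ ?_ ?_ ?_
  · intro i; simp
  · intro i _ j _ h; simpa using h
  · intro i hi; exact ⟨i - c, by simp only [Finset.mem_Ico] at *; omega, by ring⟩
  · intros; rfl

theorem sum_Ico_periodic {F : ℤ → ℤ} {n : ℕ} (hF : ∀ i, F (i + n) = F i) (a : ℤ) :
    ∑ i ∈ Finset.Ico a (a + n), F i = ∑ i ∈ Finset.Ico 0 (n : ℤ), F i := by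
  have step : ∀ a : ℤ, ∑ i ∈ Finset.Ico (a + 1) (a + 1 + n), F i = ∑ i ∈ Finset.Ico a (a + n), F i := by
    intro a
    rcases Nat.eq_zero_or_pos n with rfl | hn
    · simp
    · rw [sum_Ico_succ_left F (a := a) (by omega), show a + 1 + n = a + n + 1 by ring,
        sum_Ico_succ_right F (by omega), hF]; ring
  induction a using Int.induction_on with
  | zero => simp
  | succ i ih => rw [step, ih]
  | pred i ih => rw [← ih, ← step]; simp

/-! ### Winding numbers by counting crossings -/

/-- The contribution of the `i`-th edge to the crossing number of the upward ray from `p`. -/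
def crossing (v : ℤ → Plane) (p : Plane) (i : ℤ) : ℤ :=
  ind (p.2 < (v i).2) * (ind (p.1 < (v (i + 1)).1) - ind (p.1 < (v i).1))

/-- The contribution of the `i`-th edge to the crossing number of the rightward ray from `p`. -/
def crossing' (v : ℤ → Plane) (p : Plane) (i : ℤ) : ℤ :=
  (ind (p.2 < (v i).2) - ind (p.2 < (v (i + 1)).2)) * ind (p.1 < (v (i + 1)).1)

/-- The (clockwise) winding number around `p` of the closed rectilinear curve `v` of period `n`. -/
def wind (n : ℕ) (v : ℤ → Plane) (p : Plane) : ℤ := ∑ i ∈ Finset.Ico 0 (n : ℤ), crossing v p i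

theorem exists_param_horizontal {v : ℤ → Plane} {i : ℤ} (h : (v i).2 = (v (i + 1)).2) {x : ℝ}
    (hx : x ∈ uIcc (v i).1 (v (i + 1)).1) : ∃ t ∈ Icc (0 : ℝ) 1, curve v (i + t) = (x, (v i).2) := by
  rw [← segment_eq_uIcc, segment_eq_image_lineMap] at hx
  obtain ⟨t, ht, rfl⟩ := hx
  refine ⟨t, ht, ?_⟩
  rw [curve_add v i ht.1 ht.2]
  refine Prod.ext ?_ ?_
  · rw [lineMap_fst]; simp [AffineMap.lineMap_apply]; ring
  · rw [lineMap_snd, h]; simp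

theorem exists_param_vertical {v : ℤ → Plane} {i : ℤ} (h : (v i).1 = (v (i + 1)).1) {y : ℝ}
    (hy : y ∈ uIcc (v i).2 (v (i + 1)).2) :
    ∃ t ∈ Icc (0 : ℝ) 1, curve v (i + t) = ((v (i + 1)).1, y) := by
  rw [← segment_eq_uIcc, segment_eq_image_lineMap] at hy
  obtain ⟨t, ht, rfl⟩ := hy
  refine ⟨t, ht, ?_⟩
  rw [curve_add v i ht.1 ht.2]
  refine Prod.ext ?_ ?_
  · rw [lineMap_fst, h]; simp
  · rw [lineMap_snd]; simp [AffineMap.lineMap_apply]; ring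

theorem mem_uIcc_of_ind_ne {a b c : ℝ} (h : ind (c < a) - ind (c < b) ≠ 0) : c ∈ uIcc a b := by
  rw [mem_uIcc]
  by_contra hc
  push Not at hc
  apply h
  rw [sub_eq_zero]
  apply ind_congr
  constructor
  · intro h1; by_contra h2; push Not at h2; linarith [hc.2 h2]
  · intro h1; by_contra h2; push Not at h2; linarith [hc.1 h2]

theorem mem_uIoc_of_ind_ne {a b c : ℝ} (h : ind (a < c) - ind (b < c) ≠ 0) : c ∈ uIcc a b := by
  rw [mem_uIcc]
  by_contra hc
  push Not at hc
  apply h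
  rw [sub_eq_zero]
  apply ind_congr
  constructor
  · intro h1; by_contra h2; push Not at h2; linarith [hc.1 h1.le]
  · intro h1; by_contra h2; push Not at h2; linarith [hc.2 h1.le]

namespace RectCurve

variable {n : ℕ} {v : ℤ → Plane} (X : RectCurve n v)
include X

theorem snd_eq_of_fst_ne {i : ℤ} (h : (v i).1 ≠ (v (i + 1)).1) : (v i).2 = (v (i + 1)).2 := by
  rcases X.horizontal_or_vertical i with (h' | h') | (h' | h')
  · exact h'.1
  · exact h'.1
  · exact absurd h'.1 h
  · exact absurd h'.1 h

theorem fst_eq_of_snd_ne {i : ℤ} (h : (v i).2 ≠ (v (i + 1)).2) : (v i).1 = (v (i + 1)).1 := by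
  by_contra hc; exact h (X.snd_eq_of_fst_ne hc)

theorem wind_eq_sum (a : ℤ) (p : Plane) :
    wind n v p = ∑ i ∈ Finset.Ico a (a + n), crossing v p i := by
  rw [wind, sum_Ico_periodic]
  intro i
  rw [crossing, crossing, X.periodic, show i + n + 1 = i + 1 + n by ring, X.periodic]

/-- Term by term the two crossing counts differ by an increment of the indicator of the open
quadrant to the upper right of `p`, and such increments cancel over a period. Having both counts
matters: the vertical one is easily seen to be constant under vertical motion off the curve, the
horizontal one under horizontal motion. -/
theorem wind_eq_sum' (a : ℤ) (p : Plane) :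
    wind n v p = ∑ i ∈ Finset.Ico a (a + n), crossing' v p i := by
  rw [X.wind_eq_sum a, ← sub_eq_zero, ← Finset.sum_sub_distrib]
  have := sum_Ico_telescope (fun i => ind (p.2 < (v i).2) * ind (p.1 < (v i).1)) (a := a) (b := a + n)
    (by omega)
  simp only [X.periodic, sub_self] at this
  rw [← this]
  refine Finset.sum_congr rfl fun i _ => ?_
  rw [crossing, crossing']; ring

/-- The contribution of an edge changes under vertical motion only when the moving point passes the
height of that edge within its horizontal range. The witness is the point of the edge that is
passed, so off the curve nothing changes. -/
theorem crossing_sub {p q : Plane} (h : p.1 = q.1) {i : ℤ} (hne : crossing v p i ≠ crossing v q i) :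
    ∃ t ∈ Icc (0 : ℝ) 1, curve v (i + t) = (p.1, (v i).2) ∧ (v i).2 ∈ uIcc p.2 q.2 := by
  have h0 : (ind (p.2 < (v i).2) - ind (q.2 < (v i).2)) *
      (ind (p.1 < (v (i + 1)).1) - ind (p.1 < (v i).1)) ≠ 0 := by
    intro h0; apply hne; rw [crossing, crossing, ← h]; linarith
  have h1 := mem_uIoc_of_ind_ne (left_ne_zero_of_mul h0)
  have h2 := mem_uIcc_of_ind_ne (right_ne_zero_of_mul h0)
  have h3 : (v i).1 ≠ (v (i + 1)).1 := by
    intro h3; apply right_ne_zero_of_mul h0; rw [h3]; ring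
  obtain ⟨t, ht, h4⟩ := exists_param_horizontal (X.snd_eq_of_fst_ne h3) (by rwa [uIcc_comm])
  exact ⟨t, ht, h4, h1⟩

theorem crossing'_sub {p q : Plane} (h : p.2 = q.2) {i : ℤ}
    (hne : crossing' v p i ≠ crossing' v q i) :
    ∃ t ∈ Icc (0 : ℝ) 1, curve v (i + t) = ((v (i + 1)).1, p.2) ∧
      (v (i + 1)).1 ∈ uIcc p.1 q.1 := by
  have h0 : (ind (p.2 < (v i).2) - ind (p.2 < (v (i + 1)).2)) *
      (ind (p.1 < (v (i + 1)).1) - ind (q.1 < (v (i + 1)).1)) ≠ 0 := by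
    intro h0; apply hne; rw [crossing', crossing', ← h]; linarith
  have h1 := mem_uIoc_of_ind_ne (right_ne_zero_of_mul h0)
  have h2 := mem_uIcc_of_ind_ne (left_ne_zero_of_mul h0)
  have h3 : (v i).2 ≠ (v (i + 1)).2 := by
    intro h3; apply left_ne_zero_of_mul h0; rw [h3]; ring
  obtain ⟨t, ht, h4⟩ := exists_param_vertical (X.fst_eq_of_snd_ne h3) h2
  exact ⟨t, ht, h4, h1⟩

theorem wind_eq_of_vertical {p q : Plane} (h : p.1 = q.1)
    (hseg : ∀ y ∈ uIcc p.2 q.2, (p.1, y) ∉ trace v) : wind n v p = wind n v q := by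
  refine Finset.sum_congr rfl fun i _ => ?_
  by_contra hne
  obtain ⟨t, -, h1, h2⟩ := X.crossing_sub h hne
  exact hseg _ h2 (h1 ▸ curve_mem_trace v _)

theorem wind_eq_of_horizontal {p q : Plane} (h : p.2 = q.2)
    (hseg : ∀ x ∈ uIcc p.1 q.1, (x, p.2) ∉ trace v) : wind n v p = wind n v q := by
  rw [X.wind_eq_sum' 0, X.wind_eq_sum' 0]
  refine Finset.sum_congr rfl fun i _ => ?_
  by_contra hne
  obtain ⟨t, -, h1, h2⟩ := X.crossing'_sub h hne
  exact hseg _ h2 (h1 ▸ curve_mem_trace v _)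

/-- Balls of the product metric are squares, so an L-shaped path from `q` to `p` stays inside; each
leg is handled by one of the two crossing counts. -/
theorem wind_eq_of_ball {p q : Plane} {r : ℝ} (hb : Metric.ball p r ⊆ (trace v)ᶜ)
    (hq : q ∈ Metric.ball p r) : wind n v q = wind n v p := by
  rw [Metric.mem_ball, Prod.dist_eq, max_lt_iff, Real.dist_eq, Real.dist_eq] at hq
  have hr : 0 < r := (abs_nonneg _).trans_lt hq.1
  trans wind n v (p.1, q.2)
  · refine X.wind_eq_of_horizontal rfl fun x hx => hb ?_
    rw [Metric.mem_ball, Prod.dist_eq, max_lt_iff, Real.dist_eq, Real.dist_eq]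
    refine ⟨?_, hq.2⟩
    refine lt_of_le_of_lt ?_ hq.1
    rw [uIcc_comm] at hx
    exact abs_sub_left_of_mem_uIcc hx
  · symm
    refine X.wind_eq_of_vertical rfl fun y hy => hb ?_
    rw [Metric.mem_ball, Prod.dist_eq, max_lt_iff, Real.dist_eq, Real.dist_eq]
    refine ⟨by simpa using hr, ?_⟩
    refine lt_of_le_of_lt ?_ hq.2
    exact abs_sub_left_of_mem_uIcc hy

theorem continuousOn_wind : ContinuousOn (wind n v) (trace v)ᶜ := by
  intro p hp
  obtain ⟨r, hr, hb⟩ := Metric.isOpen_iff.1 X.isOpen_compl_trace p hp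
  refine ContinuousAt.continuousWithinAt ?_
  refine (continuousAt_const (y := wind n v p)).congr ?_
  filter_upwards [Metric.ball_mem_nhds p hr] with q hq
  exact (X.wind_eq_of_ball hb hq).symm

theorem wind_eq_of_isPreconnected {S : Set Plane} (hS : IsPreconnected S) (h : S ⊆ (trace v)ᶜ)
    {p q : Plane} (hp : p ∈ S) (hq : q ∈ S) : wind n v p = wind n v q :=
  hS.constant (X.continuousOn_wind.mono h) hp hq

/-- The winding number vanishes far away. -/
theorem wind_eq_zero_of_far {R : ℝ} (hR : ∀ i, dist (v i) 0 ≤ R) {p : Plane} (hp : R < dist p 0) :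
    wind n v p = 0 := by
  have h1 : ∀ i, |(v i).1| ≤ R ∧ |(v i).2| ≤ R := fun i => by
    have := hR i
    rw [Prod.dist_eq, max_le_iff, Real.dist_eq, Real.dist_eq] at this
    simpa using this
  rw [Prod.dist_eq, lt_max_iff, Real.dist_eq, Real.dist_eq] at hp
  simp only [Prod.fst_zero, Prod.snd_zero, sub_zero, lt_abs] at hp
  have hx := fun i => abs_le.1 (h1 i).1
  have hy := fun i => abs_le.1 (h1 i).2
  rcases hp with (hp | hp) | (hp | hp)
  · refine Finset.sum_eq_zero fun i _ => ?_
    have e : ∀ i, ind (p.1 < (v i).1) = 0 := fun i => ind_false (by linarith [hx i])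
    rw [crossing, e, e]; ring
  · refine Finset.sum_eq_zero fun i _ => ?_
    have e : ∀ i, ind (p.1 < (v i).1) = 1 := fun i => ind_true (by linarith [hx i])
    rw [crossing, e, e]; ring
  · refine Finset.sum_eq_zero fun i _ => ?_
    have e : ∀ i, ind (p.2 < (v i).2) = 0 := fun i => ind_false (by linarith [hy i])
    rw [crossing, e]; ring
  -- From below the curve an upward ray may cross it, but a rightward ray does not.
  · rw [X.wind_eq_sum' 0]
    refine Finset.sum_eq_zero fun i _ => ?_
    have e : ∀ i, ind (p.2 < (v i).2) = 1 := fun i => ind_true (by linarith [hy i])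
    rw [crossing', e, e]; ring

/-! ### The jump across an edge -/

omit X in
theorem fst_curve_of_vertical {i : ℤ} (h : Vertical v i) {t : ℝ} (ht : t ∈ Icc (i : ℝ) (i + 1)) :
    (curve v t).1 = (v i).1 := by
  rw [curve_eq_lineMap v i ht, lineMap_fst]
  rcases h with h | h <;> rw [h.1] <;> ring

omit X in
theorem snd_curve_of_horizontal {i : ℤ} (h : Horizontal v i) {t : ℝ}
    (ht : t ∈ Icc (i : ℝ) (i + 1)) : (curve v t).2 = (v i).2 := by
  rw [curve_eq_lineMap v i ht, lineMap_snd]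
  rcases h with h | h <;> rw [h.1] <;> ring

/-- Near an interior point of an edge there is only that edge. -/
theorem exists_ball_edge {i : ℤ} {s : ℝ} (hs : s ∈ Ioo (i : ℝ) (i + 1)) :
    ∃ r > 0, ∀ t, dist (curve v t) (curve v s) < r → ∃ k : ℤ, t + k * n ∈ Ioo (i : ℝ) (i + 1) := by
  obtain ⟨r, hr, h⟩ := X.exists_ball s (δ := min (s - i) (i + 1 - s))
    (lt_min (by linarith [hs.1]) (by linarith [hs.2]))
  refine ⟨r, hr, fun t ht => ?_⟩
  obtain ⟨k, hk⟩ := h t ht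
  refine ⟨k, ?_⟩
  rw [abs_lt] at hk
  have h1 := min_le_left (s - i) (i + 1 - s)
  have h2 := min_le_right (s - i) (i + 1 - s)
  exact ⟨by linarith, by linarith⟩

/-- Both ends of the edge `j` are allowed for `t`: the interval around the edge `i` is open, so a
common end point of neighbouring edges is excluded. -/
theorem index_eq {i j : ℤ} {t : ℝ} (ht : t ∈ Icc (0 : ℝ) 1) {k : ℤ}
    (h : (j : ℝ) + t + k * n ∈ Ioo (i : ℝ) (i + 1)) (hj : j ∈ Finset.Ico i (i + n)) : j = i := by
  have h1 : i - 1 < j + k * n := by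
    have : (i : ℝ) - 1 < j + k * n := by linarith [h.1, ht.2]
    exact_mod_cast this
  have h2 : j + k * n < i + 1 := by
    have : (j : ℝ) + k * n < i + 1 := by linarith [h.2, ht.1]
    exact_mod_cast this
  have h3 : j + k * n = i := by omega
  rw [Finset.mem_Ico] at hj
  have hn := X.n_pos
  have : k = 0 := by
    have h4 : -1 < k := by by_contra hc; nlinarith
    have h5 : k < 1 := by by_contra hc; nlinarith
    omega
  subst this; simpa using h3

/-- Near an interior point of an edge the trace is that edge alone, so on a short vertical passage
every other summand of the winding number stays constant, and the jump is the contribution of this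
one edge. -/
theorem jump_horizontal {i : ℤ} (hi : Horizontal v i) {s : ℝ} (hs : s ∈ Ioo (i : ℝ) (i + 1)) :
    ∃ r > 0, ∀ a b : ℝ, (curve v s).2 - r < a → a < (curve v s).2 → (curve v s).2 < b →
      b < (curve v s).2 + r → ((curve v s).1, a) ∉ trace v ∧ ((curve v s).1, b) ∉ trace v ∧
      wind n v ((curve v s).1, a) - wind n v ((curve v s).1, b) =
        ind ((curve v s).1 < (v (i + 1)).1) - ind ((curve v s).1 < (v i).1) := by
  obtain ⟨r, hr, h⟩ := X.exists_ball_edge hs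
  set p := curve v s with hp
  have hpy : p.2 = (v i).2 := snd_curve_of_horizontal hi ⟨hs.1.le, hs.2.le⟩
  have key : ∀ y, |y - p.2| < r → y ≠ p.2 → (p.1, y) ∉ trace v := by
    intro y hy hne hmem
    obtain ⟨t, ht⟩ := mem_trace.1 hmem
    obtain ⟨k, hk⟩ := h t (by
      rw [ht, Prod.dist_eq, Real.dist_eq, Real.dist_eq]; simpa [hr] using hy)
    have := snd_curve_of_horizontal hi ⟨hk.1.le, hk.2.le⟩
    rw [X.curve_periodic, ht] at this
    exact hne (this.trans hpy.symm)
  refine ⟨r, hr, fun a b ha1 ha2 hb1 hb2 => ⟨key a ?_ ha2.ne, key b ?_ hb1.ne', ?_⟩⟩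
  · rw [abs_lt]; constructor <;> linarith
  · rw [abs_lt]; constructor <;> linarith
  · rw [X.wind_eq_sum i, X.wind_eq_sum i, ← Finset.sum_sub_distrib,
      Finset.sum_eq_single_of_mem i (by simpa using X.n_pos)]
    · rw [crossing, crossing, ← hpy, ind_true ha2, ind_false (not_lt.2 hb1.le)]; simp
    · intro j hj hji
      by_contra hne
      obtain ⟨t, ht, h1, h2⟩ := X.crossing_sub (p := (p.1, a)) (q := (p.1, b)) rfl (sub_ne_zero.1 hne)
      obtain ⟨k, hk⟩ := h (j + t) (by
        rw [h1, Prod.dist_eq, Real.dist_eq, Real.dist_eq]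
        simp only [sub_self, abs_zero, max_lt_iff]
        refine ⟨hr, ?_⟩
        rw [uIcc_of_le (by linarith : a ≤ b)] at h2
        rw [abs_lt]; constructor <;> linarith [h2.1, h2.2])
      exact hji (X.index_eq ht hk hj)

theorem jump_vertical {i : ℤ} (hi : Vertical v i) {s : ℝ} (hs : s ∈ Ioo (i : ℝ) (i + 1)) :
    ∃ r > 0, ∀ a b : ℝ, (curve v s).1 - r < a → a < (curve v s).1 → (curve v s).1 < b →
      b < (curve v s).1 + r → (a, (curve v s).2) ∉ trace v ∧ (b, (curve v s).2) ∉ trace v ∧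
      wind n v (a, (curve v s).2) - wind n v (b, (curve v s).2) =
        ind ((curve v s).2 < (v i).2) - ind ((curve v s).2 < (v (i + 1)).2) := by
  obtain ⟨r, hr, h⟩ := X.exists_ball_edge hs
  set p := curve v s with hp
  have hpx : p.1 = (v i).1 := fst_curve_of_vertical hi ⟨hs.1.le, hs.2.le⟩
  have hi1 : (v i).1 = (v (i + 1)).1 := by rcases hi with h | h <;> exact h.1
  have key : ∀ x, |x - p.1| < r → x ≠ p.1 → (x, p.2) ∉ trace v := by
    intro y hy hne hmem
    obtain ⟨t, ht⟩ := mem_trace.1 hmem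
    obtain ⟨k, hk⟩ := h t (by
      rw [ht, Prod.dist_eq, Real.dist_eq, Real.dist_eq]; simpa [hr] using hy)
    have := fst_curve_of_vertical hi ⟨hk.1.le, hk.2.le⟩
    rw [X.curve_periodic, ht] at this
    exact hne (this.trans hpx.symm)
  refine ⟨r, hr, fun a b ha1 ha2 hb1 hb2 => ⟨key a ?_ ha2.ne, key b ?_ hb1.ne', ?_⟩⟩
  · rw [abs_lt]; constructor <;> linarith
  · rw [abs_lt]; constructor <;> linarith
  · rw [X.wind_eq_sum' i, X.wind_eq_sum' i, ← Finset.sum_sub_distrib,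
      Finset.sum_eq_single_of_mem i (by simpa using X.n_pos)]
    · rw [crossing', crossing', ← hi1, ← hpx, ind_true ha2, ind_false (not_lt.2 hb1.le)]; simp
    · intro j hj hji
      by_contra hne
      obtain ⟨t, ht, h1, h2⟩ := X.crossing'_sub (p := (a, p.2)) (q := (b, p.2)) rfl (sub_ne_zero.1 hne)
      obtain ⟨k, hk⟩ := h (j + t) (by
        rw [h1, Prod.dist_eq, Real.dist_eq, Real.dist_eq]
        simp only [sub_self, abs_zero, max_lt_iff]
        refine ⟨?_, hr⟩
        rw [uIcc_of_le (by linarith : a ≤ b)] at h2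
        rw [abs_lt]; constructor <;> linarith [h2.1, h2.2])
      exact hji (X.index_eq ht hk hj)

/-- The winding number to the right of an edge exceeds the one to its left by one. -/
theorem jump {i : ℤ} {s : ℝ} (hs : s ∈ Ioo (i : ℝ) (i + 1)) :
    ∃ r > (0 : ℝ), ∀ ε ∈ Ioo (0 : ℝ) r, curve v s + ε • rightNormal (v (i + 1) - v i) ∉ trace v ∧
      curve v s - ε • rightNormal (v (i + 1) - v i) ∉ trace v ∧
      wind n v (curve v s + ε • rightNormal (v (i + 1) - v i)) =
        wind n v (curve v s - ε • rightNormal (v (i + 1) - v i)) + 1 := by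
  set p := curve v s with hp
  have hsub : ∀ ε : ℝ, p + ε • rightNormal (v (i + 1) - v i) =
      (p.1 + ε * ((v (i + 1)).2 - (v i).2), p.2 - ε * ((v (i + 1)).1 - (v i).1)) := fun ε => by
    ext <;> simp [rightNormal]; ring
  have hsub' : ∀ ε : ℝ, p - ε • rightNormal (v (i + 1) - v i) =
      (p.1 - ε * ((v (i + 1)).2 - (v i).2), p.2 + ε * ((v (i + 1)).1 - (v i).1)) := fun ε => by
    ext <;> simp [rightNormal]; ring
  have small : ∀ {r d ε : ℝ}, 0 < d → ε ∈ Ioo 0 (r / d) → 0 < ε * d ∧ ε * d < r := fun hd hε =>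
    ⟨mul_pos hε.1 hd, (lt_div_iff₀ hd).1 hε.2⟩
  have hs' : s ∈ Icc (i : ℝ) (i + 1) := ⟨hs.1.le, hs.2.le⟩
  have hc := curve_eq_lineMap v i hs'
  have h01 : 0 < s - i := by linarith [hs.1]
  have h02 : s - i < 1 := by linarith [hs.2]
  have hx : p.1 = (v i).1 + (s - i) * ((v (i + 1)).1 - (v i).1) := by rw [hp, hc, lineMap_fst]
  have hy : p.2 = (v i).2 + (s - i) * ((v (i + 1)).2 - (v i).2) := by rw [hp, hc, lineMap_snd]
  rcases X.horizontal_or_vertical i with hi | hi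
  · obtain ⟨r, hr, h⟩ := X.jump_horizontal hi hs
    rw [← hp] at h
    rcases hi with hi | hi
    · have hd : 0 < (v (i + 1)).1 - (v i).1 := sub_pos.2 hi.2
      refine ⟨r / ((v (i + 1)).1 - (v i).1), div_pos hr hd, fun ε hε => ?_⟩
      obtain ⟨e1, e2⟩ := small hd hε
      obtain ⟨h1, h2, h3⟩ := h (p.2 - ε * ((v (i + 1)).1 - (v i).1))
        (p.2 + ε * ((v (i + 1)).1 - (v i).1)) (by linarith) (by linarith) (by linarith)
        (by linarith)
      rw [ind_true (by nlinarith), ind_false (by nlinarith)] at h3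
      rw [hsub, hsub', hi.1, sub_self, mul_zero, add_zero, sub_zero]
      exact ⟨h1, h2, by linarith⟩
    · have hd : 0 < (v i).1 - (v (i + 1)).1 := sub_pos.2 hi.2
      refine ⟨r / ((v i).1 - (v (i + 1)).1), div_pos hr hd, fun ε hε => ?_⟩
      obtain ⟨e1, e2⟩ := small hd hε
      obtain ⟨h1, h2, h3⟩ := h (p.2 + ε * ((v (i + 1)).1 - (v i).1))
        (p.2 - ε * ((v (i + 1)).1 - (v i).1)) (by linarith) (by linarith) (by linarith)
        (by linarith)
      rw [ind_false (by nlinarith), ind_true (by nlinarith)] at h3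
      rw [hsub, hsub', hi.1, sub_self, mul_zero, add_zero, sub_zero]
      exact ⟨h2, h1, by linarith⟩
  · obtain ⟨r, hr, h⟩ := X.jump_vertical hi hs
    rw [← hp] at h
    rcases hi with hi | hi
    · have hd : 0 < (v (i + 1)).2 - (v i).2 := sub_pos.2 hi.2
      refine ⟨r / ((v (i + 1)).2 - (v i).2), div_pos hr hd, fun ε hε => ?_⟩
      obtain ⟨e1, e2⟩ := small hd hε
      obtain ⟨h1, h2, h3⟩ := h (p.1 - ε * ((v (i + 1)).2 - (v i).2))
        (p.1 + ε * ((v (i + 1)).2 - (v i).2)) (by linarith) (by linarith) (by linarith)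
        (by linarith)
      rw [ind_false (by nlinarith), ind_true (by nlinarith)] at h3
      rw [hsub, hsub', hi.1, sub_self, mul_zero, add_zero, sub_zero]
      exact ⟨h2, h1, by linarith⟩
    · have hd : 0 < (v i).2 - (v (i + 1)).2 := sub_pos.2 hi.2
      refine ⟨r / ((v i).2 - (v (i + 1)).2), div_pos hr hd, fun ε hε => ?_⟩
      obtain ⟨e1, e2⟩ := small hd hε
      obtain ⟨h1, h2, h3⟩ := h (p.1 + ε * ((v (i + 1)).2 - (v i).2))
        (p.1 - ε * ((v (i + 1)).2 - (v i).2)) (by linarith) (by linarith) (by linarith)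
        (by linarith)
      rw [ind_true (by nlinarith), ind_false (by nlinarith)] at h3
      rw [hsub, hsub', hi.1, sub_self, mul_zero, add_zero, sub_zero]
      exact ⟨h1, h2, by linarith⟩

end RectCurve

/-! ### Small neighbourhoods of a boundary point have two connected sides -/

theorem isPreconnected_ball_inter {p : Plane} {r : ℝ} {S : Set Plane} (h : Convex ℝ S) :
    IsPreconnected {q | q ∈ Metric.ball p r ∧ q ∈ S} :=
  ((convex_ball p r).inter h).isPreconnected

/-- Only the sign of `c` matters: the factor selects the half-plane, so that the four orientations
of a corner need no separate treatment. -/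
theorem convex_fst_pos (x c : ℝ) : Convex ℝ {q : Plane | 0 < (q.1 - x) * c} := by
  intro a ha b hb s t hs ht hst
  simp only [mem_ofPred_eq, Prod.fst_add, Prod.smul_fst, smul_eq_mul] at *
  have : (s * a.1 + t * b.1 - x) * c = s * ((a.1 - x) * c) + t * ((b.1 - x) * c) := by
    linear_combination (x * c) * hst
  rw [this]
  rcases hs.eq_or_lt with rfl | hs
  · have : t = 1 := by linarith
    subst this; simpa using hb
  · have := mul_pos hs ha
    have := mul_nonneg ht hb.le
    linarith

theorem convex_snd_pos (x c : ℝ) : Convex ℝ {q : Plane | 0 < (q.2 - x) * c} := by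
  intro a ha b hb s t hs ht hst
  simp only [mem_ofPred_eq, Prod.snd_add, Prod.smul_snd, smul_eq_mul] at *
  have : (s * a.2 + t * b.2 - x) * c = s * ((a.2 - x) * c) + t * ((b.2 - x) * c) := by
    linear_combination (x * c) * hst
  rw [this]
  rcases hs.eq_or_lt with rfl | hs
  · have : t = 1 := by linarith
    subst this; simpa using hb
  · have := mul_pos hs ha
    have := mul_nonneg ht hb.le
    linarith

/-- `J` splits arbitrarily small neighbourhoods of `p` into two connected sides. -/
def SplitsAt (J : Set Plane) (p : Plane) : Prop :=
  ∀ U ∈ 𝓝 p, ∃ B ∈ 𝓝 p, B ⊆ U ∧ ∃ P N : Set Plane, IsPreconnected P ∧ IsPreconnected N ∧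
    B \ J = P ∪ N

/-- In a small square around the corner, the complement of the two arms consists of the open
quadrant between them and of two overlapping half-squares, each facing away from one arm. -/
theorem splitsAt_corner {J : Set Plane} {p a b : Plane} (ha : a.2 = p.2) (ha' : a.1 ≠ p.1)
    (hb : b.1 = p.1) (hb' : b.2 ≠ p.2) (hJ : segment ℝ p a ∪ segment ℝ p b ⊆ J)
    (hJ' : ∃ r > 0, ∀ q ∈ J, dist q p < r → q ∈ segment ℝ p a ∪ segment ℝ p b) :
    SplitsAt J p := by
  intro U hU
  obtain ⟨r₁, hr₁, h₁⟩ := hJ'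
  obtain ⟨r₂, hr₂, h₂⟩ := Metric.mem_nhds_iff.1 hU
  have hc : a.1 - p.1 ≠ 0 := sub_ne_zero.2 ha'
  have hd : b.2 - p.2 ≠ 0 := sub_ne_zero.2 hb'
  obtain ⟨r, hr, hrr⟩ : ∃ r > 0, r ≤ r₁ ∧ r ≤ r₂ ∧ r ≤ |a.1 - p.1| ∧ r ≤ |b.2 - p.2| :=
    ⟨min (min r₁ r₂) (min |a.1 - p.1| |b.2 - p.2|), by positivity, by simp, by simp, by simp, by simp⟩
  obtain ⟨hr1, hr2, hr3, hr4⟩ := hrr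
  set c := a.1 - p.1 with hcdef
  set d := b.2 - p.2 with hddef
  have hball : ∀ q ∈ Metric.ball p r, |q.1 - p.1| < r ∧ |q.2 - p.2| < r := by
    intro q hq
    rw [Metric.mem_ball, Prod.dist_eq, max_lt_iff, Real.dist_eq, Real.dist_eq] at hq
    exact hq
  have mul_sq : ∀ {x e : ℝ}, |x| < r → r ≤ |e| → 0 ≤ x * e → e ≠ 0 → x / e ∈ Icc (0 : ℝ) 1 := by
    intro x e hx he hxe hne
    have h1 : 0 ≤ x / e := by
      rw [show x / e = x * e / (e * e) by field_simp]
      exact div_nonneg hxe (mul_self_nonneg e)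
    refine ⟨h1, ?_⟩
    rw [← abs_of_nonneg h1, abs_div, div_le_one (abs_pos.2 hne)]
    linarith
  have arm1 : ∀ q ∈ Metric.ball p r, q.2 = p.2 → 0 ≤ (q.1 - p.1) * c → q ∈ J := by
    intro q hq h2 h
    refine hJ (Or.inl ?_)
    rw [segment_eq_image_lineMap]
    refine ⟨_, mul_sq (hball q hq).1 hr3 h hc, ?_⟩
    refine Prod.ext ?_ ?_
    · rw [lineMap_fst]; field_simp; ring
    · rw [lineMap_snd, ha, h2]; ring
  have arm2 : ∀ q ∈ Metric.ball p r, q.1 = p.1 → 0 ≤ (q.2 - p.2) * d → q ∈ J := by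
    intro q hq h2 h
    refine hJ (Or.inr ?_)
    rw [segment_eq_image_lineMap]
    refine ⟨_, mul_sq (hball q hq).2 hr4 h hd, ?_⟩
    refine Prod.ext ?_ ?_
    · rw [lineMap_fst, hb, h2]; ring
    · rw [lineMap_snd]; field_simp; ring
  have arms : ∀ q ∈ Metric.ball p r, q ∈ J → (q.2 = p.2 ∧ 0 ≤ (q.1 - p.1) * c) ∨
      (q.1 = p.1 ∧ 0 ≤ (q.2 - p.2) * d) := by
    intro q hq hqJ
    have hq' : dist q p < r₁ := (Metric.mem_ball.1 hq).trans_le hr1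
    rcases h₁ q hqJ hq' with h | h <;> rw [segment_eq_image_lineMap] at h <;>
      obtain ⟨t, ht, rfl⟩ := h
    · left
      rw [lineMap_fst, lineMap_snd, ha]
      refine ⟨by ring, ?_⟩
      have : (p.1 + t * (a.1 - p.1) - p.1) * c = t * (c * c) := by rw [hcdef]; ring
      rw [this]; exact mul_nonneg ht.1 (mul_self_nonneg _)
    · right
      rw [lineMap_fst, lineMap_snd, hb]
      refine ⟨by ring, ?_⟩
      have : (p.2 + t * (b.2 - p.2) - p.2) * d = t * (d * d) := by rw [hddef]; ring
      rw [this]; exact mul_nonneg ht.1 (mul_self_nonneg _)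
  refine ⟨Metric.ball p r, Metric.ball_mem_nhds p hr,
    (Metric.ball_subset_ball hr2).trans h₂,
    {q | q ∈ Metric.ball p r ∧ q ∈ {q : Plane | 0 < (q.1 - p.1) * c} ∩ {q : Plane | 0 < (q.2 - p.2) * d}},
    {q | q ∈ Metric.ball p r ∧ q ∈ {q : Plane | 0 < (q.1 - p.1) * -c}} ∪
    {q | q ∈ Metric.ball p r ∧ q ∈ {q : Plane | 0 < (q.2 - p.2) * -d}},
    isPreconnected_ball_inter ((convex_fst_pos _ _).inter (convex_snd_pos _ _)), ?_, ?_⟩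
  · have hc0 : 0 < |c| := abs_pos.2 hc
    have hd0 : 0 < |d| := abs_pos.2 hd
    have e1 : ∀ e : ℝ, e ≠ 0 → |-(r / 2 * (e / |e|))| < r ∧ 0 < -(r / 2 * (e / |e|)) * -e := by
      intro e he
      have he0 : 0 < |e| := abs_pos.2 he
      constructor
      · rw [abs_neg, abs_mul, abs_div e, abs_abs, div_self he0.ne', abs_of_pos (by linarith)]; linarith
      · have : -(r / 2 * (e / |e|)) * -e = r / 2 * (e * e / |e|) := by ring
        rw [this, ← abs_mul_abs_self]
        positivity
    -- The two half-squares are glued at a point of the quadrant opposite to the arms. The quotients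
    -- `c / |c|` and `d / |d|` are signs, and `r / 2` keeps the point inside the square.
    refine IsPreconnected.union
      (p.1 + -(r / 2 * (c / |c|)), p.2 + -(r / 2 * (d / |d|))) ?_ ?_
      (isPreconnected_ball_inter (convex_fst_pos _ _)) (isPreconnected_ball_inter (convex_snd_pos _ _))
    · refine ⟨?_, ?_⟩
      · rw [Metric.mem_ball, Prod.dist_eq, max_lt_iff, Real.dist_eq, Real.dist_eq]
        simp only [add_sub_cancel_left]
        exact ⟨(e1 c hc).1, (e1 d hd).1⟩
      · simp only [mem_ofPred_eq, add_sub_cancel_left]; exact (e1 c hc).2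
    · refine ⟨?_, ?_⟩
      · rw [Metric.mem_ball, Prod.dist_eq, max_lt_iff, Real.dist_eq, Real.dist_eq]
        simp only [add_sub_cancel_left]
        exact ⟨(e1 c hc).1, (e1 d hd).1⟩
      · simp only [mem_ofPred_eq, add_sub_cancel_left]; exact (e1 d hd).2
  · ext q
    simp only [Set.mem_sdiff, mem_union, mem_ofPred_eq, mem_inter_iff]
    constructor
    · rintro ⟨hq, hqJ⟩
      by_cases h1 : (q.1 - p.1) * c < 0
      · right; left; exact ⟨hq, by linarith⟩
      by_cases h2 : (q.2 - p.2) * d < 0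
      · right; right; exact ⟨hq, by linarith⟩
      push Not at h1 h2
      left
      refine ⟨hq, lt_of_le_of_ne h1 ?_, lt_of_le_of_ne h2 ?_⟩
      · intro h0
        rcases mul_eq_zero.1 h0.symm with h | h
        · exact hqJ (arm2 q hq (sub_eq_zero.1 h) h2)
        · exact hc h
      · intro h0
        rcases mul_eq_zero.1 h0.symm with h | h
        · exact hqJ (arm1 q hq (sub_eq_zero.1 h) h1)
        · exact hd h
    · rintro (⟨hq, h1, h2⟩ | ⟨hq, h⟩ | ⟨hq, h⟩) <;> refine ⟨hq, fun hqJ => ?_⟩ <;>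
        rcases arms q hq hqJ with ⟨h3, h4⟩ | ⟨h3, h4⟩
      · rw [h3] at h2; simp at h2
      · rw [h3] at h1; simp at h1
      · linarith
      · rw [h3] at h; simp at h
      · rw [h3] at h; simp at h
      · linarith

theorem splitsAt_horizontal {J : Set Plane} {p : Plane}
    (h : ∃ r > 0, ∀ q, dist q p < r → (q ∈ J ↔ q.2 = p.2)) : SplitsAt J p := by
  intro U hU
  obtain ⟨r₁, hr₁, h₁⟩ := h
  obtain ⟨r₂, hr₂, h₂⟩ := Metric.mem_nhds_iff.1 hU
  refine ⟨Metric.ball p (min r₁ r₂), Metric.ball_mem_nhds p (lt_min hr₁ hr₂),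
    (Metric.ball_subset_ball (min_le_right _ _)).trans h₂, _, _,
    isPreconnected_ball_inter (p := p) (r := min r₁ r₂) (convex_snd_pos p.2 1),
    isPreconnected_ball_inter (p := p) (r := min r₁ r₂) (convex_snd_pos p.2 (-1)), ?_⟩
  ext q
  simp only [Set.mem_sdiff, mem_union, mem_ofPred_eq]
  constructor
  · rintro ⟨hq, hqJ⟩
    rw [h₁ q ((Metric.mem_ball.1 hq).trans_le (min_le_left _ _))] at hqJ
    rcases lt_or_gt_of_ne hqJ with h | h
    · right; exact ⟨hq, by linarith⟩
    · left; exact ⟨hq, by linarith⟩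
  · rintro (⟨hq, h⟩ | ⟨hq, h⟩) <;> refine ⟨hq, ?_⟩ <;>
      rw [h₁ q ((Metric.mem_ball.1 hq).trans_le (min_le_left _ _))] <;> intro h0 <;>
      rw [h0] at h <;> simp at h

theorem splitsAt_vertical {J : Set Plane} {p : Plane}
    (h : ∃ r > 0, ∀ q, dist q p < r → (q ∈ J ↔ q.1 = p.1)) : SplitsAt J p := by
  intro U hU
  obtain ⟨r₁, hr₁, h₁⟩ := h
  obtain ⟨r₂, hr₂, h₂⟩ := Metric.mem_nhds_iff.1 hU
  refine ⟨Metric.ball p (min r₁ r₂), Metric.ball_mem_nhds p (lt_min hr₁ hr₂),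
    (Metric.ball_subset_ball (min_le_right _ _)).trans h₂, _, _,
    isPreconnected_ball_inter (p := p) (r := min r₁ r₂) (convex_fst_pos p.1 1),
    isPreconnected_ball_inter (p := p) (r := min r₁ r₂) (convex_fst_pos p.1 (-1)), ?_⟩
  ext q
  simp only [Set.mem_sdiff, mem_union, mem_ofPred_eq]
  constructor
  · rintro ⟨hq, hqJ⟩
    rw [h₁ q ((Metric.mem_ball.1 hq).trans_le (min_le_left _ _))] at hqJ
    rcases lt_or_gt_of_ne hqJ with h | h
    · right; exact ⟨hq, by linarith⟩
    · left; exact ⟨hq, by linarith⟩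
  · rintro (⟨hq, h⟩ | ⟨hq, h⟩) <;> refine ⟨hq, ?_⟩ <;>
      rw [h₁ q ((Metric.mem_ball.1 hq).trans_le (min_le_left _ _))] <;> intro h0 <;>
      rw [h0] at h <;> simp at h

namespace RectCurve

variable {n : ℕ} {v : ℤ → Plane} (X : RectCurve n v)
include X

theorem splitsAt_vertex (i : ℤ) : SplitsAt (trace v) (v i) := by
  obtain ⟨r, hr, h⟩ := X.exists_ball (i : ℝ) one_pos
  have hseg : segment ℝ (v i) (v (i + 1)) ⊆ trace v := subset_iUnion (fun i => segment ℝ (v i) (v (i + 1))) i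
  have hseg' : segment ℝ (v i) (v (i - 1)) ⊆ trace v := by
    have := subset_iUnion (fun i => segment ℝ (v i) (v (i + 1))) (i - 1)
    simp only [sub_add_cancel] at this
    rw [segment_symm]; exact this
  have hnear : ∀ q ∈ trace v, dist q (v i) < r →
      q ∈ segment ℝ (v i) (v (i + 1)) ∨ q ∈ segment ℝ (v i) (v (i - 1)) := by
    intro q hq hd
    obtain ⟨t, rfl⟩ := mem_trace.1 hq
    rw [← curve_int v i] at hd
    obtain ⟨k, hk⟩ := h t hd
    rw [abs_lt] at hk
    rw [← X.curve_periodic t k]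
    rcases le_total (i : ℝ) (t + k * n) with h | h
    · left
      have h' : t + k * n ∈ Icc (i : ℝ) (i + 1) := ⟨h, by linarith⟩
      rw [curve_eq_lineMap v i h', segment_eq_image_lineMap]
      exact ⟨_, ⟨by linarith, by linarith⟩, rfl⟩
    · right
      have h' : t + k * n ∈ Icc ((i - 1 : ℤ) : ℝ) ((i - 1 : ℤ) + 1) := by
        push_cast; exact ⟨by linarith, by linarith⟩
      rw [curve_eq_lineMap v (i - 1) h', segment_symm, segment_eq_image_lineMap, sub_add_cancel]
      push_cast
      exact ⟨_, ⟨by linarith, by linarith⟩, rfl⟩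
  have e := sub_add_cancel i 1
  rcases X.horizontal_or_vertical i with hi | hi
  · have hj := X.vertical_pred.2 hi
    refine splitsAt_corner (a := v (i + 1)) (b := v (i - 1)) ?_ ?_ ?_ ?_ (union_subset hseg hseg') ⟨r, hr, hnear⟩
    · rcases hi with h | h <;> exact h.1.symm
    · rcases hi with h | h; exacts [h.2.ne', h.2.ne]
    · rcases hj with h | h <;> have := h.1 <;> rwa [e] at this
    · rcases hj with h | h <;> have := h.2 <;> rw [e] at this; exacts [this.ne, this.ne']
  · have hj := X.horizontal_pred.2 hi
    refine splitsAt_corner (a := v (i - 1)) (b := v (i + 1)) ?_ ?_ ?_ ?_ (union_subset hseg' hseg)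
      ⟨r, hr, fun q hq hd => (hnear q hq hd).symm⟩
    · rcases hj with h | h <;> have := h.1 <;> rwa [e] at this
    · rcases hj with h | h <;> have := h.2 <;> rw [e] at this; exacts [this.ne, this.ne']
    · rcases hi with h | h <;> exact h.1.symm
    · rcases hi with h | h; exacts [h.2.ne', h.2.ne]

theorem splitsAt_edge {i : ℤ} {s : ℝ} (hs : s ∈ Ioo (i : ℝ) (i + 1)) :
    SplitsAt (trace v) (curve v s) := by
  obtain ⟨r, hr, h⟩ := X.exists_ball_edge hs
  have hs' : s ∈ Icc (i : ℝ) (i + 1) := ⟨hs.1.le, hs.2.le⟩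
  have hc := curve_eq_lineMap v i hs'
  set p := curve v s with hp
  have hx : p.1 = (v i).1 + (s - i) * ((v (i + 1)).1 - (v i).1) := by rw [hc, lineMap_fst]
  have hy : p.2 = (v i).2 + (s - i) * ((v (i + 1)).2 - (v i).2) := by rw [hc, lineMap_snd]
  have e1 : 0 < s - i := by linarith [hs.1]
  have e2 : 0 < i + 1 - s := by linarith [hs.2]
  have between : ∀ {a b c x δ : ℝ}, c = a + (s - i) * (b - a) → δ ≤ (s - i) * |b - a| →
      δ ≤ (i + 1 - s) * |b - a| → |x - c| < δ → x ∈ uIcc a b := by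
    intro a b c x δ hcc hm hm' hx
    rw [abs_lt] at hx
    rw [mem_uIcc]
    rcases le_total 0 (b - a) with hab | hab
    · rw [abs_of_nonneg hab] at hm hm'
      left; constructor <;> nlinarith
    · rw [abs_of_nonpos hab] at hm hm'
      right; constructor <;> nlinarith
  rcases X.horizontal_or_vertical i with hi | hi
  · apply splitsAt_horizontal
    have hyy : p.2 = (v i).2 := snd_curve_of_horizontal hi hs'
    have hne : 0 < |(v (i + 1)).1 - (v i).1| := by
      rw [abs_pos, sub_ne_zero]
      rcases hi with h | h; exacts [h.2.ne', h.2.ne]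
    have hi1 : (v i).2 = (v (i + 1)).2 := by rcases hi with h | h <;> exact h.1
    refine ⟨min r (min ((s - i) * |(v (i + 1)).1 - (v i).1|) ((i + 1 - s) * |(v (i + 1)).1 - (v i).1|)),
      by positivity, fun q hq => ⟨fun hqJ => ?_, fun hq2 => ?_⟩⟩
    · obtain ⟨t, rfl⟩ := mem_trace.1 hqJ
      obtain ⟨k, hk⟩ := h t (hq.trans_le (min_le_left _ _))
      rw [← X.curve_periodic t k, snd_curve_of_horizontal hi ⟨hk.1.le, hk.2.le⟩, hyy]
    · rw [Prod.dist_eq, max_lt_iff, Real.dist_eq] at hq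
      obtain ⟨t, -, ht⟩ := exists_param_horizontal hi1 (x := q.1)
        (between hx ((min_le_right _ _).trans (min_le_left _ _))
          ((min_le_right _ _).trans (min_le_right _ _)) hq.1)
      rw [← hyy, ← hq2] at ht
      exact mem_trace.2 ⟨_, ht⟩
  · apply splitsAt_vertical
    have hxx : p.1 = (v i).1 := fst_curve_of_vertical hi hs'
    have hne : 0 < |(v (i + 1)).2 - (v i).2| := by
      rw [abs_pos, sub_ne_zero]
      rcases hi with h | h; exacts [h.2.ne', h.2.ne]
    have hi1 : (v i).1 = (v (i + 1)).1 := by rcases hi with h | h <;> exact h.1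
    refine ⟨min r (min ((s - i) * |(v (i + 1)).2 - (v i).2|) ((i + 1 - s) * |(v (i + 1)).2 - (v i).2|)),
      by positivity, fun q hq => ⟨fun hqJ => ?_, fun hq2 => ?_⟩⟩
    · obtain ⟨t, rfl⟩ := mem_trace.1 hqJ
      obtain ⟨k, hk⟩ := h t (hq.trans_le (min_le_left _ _))
      rw [← X.curve_periodic t k, fst_curve_of_vertical hi ⟨hk.1.le, hk.2.le⟩, hxx]
    · rw [Prod.dist_eq, max_lt_iff, Real.dist_eq, Real.dist_eq] at hq
      obtain ⟨t, -, ht⟩ := exists_param_vertical hi1 (y := q.2)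
        (between hy ((min_le_right _ _).trans (min_le_left _ _))
          ((min_le_right _ _).trans (min_le_right _ _)) hq.2)
      rw [← hi1, ← hxx, ← hq2] at ht
      exact mem_trace.2 ⟨_, ht⟩

theorem splitsAt {p : Plane} (hp : p ∈ trace v) : SplitsAt (trace v) p := by
  obtain ⟨s, rfl⟩ := mem_trace.1 hp
  rcases (Int.floor_le s).lt_or_eq with h | h
  · exact X.splitsAt_edge ⟨h, Int.lt_floor_add_one s⟩
  · rw [← h, curve_int]; exact X.splitsAt_vertex _

-- The jump of the winding number is known only at interior points of edges. A neighbourhood of a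
-- vertex borrows it from such a point nearby.
omit X in
theorem exists_edge_point_mem {s : ℝ} {U : Set Plane} (hU : U ∈ 𝓝 (curve v s)) :
    ∃ i : ℤ, ∃ t ∈ Ioo (i : ℝ) (i + 1), U ∈ 𝓝 (curve v t) := by
  have h1 : ∀ᶠ t in 𝓝[>] s, U ∈ 𝓝 (curve v t) := by
    have := (continuous_curve v).continuousAt (x := s) |>.eventually (eventually_mem_nhds_iff.2 hU)
    exact this.filter_mono nhdsWithin_le_nhds
  have h2 : ∀ᶠ t in 𝓝[>] s, t ∈ Ioo s (⌊s⌋ + 1 : ℝ) := Ioo_mem_nhdsGT (Int.lt_floor_add_one s)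
  obtain ⟨t, ht1, ht2⟩ := (h1.and h2).exists
  exact ⟨⌊s⌋, t, ⟨(Int.floor_le s).trans_lt ht2.1, ht2.2⟩, ht1⟩

/-- The winding number is constant on each of the two connected sides. At an edge point inside `B`
it jumps by one, so the points to the right and to the left of that edge lie on different sides; the
side with the larger value is called `P`. -/
theorem local_sides {p : Plane} (hp : p ∈ trace v) {U : Set Plane} (hU : U ∈ 𝓝 p) :
    ∃ B ∈ 𝓝 p, B ⊆ U ∧ ∃ c : ℤ, ∃ P N : Set Plane, IsPreconnected P ∧ IsPreconnected N ∧
      P.Nonempty ∧ N.Nonempty ∧ B \ trace v = P ∪ N ∧ (∀ q ∈ P, wind n v q = c + 1) ∧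
      ∀ q ∈ N, wind n v q = c := by
  obtain ⟨B, hB, hBU, P, N, hP, hN, hPN⟩ := X.splitsAt hp U hU
  obtain ⟨s, rfl⟩ := mem_trace.1 hp
  obtain ⟨i, t, ht, hBt⟩ := exists_edge_point_mem hB
  obtain ⟨r, hr, hj⟩ := X.jump ht
  set w := rightNormal (v (i + 1) - v i)
  have hc1 : ContinuousAt (fun ε : ℝ => curve v t + ε • w) 0 := by fun_prop
  have hc2 : ContinuousAt (fun ε : ℝ => curve v t - ε • w) 0 := by fun_prop
  have h1 : ∀ᶠ ε in 𝓝[>] (0 : ℝ), curve v t + ε • w ∈ B :=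
    (hc1.eventually (by simpa using hBt)).filter_mono nhdsWithin_le_nhds
  have h2 : ∀ᶠ ε in 𝓝[>] (0 : ℝ), curve v t - ε • w ∈ B :=
    (hc2.eventually (by simpa using hBt)).filter_mono nhdsWithin_le_nhds
  obtain ⟨ε, ⟨hε1, hε2⟩, hε⟩ := ((h1.and h2).and (Ioo_mem_nhdsGT hr)).exists
  obtain ⟨k1, k2, k3⟩ := hj ε hε
  set q₁ := curve v t + ε • w
  set q₂ := curve v t - ε • w
  have hPJ : P ⊆ (trace v)ᶜ := fun q hq => (hPN.symm.subset (Or.inl hq)).2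
  have hNJ : N ⊆ (trace v)ᶜ := fun q hq => (hPN.symm.subset (Or.inr hq)).2
  have m1 : q₁ ∈ P ∪ N := hPN.subset ⟨hε1, k1⟩
  have m2 : q₂ ∈ P ∪ N := hPN.subset ⟨hε2, k2⟩
  refine ⟨B, hB, hBU, wind n v q₂, ?_⟩
  rcases m1 with m1 | m1 <;> rcases m2 with m2 | m2
  · have := X.wind_eq_of_isPreconnected hP hPJ m1 m2; omega
  · exact ⟨P, N, hP, hN, ⟨_, m1⟩, ⟨_, m2⟩, hPN,
      fun q hq => k3 ▸ X.wind_eq_of_isPreconnected hP hPJ hq m1,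
      fun q hq => X.wind_eq_of_isPreconnected hN hNJ hq m2⟩
  · exact ⟨N, P, hN, hP, ⟨_, m1⟩, ⟨_, m2⟩, by rw [hPN, union_comm],
      fun q hq => k3 ▸ X.wind_eq_of_isPreconnected hN hNJ hq m1,
      fun q hq => X.wind_eq_of_isPreconnected hP hPJ hq m2⟩
  · have := X.wind_eq_of_isPreconnected hN hNJ m1 m2; omega

end RectCurve

/-! ### The Jordan curve theorem for rectilinear curves -/

/-- A component of the complement of a nonempty closed set touches this set. -/
theorem exists_mem_closure_component {J : Set Plane} (hJ : IsClosed J) (hne : J.Nonempty) {q : Plane}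
    (hq : q ∉ J) : ∃ p ∈ J, p ∈ closure (connectedComponentIn Jᶜ q) := by
  set C := connectedComponentIn Jᶜ q with hC
  have hqC : q ∈ C := mem_connectedComponentIn hq
  have hCo : IsOpen C := hJ.isOpen_compl.connectedComponentIn
  by_contra hcon
  push Not at hcon
  have hcl : IsClosed C := by
    rw [← closure_subset_iff_isClosed]
    intro x hx
    have hxJ : x ∉ J := fun h => hcon x h hx
    have hxo : IsOpen (connectedComponentIn Jᶜ x) := hJ.isOpen_compl.connectedComponentIn
    obtain ⟨y, hy1, hy2⟩ := mem_closure_iff.1 hx _ hxo (mem_connectedComponentIn hxJ)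
    rw [hC, connectedComponentIn_eq hy2, ← connectedComponentIn_eq hy1]
    exact mem_connectedComponentIn hxJ
  obtain ⟨p, hp⟩ := hne
  have huniv : C = univ := IsClopen.eq_univ ⟨hcl, hCo⟩ ⟨q, hqC⟩
  have : p ∈ C := huniv ▸ mem_univ p
  exact connectedComponentIn_subset _ _ this hp

namespace RectCurve

variable {n : ℕ} {v : ℤ → Plane} (X : RectCurve n v)
include X

theorem wind_eq_of_mem_component {p q : Plane} (h : q ∈ connectedComponentIn (trace v)ᶜ p) :
    wind n v q = wind n v p := by
  have hp : p ∈ (trace v)ᶜ := connectedComponentIn_nonempty_iff.1 ⟨q, h⟩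
  exact X.wind_eq_of_isPreconnected isPreconnected_connectedComponentIn
    (connectedComponentIn_subset _ _) h (mem_connectedComponentIn hp)

/-- The two sides of a simple closed rectilinear curve. -/
theorem exists_sides : ∃ c : ℤ, ∃ P N : Plane, P ∉ trace v ∧ N ∉ trace v ∧ wind n v P = c + 1 ∧
    wind n v N = c ∧ (∀ q ∉ trace v, q ∈ connectedComponentIn (trace v)ᶜ P ∨
      q ∈ connectedComponentIn (trace v)ᶜ N) ∧
    ∀ p ∈ trace v, ∀ U ∈ 𝓝 p, (∃ q ∈ U, q ∉ trace v ∧ wind n v q = c + 1) ∧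
      ∃ q ∈ U, q ∉ trace v ∧ wind n v q = c := by
  classical
  have hloc := fun p : trace v => X.local_sides p.2 (U := univ) univ_mem
  choose B hB hBU c P N hP hN hPne hNne hPN hPw hNw using hloc
  have hPJ : ∀ p, P p ⊆ (trace v)ᶜ := fun p q hq => ((hPN p).symm.subset (Or.inl hq)).2
  have hNJ : ∀ p, N p ⊆ (trace v)ᶜ := fun p q hq => ((hPN p).symm.subset (Or.inr hq)).2
  set CP := fun p => connectedComponentIn (trace v)ᶜ (hPne p).some with hCP
  set CN := fun p => connectedComponentIn (trace v)ᶜ (hNne p).some with hCN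
  have hPC : ∀ p, ∀ q ∈ P p, connectedComponentIn (trace v)ᶜ q = CP p := fun p q hq =>
    (connectedComponentIn_eq ((hP p).subset_connectedComponentIn (hPne p).some_mem (hPJ p) hq)).symm
  have hNC : ∀ p, ∀ q ∈ N p, connectedComponentIn (trace v)ᶜ q = CN p := fun p q hq =>
    (connectedComponentIn_eq ((hN p).subset_connectedComponentIn (hNne p).some_mem (hNJ p) hq)).symm
  have memP : ∀ p, ∀ q ∈ B p, q ∉ trace v → wind n v q = c p + 1 → q ∈ P p := by
    intro p q hq hqJ hw
    rcases (hPN p).subset ⟨hq, hqJ⟩ with h | h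
    · exact h
    · have := hNw p q h; omega
  have memN : ∀ p, ∀ q ∈ B p, q ∉ trace v → wind n v q = c p → q ∈ N p := by
    intro p q hq hqJ hw
    rcases (hPN p).subset ⟨hq, hqJ⟩ with h | h
    · have := hPw p q h; omega
    · exact h
  have hval : ∀ p, ∀ q ∈ B p, q ∉ trace v → wind n v q = c p ∨ wind n v q = c p + 1 := by
    intro p q hq hqJ
    rcases (hPN p).subset ⟨hq, hqJ⟩ with h | h
    · exact Or.inr (hPw p q h)
    · exact Or.inl (hNw p q h)
  -- comparison at a point close to `p`
  have cmp : ∀ p p' : trace v, ∀ U ∈ 𝓝 (p' : Plane), U ⊆ B p → ∃ q₁ ∈ U, ∃ q₂ ∈ U,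
      q₁ ∈ P p ∧ q₂ ∈ N p := by
    intro p p' U hU hUB
    obtain ⟨B', hB', hBU', c', P', N', -, -, ⟨q₁, h₁⟩, ⟨q₂, h₂⟩, hPN', hPw', hNw'⟩ :=
      X.local_sides p'.2 hU
    have k1 : q₁ ∈ B' \ trace v := hPN'.symm.subset (Or.inl h₁)
    have k2 : q₂ ∈ B' \ trace v := hPN'.symm.subset (Or.inr h₂)
    have w1 := hPw' q₁ h₁
    have w2 := hNw' q₂ h₂
    have v1 := hval p q₁ (hUB (hBU' k1.1)) k1.2
    have v2 := hval p q₂ (hUB (hBU' k2.1)) k2.2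
    exact ⟨q₁, hBU' k1.1, q₂, hBU' k2.1, memP p q₁ (hUB (hBU' k1.1)) k1.2 (by omega),
      memN p q₂ (hUB (hBU' k2.1)) k2.2 (by omega)⟩
  -- The lower value and the two components seen from a boundary point are locally constant along
  -- the trace, because overlapping neighbourhoods share points of both sides. The trace is
  -- connected, so they do not depend on the point.
  have hconst : ∀ p p' : trace v, c p = c p' ∧ CP p = CP p' ∧ CN p = CN p' := by
    have : PreconnectedSpace (trace v) := Subtype.preconnectedSpace (isPreconnected_trace v)
    have : Std.Symm fun p p' : trace v => c p = c p' ∧ CP p = CP p' ∧ CN p = CN p' :=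
      ⟨fun p p' h => ⟨h.1.symm, h.2.1.symm, h.2.2.symm⟩⟩
    refine PreconnectedSpace.induction₂ (fun p p' : trace v => c p = c p' ∧ CP p = CP p' ∧ CN p = CN p')
      ?_ ⟨fun a b c h h' => ⟨h.1.trans h'.1, h.2.1.trans h'.2.1, h.2.2.trans h'.2.2⟩⟩
    intro p
    have : ∀ᶠ p' : trace v in 𝓝 p, B p ∈ 𝓝 (p' : Plane) :=
      continuous_subtype_val.continuousAt.eventually (eventually_mem_nhds_iff.2 (hB p))
    filter_upwards [this] with p' hp'
    obtain ⟨q₁, m1, q₂, m2, hq₁, hq₂⟩ := cmp p p' _ (inter_mem hp' (hB p')) inter_subset_left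
    have v1 := hval p' q₁ m1.2 (hPJ p hq₁)
    have v2 := hval p' q₂ m2.2 (hNJ p hq₂)
    have w1 := hPw p q₁ hq₁
    have w2 := hNw p q₂ hq₂
    have hc : c p = c p' := by omega
    refine ⟨hc, ?_, ?_⟩
    · rw [← hPC p q₁ hq₁, hPC p' q₁ (memP p' q₁ m1.2 (hPJ p hq₁) (by omega))]
    · rw [← hNC p q₂ hq₂, hNC p' q₂ (memN p' q₂ m2.2 (hNJ p hq₂) (by omega))]
  let p₀ : trace v := ⟨v 0, mem_trace.2 ⟨_, curve_int v 0⟩⟩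
  refine ⟨c p₀, (hPne p₀).some, (hNne p₀).some, hPJ _ (hPne p₀).some_mem, hNJ _ (hNne p₀).some_mem,
    hPw _ _ (hPne p₀).some_mem, hNw _ _ (hNne p₀).some_mem, ?_, ?_⟩
  -- The component of `q` has a point of the trace in its closure and therefore meets one of the two
  -- local sides there.
  · intro q hq
    obtain ⟨p, hp, hpc⟩ := exists_mem_closure_component X.isCompact_trace.isClosed ⟨_, p₀.2⟩ hq
    obtain ⟨x, hxB, hxC⟩ := mem_closure_iff_nhds.1 hpc _ (hB ⟨p, hp⟩)
    have hqx : connectedComponentIn (trace v)ᶜ q = connectedComponentIn (trace v)ᶜ x :=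
      connectedComponentIn_eq hxC
    have hq' := mem_connectedComponentIn (show q ∈ (trace v)ᶜ from hq)
    rw [hqx] at hq'
    rcases (hPN ⟨p, hp⟩).subset ⟨hxB, connectedComponentIn_subset _ _ hxC⟩ with h | h
    · left
      rwa [hPC _ _ h, (hconst ⟨p, hp⟩ p₀).2.1] at hq'
    · right
      rwa [hNC _ _ h, (hconst ⟨p, hp⟩ p₀).2.2] at hq'
  · intro p hp U hU
    obtain ⟨q₁, m1, q₂, m2, hq₁, hq₂⟩ :=
      cmp ⟨p, hp⟩ ⟨p, hp⟩ _ (inter_mem hU (hB ⟨p, hp⟩)) inter_subset_right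
    rw [← (hconst ⟨p, hp⟩ p₀).1]
    exact ⟨⟨q₁, m1.1, hPJ _ hq₁, hPw _ _ hq₁⟩, ⟨q₂, m2.1, hNJ _ hq₂, hNw _ _ hq₂⟩⟩

theorem isOpen_wind_eq (e : ℤ) : IsOpen {q | q ∉ trace v ∧ wind n v q = e} := by
  rw [Metric.isOpen_iff]
  rintro p ⟨hp, hw⟩
  obtain ⟨r, hr, hb⟩ := Metric.isOpen_iff.1 X.isOpen_compl_trace p hp
  exact ⟨r, hr, fun q hq => ⟨hb hq, by rw [X.wind_eq_of_ball hb hq, hw]⟩⟩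

theorem exists_far : ∃ R, ∀ p : Plane, R < dist p 0 → p ∉ trace v ∧ wind n v p = 0 := by
  obtain ⟨R, hR⟩ := X.isCompact_trace.isBounded.subset_closedBall (0 : Plane)
  refine ⟨R, fun p hp => ⟨fun h => hp.not_ge (hR h), X.wind_eq_zero_of_far (fun i => ?_) hp⟩⟩
  exact hR (mem_trace.2 ⟨_, curve_int v i⟩)

omit X in
theorem exists_dist_gt (R : ℝ) : ∃ p : Plane, R < dist p 0 := by
  refine ⟨(|R| + 1, 0), ?_⟩
  rw [Prod.dist_eq, lt_max_iff, Real.dist_eq]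
  left
  simp only [Prod.fst_zero, sub_zero]
  rw [abs_of_pos (by positivity)]
  linarith [le_abs_self R]

/-- Jordan curve theorem for simple closed rectilinear curves, in terms of winding numbers. -/
theorem jordan : ∃ c : ℤ, (c = 0 ∨ c = -1) ∧ (∀ q ∉ trace v, wind n v q = c ∨ wind n v q = c + 1) ∧
    (∀ e, IsPreconnected {q | q ∉ trace v ∧ wind n v q = e}) ∧
    ∀ p ∈ trace v, ∀ U ∈ 𝓝 p, (∃ q ∈ U, q ∉ trace v ∧ wind n v q = c + 1) ∧
      ∃ q ∈ U, q ∉ trace v ∧ wind n v q = c := by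
  obtain ⟨c, P, N, hP, hN, hPw, hNw, hcov, hnear⟩ := X.exists_sides
  have hval : ∀ q ∉ trace v, wind n v q = c ∨ wind n v q = c + 1 := by
    intro q hq
    rcases hcov q hq with h | h
    · right; rw [X.wind_eq_of_mem_component h, hPw]
    · left; rw [X.wind_eq_of_mem_component h, hNw]
  refine ⟨c, ?_, hval, ?_, hnear⟩
  -- Far away the winding number is 0, so 0 is one of the two values `c` and `c + 1`.
  · obtain ⟨R, hR⟩ := X.exists_far
    obtain ⟨p, hp⟩ := exists_dist_gt R
    have := hR p hp
    have := hval p this.1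
    omega
  · intro e
    by_cases h1 : e = c + 1
    · convert isPreconnected_connectedComponentIn (x := P) (F := (trace v)ᶜ) using 1
      ext q
      constructor
      · rintro ⟨hq, hw⟩
        rcases hcov q hq with h | h
        · exact h
        · have := X.wind_eq_of_mem_component h; omega
      · exact fun h => ⟨connectedComponentIn_subset _ _ h, by rw [X.wind_eq_of_mem_component h]; omega⟩
    by_cases h2 : e = c
    · convert isPreconnected_connectedComponentIn (x := N) (F := (trace v)ᶜ) using 1
      ext q
      constructor
      · rintro ⟨hq, hw⟩
        rcases hcov q hq with h | h
        · have := X.wind_eq_of_mem_component h; omega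
        · exact h
      · exact fun h => ⟨connectedComponentIn_subset _ _ h, by rw [X.wind_eq_of_mem_component h]; omega⟩
    · convert isPreconnected_empty using 1
      refine eq_empty_of_forall_notMem ?_
      rintro q ⟨hq, hw⟩
      have := hval q hq
      omega

/-- Points far away have winding number 0. A component with another value therefore stays in a fixed
ball, while the level set of 0 is connected and contains all far points, so the components of its
points are unbounded. -/
theorem innerRegion_eq : innerRegion (trace v) = {p | p ∉ trace v ∧ wind n v p ≠ 0} := by
  obtain ⟨R, hR⟩ := X.exists_far
  ext p
  simp only [innerRegion, mem_ofPred_eq]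
  refine and_congr_right fun hp => ?_
  constructor
  · intro hb hw
    obtain ⟨R', hR'⟩ := hb.subset_closedBall (0 : Plane)
    obtain ⟨q, hq⟩ := exists_dist_gt (max R R')
    rw [max_lt_iff] at hq
    obtain ⟨c, -, -, hconn, -⟩ := X.jordan
    have := (hconn 0).subset_connectedComponentIn (F := (trace v)ᶜ) ⟨hp, hw⟩ (fun x hx => hx.1)
      (hR q hq.1)
    exact hq.2.not_ge (hR' this)
  · intro hw
    refine (Metric.isBounded_closedBall (x := (0 : Plane)) (r := R)).subset fun q hq => ?_
    by_contra hc
    rw [Metric.mem_closedBall, not_le] at hc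
    exact hw (by rw [← X.wind_eq_of_mem_component hq, (hR q hc).2])

theorem wind_eventually_jump {i : ℤ} {p : Plane} (hp : p ∈ openSegment ℝ (v i) (v (i + 1))) :
    ∀ᶠ ε in 𝓝[>] (0 : ℝ), p + ε • rightNormal (v (i + 1) - v i) ∉ trace v ∧
      p - ε • rightNormal (v (i + 1) - v i) ∉ trace v ∧
      wind n v (p + ε • rightNormal (v (i + 1) - v i)) =
        wind n v (p - ε • rightNormal (v (i + 1) - v i)) + 1 := by
  rw [openSegment_eq_image_lineMap] at hp
  obtain ⟨t, ht, rfl⟩ := hp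
  rw [← curve_add v i ht.1.le ht.2.le]
  obtain ⟨r, hr, h⟩ := X.jump (i := i) (s := i + t) ⟨by linarith [ht.1], by linarith [ht.2]⟩
  filter_upwards [Ioo_mem_nhdsGT hr] with ε hε using h ε hε

/-- The curve is traversed clockwise iff its winding numbers are nonnegative. -/
theorem clockwise_of_nonneg (h : ∀ p ∉ trace v, 0 ≤ wind n v p) (i : ℤ) :
    ∀ p ∈ openSegment ℝ (v i) (v (i + 1)),
      ∀ᶠ ε in 𝓝[>] (0 : ℝ), p + ε • rightNormal (v (i + 1) - v i) ∈ innerRegion (trace v) := by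
  intro p hp
  filter_upwards [X.wind_eventually_jump hp] with ε hε
  rw [X.innerRegion_eq]
  refine ⟨hε.1, ?_⟩
  have := h _ hε.2.1
  omega

end RectCurve

/-! ### Winding numbers of holes -/

namespace Hole

variable (H : Hole)

/-- The winding number around a point with respect to the boundary of the hole. -/
def w (p : Plane) : ℤ := wind H.n H.v p

/-- `RectCurve.jordan` leaves the values `{0, 1}` and `{-1, 0}`. The field `clockwise` decides: the
larger value is taken to the right of an edge, where the inner region lies, so it is not 0. -/
theorem w_facts : (∀ q ∉ H.boundary, H.w q = 0 ∨ H.w q = 1) ∧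
    (∀ e, IsPreconnected {q | q ∉ H.boundary ∧ H.w q = e}) ∧
    ∀ p ∈ H.boundary, ∀ U ∈ 𝓝 p, (∃ q ∈ U, q ∉ H.boundary ∧ H.w q = 1) ∧
      ∃ q ∈ U, q ∉ H.boundary ∧ H.w q = 0 := by
  have X := H.rectCurve
  obtain ⟨c, hc, hval, hconn, hnear⟩ := X.jordan
  have hmid : curve H.v ((0 : ℤ) + 1 / 2) ∈ openSegment ℝ (H.v 0) (H.v (0 + 1)) := by
    rw [curve_add H.v 0 (by norm_num) (by norm_num), openSegment_eq_image_lineMap]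
    exact ⟨1 / 2, by norm_num, rfl⟩
  obtain ⟨ε, h1, h2⟩ := ((X.wind_eventually_jump hmid).and (H.clockwise 0 _ hmid)).exists
  rw [X.innerRegion_eq] at h2
  have v1 := hval _ h1.1
  have v2 := hval _ h1.2.1
  have h3 := h2.2
  have : c = 0 := by omega
  subst this
  exact ⟨hval, hconn, hnear⟩

theorem inner_eq : H.inner = {p | p ∉ H.boundary ∧ H.w p = 1} := by
  rw [inner, boundary, H.rectCurve.innerRegion_eq]
  ext p
  simp only [mem_ofPred_eq]
  refine and_congr_right fun hp => ?_
  have := H.w_facts.1 p hp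
  simp only [w] at *
  omega

theorem isPreconnected_inner : IsPreconnected H.inner := by
  rw [H.inner_eq]; exact H.w_facts.2.1 1

theorem inner_nonempty : H.inner.Nonempty := by
  obtain ⟨⟨q, -, hq⟩, -⟩ := H.w_facts.2.2 (H.v 0) (mem_trace.2 ⟨_, curve_int H.v 0⟩) univ univ_mem
  exact ⟨q, by rw [H.inner_eq]; exact hq⟩

theorem isOpen_inner : IsOpen H.inner := by
  rw [H.inner_eq]; exact H.rectCurve.isOpen_wind_eq 1

end Hole

/-! ### Hopf's theorem on the turning number -/

/-- The exponential map is a covering, so a lift of a constant map on a preconnected set is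
constant. This compares two continuous logarithms of the same function. -/
theorem eq_of_exp_eq {α : Type*} [TopologicalSpace α] {S : Set α} (hS : IsPreconnected S) {F : α → ℂ}
    (hF : ContinuousOn F S) {d : ℂ} (h : ∀ x ∈ S, Complex.exp (F x) = d) {x y : α} (hx : x ∈ S)
    (hy : y ∈ S) : F x = F y :=
  Complex.isCoveringMap_exp.constOn_of_comp hS hF
    (fun a ha b hb => Subtype.ext ((h a ha).trans (h b hb).symm)) hx hy

/-- The change of a continuous argument along a path in a slit plane. -/
theorem im_sub_eq_arg_sub {g h : ℝ → ℂ} {a b : ℝ} (hab : a ≤ b) (hg : ContinuousOn g (Icc a b))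
    (hh : ContinuousOn h (Icc a b)) {d : ℂ} (hgh : ∀ t ∈ Icc a b, Complex.exp (g t) = d * h t)
    (hs : ∀ t ∈ Icc a b, h t ∈ Complex.slitPlane) :
    (g b - g a).im = Complex.arg (h b) - Complex.arg (h a) := by
  have := eq_of_exp_eq isPreconnected_Icc (F := fun t => g t - Complex.log (h t))
    (hg.sub (hh.clog hs)) (d := d) (fun t ht => by
      have hne := Complex.slitPlane_ne_zero (hs t ht)
      rw [Complex.exp_sub, hgh t ht, Complex.exp_log hne]; field_simp)
    (right_mem_Icc.2 hab) (left_mem_Icc.2 hab)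
  have h2 := congrArg Complex.im this
  simp only [Complex.sub_im, Complex.log_im] at h2
  rw [Complex.sub_im]; linarith

/-- The cross product of the edges before and after the vertex with index `i`. -/
def cross (v : ℤ → Plane) (i : ℤ) : ℝ :=
  ((v i).1 - (v (i - 1)).1) * ((v (i + 1)).2 - (v i).2) -
    ((v i).2 - (v (i - 1)).2) * ((v (i + 1)).1 - (v i).1)

/-- The turn at the vertex with index `i`: `1` for a left turn, `-1` for a right turn. -/
def turn (v : ℤ → Plane) (i : ℤ) : ℤ := ind (0 < cross v i) - ind (cross v i < 0)

/-- The plane as the complex plane. -/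
def toComplex (p : Plane) : ℂ := ⟨p.1, p.2⟩

theorem toComplex_injective : Function.Injective toComplex := by
  intro p q h
  simp only [toComplex, Complex.mk.injEq] at h
  exact Prod.ext h.1 h.2

theorem continuous_toComplex : Continuous toComplex :=
  Complex.equivRealProdCLM.symm.continuous

theorem toComplex_lineMap (a b : Plane) (t : ℝ) :
    toComplex (AffineMap.lineMap a b t) = toComplex a + t * (toComplex b - toComplex a) := by
  rw [toComplex, lineMap_fst, lineMap_snd]
  apply Complex.ext <;> simp [toComplex]

namespace RectCurve

variable {n : ℕ} {v : ℤ → Plane} (X : RectCurve n v)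

/-- The secant of the curve. -/
def secant (v : ℤ → Plane) (s u : ℝ) : ℂ := toComplex (curve v (s + u)) - toComplex (curve v s)

theorem continuous_secant (v : ℤ → Plane) : Continuous fun x : ℝ × ℝ => secant v x.1 x.2 := by
  have h := continuous_toComplex.comp (continuous_curve v)
  exact (h.comp (continuous_fst.add continuous_snd)).sub (h.comp continuous_fst)

/-- The edge vector as a complex number. -/
def edgeVec (v : ℤ → Plane) (i : ℤ) : ℂ := toComplex (v (i + 1)) - toComplex (v i)

theorem toComplex_curve (v : ℤ → Plane) (i : ℤ) {t : ℝ} (ht : t ∈ Icc (i : ℝ) (i + 1)) :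
    toComplex (curve v t) = toComplex (v i) + (t - i : ℝ) * edgeVec v i := by
  rw [curve_eq_lineMap v i ht, toComplex_lineMap, edgeVec]

/-- A rectilinear curve has no tangent at its vertices; the secant of parameter length `1 / 2`
replaces it. It is parallel to the edge during the first half of the edge and moves linearly to the
direction of the next edge during the second half. -/
theorem secant_half_of_le (v : ℤ → Plane) (i : ℤ) {t : ℝ} (h1 : i ≤ t) (h2 : t ≤ i + 1 / 2) :
    secant v t (1 / 2) = (1 / 2 : ℝ) * edgeVec v i := by
  rw [secant, toComplex_curve v i ⟨by linarith, by linarith⟩,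
    toComplex_curve v i ⟨by linarith, by linarith⟩]
  push_cast; ring

theorem secant_half_of_ge (v : ℤ → Plane) (i : ℤ) {t : ℝ} (h1 : i + 1 / 2 ≤ t) (h2 : t ≤ i + 1) :
    secant v t (1 / 2) = (i + 1 - t : ℝ) * edgeVec v i + (t - i - 1 / 2 : ℝ) * edgeVec v (i + 1) := by
  rw [secant, toComplex_curve v (i + 1) ⟨by push_cast; linarith, by push_cast; linarith⟩,
    toComplex_curve v i ⟨by linarith, by linarith⟩]
  rw [show toComplex (v (i + 1)) = toComplex (v i) + edgeVec v i by rw [edgeVec]; ring]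
  push_cast; ring

include X

theorem secant_ne_zero {s u : ℝ} (h0 : 0 < u) (h1 : u < n) : secant v s u ≠ 0 := by
  intro h
  have h2 := toComplex_injective (sub_eq_zero.1 h)
  have := X.eq_of_curve_eq (a := s) h2 ⟨by linarith, by linarith⟩
    ⟨le_rfl, by linarith⟩
  linarith

theorem edgeVec_ne_zero (i : ℤ) : edgeVec v i ≠ 0 := by
  intro h
  exact X.ne_succ i (toComplex_injective (sub_eq_zero.1 h)).symm

/-- Consecutive edges are perpendicular, in the direction given by the turn. -/
theorem edgeVec_div (i : ℤ) : ∃ r : ℝ, 0 < r ∧ (turn v (i + 1) = 1 ∨ turn v (i + 1) = -1) ∧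
    edgeVec v (i + 1) / edgeVec v i = r * (turn v (i + 1) * Complex.I) := by
  have hne := X.edgeVec_ne_zero i
  have hcr : cross v (i + 1) = ((v (i + 1)).1 - (v i).1) * ((v (i + 1 + 1)).2 - (v (i + 1)).2) -
    ((v (i + 1)).2 - (v i).2) * ((v (i + 1 + 1)).1 - (v (i + 1)).1) := by
    rw [cross, add_sub_cancel_right]
  -- For perpendicular edges the second vector times the conjugate of the first is purely imaginary,
  -- with the cross product as imaginary part; multiplying by the first vector gives this form.
  have hmul : edgeVec v (i + 1) * (Complex.normSq (edgeVec v i) : ℂ) =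
      (cross v (i + 1) * Complex.I) * edgeVec v i := by
    rw [hcr]
    rcases X.alternating i with ⟨h | h, h' | h'⟩ | ⟨h | h, h' | h'⟩ <;>
    · apply Complex.ext <;>
        simp only [edgeVec, toComplex, Complex.normSq_apply, Complex.sub_re, Complex.sub_im,
          Complex.mul_re, Complex.mul_im, Complex.ofReal_re, Complex.ofReal_im, Complex.I_re,
          Complex.I_im, h.1, h'.1] <;> ring
  have hpos : 0 < Complex.normSq (edgeVec v i) := Complex.normSq_pos.2 hne
  have hcne : cross v (i + 1) ≠ 0 := by
    intro h0
    rw [h0] at hmul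
    simp only [Complex.ofReal_zero, zero_mul, mul_eq_zero, Complex.ofReal_eq_zero] at hmul
    exact hmul.elim (X.edgeVec_ne_zero (i + 1)) hpos.ne'
  have hdiv : edgeVec v (i + 1) / edgeVec v i =
      ((cross v (i + 1) / Complex.normSq (edgeVec v i) : ℝ) : ℂ) * Complex.I := by
    rw [div_eq_iff hne]
    have : (Complex.normSq (edgeVec v i) : ℂ) ≠ 0 := by exact_mod_cast hpos.ne'
    push_cast
    field_simp
    linear_combination hmul
  refine ⟨|cross v (i + 1)| / Complex.normSq (edgeVec v i), by positivity, ?_⟩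
  rcases lt_or_gt_of_ne hcne with h | h
  · have : turn v (i + 1) = -1 := by
      rw [turn, ind_false (not_lt.2 h.le), ind_true h]; rfl
    refine ⟨Or.inr this, ?_⟩
    rw [hdiv, this, abs_of_neg h]; push_cast; ring
  · have : turn v (i + 1) = 1 := by
      rw [turn, ind_true h, ind_false (not_lt.2 h.le)]; rfl
    refine ⟨Or.inl this, ?_⟩
    rw [hdiv, this, abs_of_pos h]; push_cast; ring

omit X in
theorem arg_turn {r : ℝ} (hr : 0 < r) {τ : ℤ} (hτ : τ = 1 ∨ τ = -1) :
    Complex.arg (r * (τ * Complex.I)) = Real.pi / 2 * τ := by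
  rw [Complex.arg_real_mul _ hr]
  rcases hτ with rfl | rfl <;> simp

/-- Divided by the current edge vector, the half-secant has positive real part until the very end,
where it is a nonzero imaginary number. It never meets the branch cut of the argument, so the change
of the continuous argument is read off from the end points: a quarter turn. -/
theorem turn_eq (i : ℤ) {g : ℝ → ℂ} {a : ℝ} (ha1 : i ≤ a) (ha2 : a ≤ i + 1 / 2)
    (hg : ContinuousOn g (Icc a (i + 1)))
    (hexp : ∀ t ∈ Icc a (i + 1 : ℝ), Complex.exp (g t) = secant v t (1 / 2)) :
    (g (i + 1) - g a).im = Real.pi / 2 * turn v (i + 1) := by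
  obtain ⟨r, hr, hτ, hdiv⟩ := X.edgeVec_div i
  have hne := X.edgeVec_ne_zero i
  have hh : ContinuousOn (fun t => secant v t (1 / 2) / edgeVec v i) (Icc a (i + 1)) := by
    have := (continuous_secant v).comp (continuous_id.prodMk continuous_const : Continuous fun t : ℝ => (t, (1 / 2 : ℝ)))
    exact (this.div_const _).continuousOn
  rw [im_sub_eq_arg_sub (by linarith) hg hh (d := edgeVec v i) (fun t ht => by
    rw [hexp t ht]; field_simp) (fun t ht => ?_)]
  · rw [secant_half_of_le v i ha1 ha2, secant_half_of_ge v i (t := i + 1) (by linarith) le_rfl]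
    have e1 : ((1 / 2 : ℝ) : ℂ) * edgeVec v i / edgeVec v i = (1 / 2 : ℝ) := by field_simp
    have e2 : (((i + 1 - (i + 1) : ℝ) : ℂ) * edgeVec v i + ((i + 1 - i - 1 / 2 : ℝ) : ℂ) * edgeVec v (i + 1)) /
        edgeVec v i = ((1 / 2 * r : ℝ) : ℂ) * (turn v (i + 1) * Complex.I) := by
      rw [add_div, mul_div_assoc, mul_div_assoc, hdiv]
      push_cast; ring
    rw [e1, e2, arg_turn (by positivity) hτ, Complex.arg_ofReal_of_nonneg (by norm_num)]; ring
  · rw [Complex.mem_slitPlane_iff]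
    rcases le_total t (i + 1 / 2) with h | h
    · left
      rw [secant_half_of_le v i (ha1.trans ht.1) h, mul_div_assoc, div_self hne]
      norm_num
    · rw [secant_half_of_ge v i h ht.2, add_div, mul_div_assoc, mul_div_assoc, hdiv, div_self hne]
      have hre : (((i + 1 - t : ℝ) : ℂ) * 1 + ((t - i - 1 / 2 : ℝ) : ℂ) *
          (r * (turn v (i + 1) * Complex.I))).re = i + 1 - t := by
        simp
      have him : (((i + 1 - t : ℝ) : ℂ) * 1 + ((t - i - 1 / 2 : ℝ) : ℂ) *
          (r * (turn v (i + 1) * Complex.I))).im = (t - i - 1 / 2) * (r * turn v (i + 1)) := by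
        simp
      rw [hre, him]
      rcases ht.2.lt_or_eq with h' | h'
      · left; linarith
      · right
        rw [h']
        have : (turn v (i + 1) : ℝ) ≠ 0 := by
          rcases hτ with h | h <;> rw [h] <;> norm_num
        have h2 : (i + 1 - i - 1 / 2 : ℝ) ≠ 0 := by ring_nf; norm_num
        exact mul_ne_zero h2 (mul_ne_zero hr.ne' this)

/-- A lowest vertex is the base point of Hopf's argument: no secant starting there points below the
horizontal. -/
theorem exists_lowest : ∃ a : ℤ, ∀ t, (v a).2 ≤ (curve v t).2 := by
  obtain ⟨a, -, ha⟩ := Finset.exists_min_image (Finset.Ico 0 (n : ℤ)) (fun i => (v i).2)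
    ⟨0, by simpa using X.n_pos⟩
  have ha' : ∀ i, (v a).2 ≤ (v i).2 := by
    intro i
    obtain ⟨k, hk⟩ := exists_int_mem_Ico X.n_pos 0 i
    rw [zero_add] at hk
    rw [← X.periodic_int i k]
    exact ha _ (Finset.mem_Ico.2 hk)
  refine ⟨a, fun t => ?_⟩
  have ht : t ∈ Icc (⌊t⌋ : ℝ) (⌊t⌋ + 1) := ⟨Int.floor_le t, (Int.lt_floor_add_one t).le⟩
  rw [curve_eq_lineMap v ⌊t⌋ ht, lineMap_snd]
  have h1 := ha' ⌊t⌋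
  have h2 := ha' (⌊t⌋ + 1)
  nlinarith [ht.1, ht.2]

/-- Hopf's theorem on turning numbers for simple closed rectilinear curves. -/
theorem sum_turn : ∑ i ∈ Finset.Ico 0 (n : ℤ), turn v i = 4 ∨
    ∑ i ∈ Finset.Ico 0 (n : ℤ), turn v i = -4 := by
  have hn : (1 : ℝ) ≤ n := by exact_mod_cast X.n_pos
  set S : Set (ℝ × ℝ) := univ ×ˢ Ioo (0 : ℝ) n with hS
  have hSc : Convex ℝ S := convex_univ.prod (convex_Ioo 0 (n : ℝ))
  have hSo : IsOpen S := isOpen_univ.prod isOpen_Ioo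
  have hSne : S.Nonempty := ⟨(0, 1 / 2), trivial, by norm_num, by simp only; linarith⟩
  have hSs : IsSimplyConnected S := by
    have := hSc.contractibleSpace hSne
    exact inferInstanceAs (SimplyConnectedSpace S)
  -- By simplicity of the curve secants of parameter length strictly between 0 and `n` do not
  -- vanish. The strip of all such pairs is simply connected, so the secant has a continuous
  -- logarithm on it.
  obtain ⟨g, hg, hexp⟩ := Complex.exists_continuousOn_eqOn_exp_comp hSs hSo
    (continuous_secant v).continuousOn (by
      rintro ⟨⟨s, u⟩, hx, h0⟩
      exact X.secant_ne_zero hx.2.1 hx.2.2 h0)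
  have hexp' : ∀ s u : ℝ, 0 < u → u < n → Complex.exp (g (s, u)) = secant v s u :=
    fun s u h0 h1 => hexp ⟨trivial, h0, h1⟩
  have half : (1 / 2 : ℝ) < n := by linarith
  obtain ⟨a, ha⟩ := X.exists_lowest
  -- the reflection `(s, u) ↦ (s + u, n - u)` reverses the secant
  have hF : ∀ x ∈ S, ∀ y ∈ S, g (x.1 + x.2, n - x.2) - g x = g (y.1 + y.2, n - y.2) - g y := by
    intro x hx y hy
    refine eq_of_exp_eq hSc.isPreconnected (F := fun x => g (x.1 + x.2, n - x.2) - g x) ?_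
      (d := -1) ?_ hx hy
    · refine ContinuousOn.sub (hg.comp (f := fun x : ℝ × ℝ => (x.1 + x.2, n - x.2)) ?_ ?_) hg
      · fun_prop
      · intro x hx; exact ⟨trivial, by linarith [hx.2.2], by linarith [hx.2.1]⟩
    · rintro ⟨s, u⟩ ⟨-, h0, h1⟩
      simp only at h0 h1 ⊢
      have hne := X.secant_ne_zero (s := s) h0 h1
      rw [Complex.exp_sub, hexp' _ _ (by linarith) (by linarith), hexp' _ _ h0 h1, div_eq_iff hne]
      have hp : curve v (s + u + (n - u)) = curve v s := by
        have := X.curve_periodic s 1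
        rw [← this]; congr 1; push_cast; ring
      rw [secant, secant, hp]; ring
  -- The constant increment of `g` under the reflection, written out at `(a - 1 / 2, 1 / 2)`. The
  -- reflection reverses the secant, so `exp c = -1` and the imaginary part of `c` is an odd
  -- multiple of `π`.
  set c := g ((a : ℝ), n - 1 / 2) - g (a - 1 / 2, 1 / 2) with hc
  have hc1 : ∀ s u : ℝ, 0 < u → u < n → g (s + u, n - u) - g (s, u) = c := by
    intro s u h0 h1
    have := hF (s, u) ⟨trivial, h0, h1⟩ (a - 1 / 2, 1 / 2) ⟨trivial, by norm_num, half⟩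
    rw [hc]; simpa using this
  have hcexp : Complex.exp c = -1 := by
    have hne := X.secant_ne_zero (s := a - 1 / 2) (u := 1 / 2) (by norm_num) half
    rw [hc, Complex.exp_sub, hexp' _ _ (by linarith) (by linarith), hexp' _ _ (by norm_num) half,
      div_eq_iff hne, secant, secant, sub_add_cancel]
    have hp : curve v (a + (n - 1 / 2)) = curve v (a - 1 / 2) := by
      have := X.curve_periodic (a - 1 / 2) 1
      rw [← this]; congr 1; push_cast; ring
    rw [hp]; ring
  obtain ⟨m, hm⟩ : ∃ m : ℤ, c.im = (2 * m + 1) * Real.pi := by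
    rw [← Complex.exp_pi_mul_I, Complex.exp_eq_exp_iff_exists_int] at hcexp
    obtain ⟨m, hm⟩ := hcexp
    refine ⟨m, ?_⟩
    rw [hm]; simp; ring
  have hline : ∀ b c : ℝ, ContinuousOn (fun t : ℝ => g (t, 1 / 2)) (Icc b c) := fun b c =>
    hg.comp (by fun_prop) fun t _ => ⟨trivial, by norm_num, half⟩
  -- total turning
  have htot : ∀ m : ℕ, (g (a + m, 1 / 2) - g (a, 1 / 2)).im =
      Real.pi / 2 * (∑ i ∈ Finset.Ico a (a + m), turn v (i + 1) : ℤ) := by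
    intro m
    induction m with
    | zero => simp
    | succ m ih =>
      have h1 := X.turn_eq (a + m) (g := fun t => g (t, 1 / 2)) (a := (a + m : ℤ)) le_rfl (by linarith)
        (hline _ _) (fun t _ => hexp' t _ (by norm_num) half)
      have h2 := sum_Ico_succ_right (fun i => turn v (i + 1)) (a := a) (b := a + m) (by omega)
      push_cast at h1
      rw [Nat.cast_succ, Nat.cast_succ, ← add_assoc, ← add_assoc, h2]
      push_cast
      rw [Complex.sub_im] at h1 ih ⊢
      push_cast at ih
      linarith
  -- Reflecting twice shifts the base point by a whole period, so the total turning is `2 * c`.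
  have h2c : g (a + n, 1 / 2) - g (a, 1 / 2) = 2 * c := by
    have h1 := hc1 a (1 / 2) (by norm_num) half
    have h2 := hc1 (a + 1 / 2) (n - 1 / 2) (by linarith) (by linarith)
    rw [show (a + 1 / 2 + (n - 1 / 2) : ℝ) = a + n by ring, sub_sub_cancel] at h2
    linear_combination h1 + h2
  have hsum : ∑ i ∈ Finset.Ico a (a + n), turn v (i + 1) = ∑ i ∈ Finset.Ico 0 (n : ℤ), turn v i := by
    rw [sum_Ico_shift (turn v), show a + n + 1 = a + 1 + n by ring]
    apply sum_Ico_periodic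
    intro i
    rw [turn, turn, cross, cross, X.periodic, show i + n - 1 = i - 1 + n by ring, X.periodic,
      show i + n + 1 = i + 1 + n by ring, X.periodic]
  have hfin := htot n
  rw [h2c, hsum] at hfin
  -- bound on `c`
  have hb1 : |(g (a, n - 1 / 2) - g (a, 1 / 2)).im| ≤ Real.pi := by
    -- Division by `Complex.I` moves the closed upper half-plane, which contains all secants from
    -- the lowest vertex, to the closed right half-plane. There arguments are at most `π / 2` in
    -- absolute value, so the total change is at most `π`.
    have hre : ∀ u, 0 ≤ (secant v a u / Complex.I).re := by
      intro u
      rw [Complex.div_I]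
      simp only [secant, curve_int, toComplex, Complex.neg_re, Complex.mul_re, Complex.sub_re,
        Complex.sub_im, Complex.I_re, Complex.I_im]
      linarith [ha (a + u)]
    have hh : ContinuousOn (fun u => secant v a u / Complex.I) (Icc (1 / 2) (n - 1 / 2)) := by
      have := (continuous_secant v).comp (continuous_const.prodMk continuous_id : Continuous fun t : ℝ => ((a : ℝ), t))
      exact (this.div_const _).continuousOn
    have := im_sub_eq_arg_sub (g := fun u => g (a, u)) (a := 1 / 2) (b := n - 1 / 2) (by linarith)
      (hg.comp (by fun_prop) fun u hu => ⟨trivial, by linarith [hu.1], by linarith [hu.2]⟩) hh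
      (d := Complex.I) (fun u hu => by
        rw [hexp' _ _ (by linarith [hu.1]) (by linarith [hu.2])]; field_simp) (fun u hu => by
        rw [Complex.mem_slitPlane_iff]
        rcases (hre u).lt_or_eq with h | h
        · exact Or.inl h
        · right
          intro h0
          have hne := X.secant_ne_zero (s := a) (u := u) (by linarith [hu.1]) (by linarith [hu.2])
          exact div_ne_zero hne Complex.I_ne_zero (Complex.ext h.symm h0))
    rw [this]
    have k1 := Complex.abs_arg_le_pi_div_two_iff.2 (hre (1 / 2))
    have k2 := Complex.abs_arg_le_pi_div_two_iff.2 (hre (n - 1 / 2))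
    rw [abs_le] at k1 k2 ⊢
    constructor <;> linarith
  have hb2 : (g (a, 1 / 2) - g (a - 1 / 2, 1 / 2)).im = Real.pi / 2 * turn v a := by
    have := X.turn_eq (a - 1) (g := fun t => g (t, 1 / 2)) (a := a - 1 / 2) (by push_cast; linarith)
      (by push_cast; linarith) (hline _ _) (fun t _ => hexp' t _ (by norm_num) half)
    simpa using this
  have hb3 : turn v a = 1 ∨ turn v a = -1 := by
    obtain ⟨_, _, h, _⟩ := X.edgeVec_div (a - 1)
    simpa using h
  -- The path from `(a - 1 / 2, 1 / 2)` to `(a, n - 1 / 2)` goes through `(a, 1 / 2)`: a quarter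
  -- turn followed by a change of at most `π`. Among odd multiples of `π` this bound leaves only `π`
  -- and `-π`.
  have hb4 : |c.im| ≤ 3 / 2 * Real.pi := by
    have : c = (g (a, n - 1 / 2) - g (a, 1 / 2)) + (g (a, 1 / 2) - g (a - 1 / 2, 1 / 2)) := by
      rw [hc]; ring
    rw [this, Complex.add_im, hb2]
    have hpi := Real.pi_pos
    rw [abs_le] at hb1 ⊢
    rcases hb3 with h | h <;> rw [h] <;> push_cast <;> constructor <;> linarith
  have hpi := Real.pi_pos
  rw [hm, abs_le] at hb4
  have hm0 : m = 0 ∨ m = -1 := by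
    have h1 : (m : ℝ) < 1 := by nlinarith
    have h2 : (-2 : ℝ) < m := by nlinarith
    have h1' : m < 1 := by exact_mod_cast h1
    have h2' : -2 < m := by exact_mod_cast h2
    omega
  have him : (2 * c).im = 2 * c.im := by simp
  rw [him, hm] at hfin
  set T := ∑ i ∈ Finset.Ico 0 (n : ℤ), turn v i
  have hT : (T : ℝ) = 4 * (2 * m + 1) := by
    have : Real.pi * (T : ℝ) = Real.pi * (4 * (2 * m + 1)) := by linarith
    exact mul_left_cancel₀ hpi.ne' this
  have hT' : T = 4 * (2 * m + 1) := by exact_mod_cast hT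
  rcases hm0 with h | h <;> rw [h] at hT' <;> omega

end RectCurve

/-! ### The cyclic word of edge directions -/

/-- Leftmost edges of a closed rectilinear curve. -/
def LM (v : ℤ → Plane) (i : ℤ) : Prop := Leftward v (i - 1) ∧ Upward v i ∧ Rightward v (i + 1)

/-- Rightmost edges of a closed rectilinear curve. -/
def RM (v : ℤ → Plane) (i : ℤ) : Prop := Rightward v (i - 1) ∧ Downward v i ∧ Leftward v (i + 1)

/-- Left notches of a closed rectilinear curve. -/
def LN (v : ℤ → Plane) (i : ℤ) : Prop := Rightward v (i - 1) ∧ Upward v i ∧ Leftward v (i + 1)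

/-- Right notches of a closed rectilinear curve. -/
def RN (v : ℤ → Plane) (i : ℤ) : Prop := Leftward v (i - 1) ∧ Downward v i ∧ Rightward v (i + 1)

theorem Leftward.horizontal {v : ℤ → Plane} {i : ℤ} (h : Leftward v i) : Horizontal v i := Or.inr h
theorem Rightward.horizontal {v : ℤ → Plane} {i : ℤ} (h : Rightward v i) : Horizontal v i := Or.inl h
theorem Upward.vertical {v : ℤ → Plane} {i : ℤ} (h : Upward v i) : Vertical v i := Or.inl h
theorem Downward.vertical {v : ℤ → Plane} {i : ℤ} (h : Downward v i) : Vertical v i := Or.inr h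

theorem turn_of_cross_pos {v : ℤ → Plane} {i : ℤ} (h : 0 < cross v i) : turn v i = 1 := by
  rw [turn, ind_true h, ind_false (not_lt.2 h.le)]; rfl

theorem turn_of_cross_neg {v : ℤ → Plane} {i : ℤ} (h : cross v i < 0) : turn v i = -1 := by
  rw [turn, ind_true h, ind_false (not_lt.2 h.le)]; rfl

theorem cross_succ (v : ℤ → Plane) (i : ℤ) : cross v (i + 1) =
    ((v (i + 1)).1 - (v i).1) * ((v (i + 1 + 1)).2 - (v (i + 1)).2) -
      ((v (i + 1)).2 - (v i).2) * ((v (i + 1 + 1)).1 - (v (i + 1)).1) := by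
  rw [cross, add_sub_cancel_right]

section turns

variable {v : ℤ → Plane} {i : ℤ}

theorem turn_left_up (h : Leftward v i) (h' : Upward v (i + 1)) : turn v (i + 1) = -1 := by
  apply turn_of_cross_neg; rw [cross_succ, h.1, sub_self, zero_mul, sub_zero]
  exact mul_neg_of_neg_of_pos (sub_neg.2 h.2) (sub_pos.2 h'.2)

theorem turn_left_down (h : Leftward v i) (h' : Downward v (i + 1)) : turn v (i + 1) = 1 := by
  apply turn_of_cross_pos; rw [cross_succ, h.1, sub_self, zero_mul, sub_zero]
  exact mul_pos_of_neg_of_neg (sub_neg.2 h.2) (sub_neg.2 h'.2)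

theorem turn_right_up (h : Rightward v i) (h' : Upward v (i + 1)) : turn v (i + 1) = 1 := by
  apply turn_of_cross_pos; rw [cross_succ, h.1, sub_self, zero_mul, sub_zero]
  exact mul_pos (sub_pos.2 h.2) (sub_pos.2 h'.2)

theorem turn_right_down (h : Rightward v i) (h' : Downward v (i + 1)) : turn v (i + 1) = -1 := by
  apply turn_of_cross_neg; rw [cross_succ, h.1, sub_self, zero_mul, sub_zero]
  exact mul_neg_of_pos_of_neg (sub_pos.2 h.2) (sub_neg.2 h'.2)

theorem turn_up_left (h : Upward v i) (h' : Leftward v (i + 1)) : turn v (i + 1) = 1 := by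
  apply turn_of_cross_pos; rw [cross_succ, h.1, sub_self, zero_mul, zero_sub, neg_pos]
  exact mul_neg_of_pos_of_neg (sub_pos.2 h.2) (sub_neg.2 h'.2)

theorem turn_up_right (h : Upward v i) (h' : Rightward v (i + 1)) : turn v (i + 1) = -1 := by
  apply turn_of_cross_neg; rw [cross_succ, h.1, sub_self, zero_mul, zero_sub, neg_lt_zero]
  exact mul_pos (sub_pos.2 h.2) (sub_pos.2 h'.2)

theorem turn_down_left (h : Downward v i) (h' : Leftward v (i + 1)) : turn v (i + 1) = -1 := by
  apply turn_of_cross_neg; rw [cross_succ, h.1, sub_self, zero_mul, zero_sub, neg_lt_zero]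
  exact mul_pos_of_neg_of_neg (sub_neg.2 h.2) (sub_neg.2 h'.2)

theorem turn_down_right (h : Downward v i) (h' : Rightward v (i + 1)) : turn v (i + 1) = 1 := by
  apply turn_of_cross_pos; rw [cross_succ, h.1, sub_self, zero_mul, zero_sub, neg_pos]
  exact mul_neg_of_neg_of_pos (sub_neg.2 h.2) (sub_pos.2 h'.2)

end turns

theorem Leftward.not_rightward {v : ℤ → Plane} {i : ℤ} (h : Leftward v i) : ¬ Rightward v i :=
  fun h' => h'.not_leftward h

theorem Downward.not_upward {v : ℤ → Plane} {i : ℤ} (h : Downward v i) : ¬ Upward v i :=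
  fun h' => h'.not_downward h

namespace RectCurve

variable {n : ℕ} {v : ℤ → Plane} (X : RectCurve n v)
include X

/-- The eight types of vertical edges. -/
theorem vertical_cases {i : ℤ} (h : Vertical v i) :
    (Rightward v (i - 1) ∨ Leftward v (i - 1)) ∧ (Upward v i ∨ Downward v i) ∧
      (Rightward v (i + 1) ∨ Leftward v (i + 1)) :=
  ⟨X.horizontal_pred.2 h, h, X.horizontal_succ.2 h⟩

/-- Exactly one of the edges `i - 1` and `i` is horizontal, so the bracketed sums record whether the
latest horizontal edge goes right. Leftmost edges and right notches switch this from left to right,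
left notches and rightmost edges switch it back, and all other edges leave it unchanged. -/
theorem word_step (i : ℤ) : ind (LM v i) + ind (RN v i) - ind (LN v i) - ind (RM v i) =
    (ind (Rightward v (i + 1)) + ind (Rightward v (i + 1 - 1))) -
      (ind (Rightward v i) + ind (Rightward v (i - 1))) := by
  rw [add_sub_cancel_right]
  rcases X.horizontal_or_vertical i with h | h
  · have h0 : ¬ Upward v i := fun h' => h'.vertical.not_horizontal h
    have h1 : ¬ Downward v i := fun h' => h'.vertical.not_horizontal h
    have h2 : ¬ Rightward v (i + 1) := fun h' => (X.vertical_succ.2 h).not_horizontal h'.horizontal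
    have h3 : ¬ Rightward v (i - 1) := fun h' => (X.vertical_pred.2 h).not_horizontal h'.horizontal
    simp [ind, LM, RM, LN, RN, h0, h1, h2, h3]
  · have h0 : ¬ Rightward v i := fun h' => h.not_horizontal h'.horizontal
    rcases X.vertical_cases h with ⟨h1 | h1, h2 | h2, h3 | h3⟩ <;>
      first
        | have h1' := h1.not_leftward
        | have h1' := h1.not_rightward
    all_goals first
      | have h2' := h2.not_downward
      | have h2' := h2.not_upward
    all_goals first
      | have h3' := h3.not_leftward
      | have h3' := h3.not_rightward
    all_goals simp [ind, LM, RM, LN, RN, h0, h1, h2, h3, h1', h2', h3']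

theorem word_sum {a b : ℤ} (h : a ≤ b) :
    ∑ i ∈ Finset.Ico a b, (ind (LM v i) + ind (RN v i) - ind (LN v i) - ind (RM v i)) =
      (ind (Rightward v b) + ind (Rightward v (b - 1))) -
      (ind (Rightward v a) + ind (Rightward v (a - 1))) := by
  rw [← sum_Ico_telescope (fun i => ind (Rightward v i) + ind (Rightward v (i - 1))) h]
  exact Finset.sum_congr rfl fun i _ => X.word_step i

/-- Leftmost and rightmost edges lie between two right turns, left and right notches between two
left turns; at any other vertical edge the two turns cancel. -/
theorem turn_add_turn {i : ℤ} (h : Vertical v i) : turn v i + turn v (i + 1) =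
    -2 * (ind (LM v i) + ind (RM v i) - ind (LN v i) - ind (RN v i)) := by
  have e := sub_add_cancel i 1
  rcases X.vertical_cases h with ⟨h1 | h1, h2 | h2, h3 | h3⟩ <;>
    first
      | have h1' := h1.not_leftward
      | have h1' := h1.not_rightward
  all_goals first
    | have h2' := h2.not_downward
    | have h2' := h2.not_upward
  all_goals first
    | have h3' := h3.not_leftward
    | have h3' := h3.not_rightward
  all_goals rw [← e] at h2
  all_goals first
    | have t1 := turn_left_up h1 h2
    | have t1 := turn_left_down h1 h2
    | have t1 := turn_right_up h1 h2
    | have t1 := turn_right_down h1 h2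
  all_goals rw [e] at h2
  all_goals first
    | have t2 := turn_up_left h2 h3
    | have t2 := turn_up_right h2 h3
    | have t2 := turn_down_left h2 h3
    | have t2 := turn_down_right h2 h3
  all_goals
    rw [e] at t1
    rw [t1, t2]
    simp [ind, LM, RM, LN, RN, h1, h2, h3, h1', h2', h3']

theorem dir_periodic (i k : ℤ) : (Rightward v (i + k * n) ↔ Rightward v i) ∧
    (Leftward v (i + k * n) ↔ Leftward v i) ∧ (Upward v (i + k * n) ↔ Upward v i) ∧
    (Downward v (i + k * n) ↔ Downward v i) := by
  simp only [Rightward, Leftward, Upward, Downward, show i + k * n + 1 = i + 1 + k * n by ring,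
    X.periodic_int, and_self]

theorem types_periodic (i k : ℤ) : (LM v (i + k * n) ↔ LM v i) ∧ (RM v (i + k * n) ↔ RM v i) ∧
    (LN v (i + k * n) ↔ LN v i) ∧ (RN v (i + k * n) ↔ RN v i) := by
  have h := X.dir_periodic i k
  have h1 := X.dir_periodic (i + 1) k
  have h2 := X.dir_periodic (i - 1) k
  simp only [LM, RM, LN, RN, show i + k * n + 1 = i + 1 + k * n by ring,
    show i + k * n - 1 = i - 1 + k * n by ring, h, h1, h2, and_self]

/-- Every vertex is an end of exactly one vertical edge, so the total turning can be collected edge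
by edge over the vertical ones. -/
theorem sum_turn_eq : ∑ i ∈ Finset.Ico 0 (n : ℤ), turn v i = -2 * ∑ i ∈ Finset.Ico 0 (n : ℤ),
    (ind (LM v i) + ind (RM v i) - ind (LN v i) - ind (RN v i)) := by
  have h1 : ∀ i, ind (Vertical v i) * (turn v i + turn v (i + 1)) =
      -2 * (ind (LM v i) + ind (RM v i) - ind (LN v i) - ind (RN v i)) := by
    intro i
    by_cases h : Vertical v i
    · rw [ind_true h, one_mul, X.turn_add_turn h]
    · have h0 : ¬ Upward v i := fun h' => h h'.vertical
      have h1 : ¬ Downward v i := fun h' => h h'.vertical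
      simp [ind, LM, RM, LN, RN, h0, h1, h]
  have h2 : ∑ i ∈ Finset.Ico 0 (n : ℤ), ind (Vertical v i) * turn v (i + 1) =
      ∑ i ∈ Finset.Ico 0 (n : ℤ), ind (Horizontal v i) * turn v i := by
    have := sum_Ico_shift (fun i => ind (Horizontal v i) * turn v i) 0 n 1
    rw [show (n : ℤ) + 1 = (0 + 1) + n by ring, sum_Ico_periodic] at this
    · rw [← this]
      refine Finset.sum_congr rfl fun i _ => ?_
      rw [ind_congr X.horizontal_succ]
    · intro i
      have hd := X.dir_periodic i 1
      rw [one_mul] at hd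
      rw [turn, turn, cross, cross, X.periodic, show i + n - 1 = i - 1 + n by ring, X.periodic,
        show i + n + 1 = i + 1 + n by ring, X.periodic]
      rw [ind_congr (show Horizontal v (i + n) ↔ Horizontal v i by rw [Horizontal, Horizontal, hd.1, hd.2.1])]
  rw [Finset.mul_sum, ← Finset.sum_congr rfl fun i _ => h1 i]
  simp only [mul_add, Finset.sum_add_distrib]
  rw [h2, ← Finset.sum_add_distrib]
  refine Finset.sum_congr rfl fun i _ => ?_
  rcases X.horizontal_or_vertical i with h | h
  · rw [ind_true h, ind_false h.not_vertical]; ring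
  · rw [ind_true h, ind_false h.not_horizontal]; ring

/-- Without right notches there is exactly one rightmost edge, and one left notch fewer than
leftmost edges. -/
theorem counts (hRN : ∀ i, ¬ RN v i) (a : ℤ) : ∑ i ∈ Finset.Ico a (a + n), ind (RM v i) = 1 ∧
    ∑ i ∈ Finset.Ico a (a + n), ind (LM v i) = ∑ i ∈ Finset.Ico a (a + n), ind (LN v i) + 1 := by
  have hp := fun i => X.types_periodic i 1
  simp only [one_mul] at hp
  rw [sum_Ico_periodic (fun i => ind_congr (hp i).2.1), sum_Ico_periodic (fun i => ind_congr (hp i).1),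
    sum_Ico_periodic (fun i => ind_congr (hp i).2.2.1)]
  have h1 := X.word_sum (a := 0) (b := n) (by omega)
  have h2 := X.sum_turn_eq
  have h3 := X.sum_turn
  have e := X.dir_periodic 0 1
  have e' := X.dir_periodic (-1) 1
  rw [one_mul, zero_add] at e
  rw [one_mul, show (-1 : ℤ) + n = n - 1 by ring] at e'
  rw [ind_congr e.1, ind_congr e'.1, zero_sub, sub_self] at h1
  simp only [Finset.sum_sub_distrib, Finset.sum_add_distrib] at h1 h2
  have h4 : ∑ i ∈ Finset.Ico 0 (n : ℤ), ind (RN v i) = 0 :=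
    Finset.sum_eq_zero fun i _ => ind_false (hRN i)
  have h5 : 0 ≤ ∑ i ∈ Finset.Ico 0 (n : ℤ), ind (RM v i) := Finset.sum_nonneg fun i _ => ind_nonneg _
  -- With no right notches the word relation says that leftmost edges equal left notches plus
  -- rightmost edges. Inserted into the turning relation, it makes twice the number of rightmost
  -- edges equal to 2 or -2, and the sign is forced.
  omega

omit X in
theorem exists_of_sum_ind {P : ℤ → Prop} {a b : ℤ} (h : 0 < ∑ i ∈ Finset.Ico a b, ind (P i)) :
    ∃ i ∈ Ico a b, P i := by
  by_contra hc
  push Not at hc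
  rw [Finset.sum_eq_zero fun i hi => ind_false (hc i (by simpa using hi))] at h
  exact lt_irrefl _ h

omit X in
theorem eq_of_sum_ind {P : ℤ → Prop} {a b : ℤ} (h : ∑ i ∈ Finset.Ico a b, ind (P i) ≤ 1) {i j : ℤ}
    (hi : i ∈ Ico a b) (hj : j ∈ Ico a b) (hPi : P i) (hPj : P j) : i = j := by
  by_contra hne
  have : ∑ k ∈ ({i, j} : Finset ℤ), ind (P k) ≤ ∑ i ∈ Finset.Ico a b, ind (P i) :=
    Finset.sum_le_sum_of_subset_of_nonneg (by
      intro k hk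
      rw [Finset.mem_insert, Finset.mem_singleton] at hk
      rcases hk with rfl | rfl <;> simpa using (by assumption)) fun _ _ _ => ind_nonneg _
  rw [Finset.sum_pair hne, ind_true hPi, ind_true hPj] at this
  omega

theorem rm_unique (hRN : ∀ i, ¬ RN v i) {i j a : ℤ} (hi : RM v i) (hj : RM v j)
    (hia : i ∈ Ico a (a + n)) (hja : j ∈ Ico a (a + n)) : i = j :=
  eq_of_sum_ind (X.counts hRN a).1.le hia hja hi hj

end RectCurve

/-! ### The inner region next to the boundary, and the first boundary point on a vertical ray -/

namespace Hole

variable (H : Hole)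

theorem isClosed_boundary : IsClosed H.boundary := H.rectCurve.isCompact_trace.isClosed

theorem mem_inner {p : Plane} : p ∈ H.inner ↔ p ∉ H.boundary ∧ H.w p = 1 := by rw [inner_eq]; rfl

theorem w_eq_of_isPreconnected {S : Set Plane} (hS : IsPreconnected S) (h : S ⊆ H.boundaryᶜ)
    {p q : Plane} (hp : p ∈ S) (hq : q ∈ S) : H.w p = H.w q :=
  H.rectCurve.wind_eq_of_isPreconnected hS h hp hq

/-- The hole lies below its rightward edges and above its leftward edges. -/
theorem w_near_horizontal {i : ℤ} (hi : Horizontal H.v i) {s : ℝ} (hs : s ∈ Ioo (i : ℝ) (i + 1)) :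
    ∃ r > 0, (∀ y, (curve H.v s).2 - r < y → y < (curve H.v s).2 →
        ((curve H.v s).1, y) ∉ H.boundary ∧ H.w ((curve H.v s).1, y) = ind (Rightward H.v i)) ∧
      ∀ y, (curve H.v s).2 < y → y < (curve H.v s).2 + r →
        ((curve H.v s).1, y) ∉ H.boundary ∧ H.w ((curve H.v s).1, y) = ind (Leftward H.v i) := by
  obtain ⟨r, hr, h⟩ := H.rectCurve.jump_horizontal hi hs
  set p := curve H.v s with hp
  have hs' : s ∈ Icc (i : ℝ) (i + 1) := ⟨hs.1.le, hs.2.le⟩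
  have hx : p.1 = (H.v i).1 + (s - i) * ((H.v (i + 1)).1 - (H.v i).1) := by
    rw [hp, curve_eq_lineMap H.v i hs', lineMap_fst]
  have h01 : 0 < s - i := by linarith [hs.1]
  have h02 : s - i < 1 := by linarith [hs.2]
  have key : ∀ a b : ℝ, p.2 - r < a → a < p.2 → p.2 < b → b < p.2 + r →
      ((p.1, a) ∉ H.boundary ∧ H.w (p.1, a) = ind (Rightward H.v i)) ∧
      ((p.1, b) ∉ H.boundary ∧ H.w (p.1, b) = ind (Leftward H.v i)) := by
    intro a b ha1 ha2 hb1 hb2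
    obtain ⟨k1, k2, k3⟩ := h a b ha1 ha2 hb1 hb2
    have v1 := H.w_facts.1 _ k1
    have v2 := H.w_facts.1 _ k2
    refine ⟨⟨k1, ?_⟩, k2, ?_⟩
    · rcases hi with hi | hi
      · rw [ind_true (by nlinarith [hi.2]), ind_false (by nlinarith [hi.2])] at k3
        rw [ind_true hi]
        simp only [w] at *
        omega
      · rw [ind_false (by nlinarith [hi.2]), ind_true (by nlinarith [hi.2])] at k3
        rw [ind_false hi.not_rightward]
        simp only [w] at *
        omega
    · rcases hi with hi | hi
      · rw [ind_true (by nlinarith [hi.2]), ind_false (by nlinarith [hi.2])] at k3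
        rw [ind_false hi.not_leftward]
        simp only [w] at *
        omega
      · rw [ind_false (by nlinarith [hi.2]), ind_true (by nlinarith [hi.2])] at k3
        rw [ind_true hi]
        simp only [w] at *
        omega
  exact ⟨r, hr, fun y h1 h2 => (key y (p.2 + r / 2) h1 h2 (by linarith) (by linarith)).1,
    fun y h1 h2 => (key (p.2 - r / 2) y (by linarith) (by linarith) h1 h2).2⟩

theorem boundary_near_vertex (j : ℤ) : ∃ r > 0, ∀ q ∈ H.boundary, dist q (H.v j) < r →
    ∃ t ∈ Icc (j - 1 : ℝ) (j + 1), curve H.v t = q := by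
  obtain ⟨r, hr, h⟩ := H.rectCurve.exists_ball (j : ℝ) one_pos
  refine ⟨r, hr, fun q hq hd => ?_⟩
  obtain ⟨t, rfl⟩ := mem_trace.1 hq
  obtain ⟨k, hk⟩ := h t (by rwa [curve_int])
  rw [abs_lt] at hk
  exact ⟨t + k * H.n, ⟨by linarith, by linarith⟩, H.rectCurve.curve_periodic t k⟩

theorem exists_edge_point_near {j e : ℤ} (he : e = j ∨ e = j - 1) {r : ℝ} (hr : 0 < r) :
    ∃ s ∈ Ioo (e : ℝ) (e + 1), dist (curve H.v s) (H.v j) < r := by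
  have hc := (continuous_curve H.v).continuousAt (x := (j : ℝ))
  rw [← curve_int H.v j]
  have h := hc.eventually (Metric.ball_mem_nhds _ hr)
  rcases he with rfl | rfl
  · have h2 : ∀ᶠ t in 𝓝[>] (e : ℝ), t ∈ Ioo (e : ℝ) (e + 1) := Ioo_mem_nhdsGT (by linarith)
    obtain ⟨s, h1, h2⟩ := ((h.filter_mono nhdsWithin_le_nhds).and h2).exists
    exact ⟨s, h2, h1⟩
  · have h2 : ∀ᶠ t in 𝓝[<] (j : ℝ), t ∈ Ioo ((j - 1 : ℤ) : ℝ) ((j - 1 : ℤ) + 1) := by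
      push_cast
      rw [sub_add_cancel]
      exact Ioo_mem_nhdsLT (by linarith)
    obtain ⟨s, h1, h2⟩ := ((h.filter_mono nhdsWithin_le_nhds).and h2).exists
    exact ⟨s, h2, h1⟩

/-- If both edges at a vertex lie below it, the points above it lie on the upper side of the
horizontal edge. -/
theorem w_above_vertex {j e : ℤ} (he : e = j ∨ e = j - 1) (hh : Horizontal H.v e)
    (hb : ∀ t ∈ Icc (j - 1 : ℝ) (j + 1), (curve H.v t).2 ≤ (H.v j).2) :
    ∃ r > 0, ∀ q, dist q (H.v j) < r → (H.v j).2 < q.2 →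
      q ∉ H.boundary ∧ H.w q = ind (Leftward H.v e) := by
  obtain ⟨r, hr, h⟩ := H.boundary_near_vertex j
  set S : Set Plane := {q | q ∈ Metric.ball (H.v j) r ∧ q ∈ {q : Plane | 0 < (q.2 - (H.v j).2) * 1}}
  have hS : IsPreconnected S := isPreconnected_ball_inter (convex_snd_pos _ _)
  have hSJ : S ⊆ H.boundaryᶜ := by
    rintro q ⟨hq1, hq2⟩ hq
    obtain ⟨t, ht, rfl⟩ := h q hq hq1
    have := hb t ht
    simp only [mem_ofPred_eq] at hq2
    linarith
  obtain ⟨s, hs, hsd⟩ := H.exists_edge_point_near he hr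
  obtain ⟨r', hr', -, h2⟩ := H.w_near_horizontal hh hs
  have hy : (curve H.v s).2 = (H.v j).2 := by
    rw [RectCurve.snd_curve_of_horizontal hh ⟨hs.1.le, hs.2.le⟩]
    rcases he with rfl | rfl
    · rfl
    · have : (H.v (j - 1)).2 = (H.v (j - 1 + 1)).2 := by rcases hh with h | h <;> exact h.1
      rwa [sub_add_cancel] at this
  rw [hy] at h2
  rw [Prod.dist_eq, max_lt_iff, Real.dist_eq] at hsd
  -- A sample point just above an interior point of the edge `e`: its winding number is known, and
  -- it lies in the same half-square above the vertex.
  set y := (H.v j).2 + min r r' / 2 with hydef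
  have hm : 0 < min r r' := lt_min hr hr'
  have hm1 := min_le_left r r'
  have hm2 := min_le_right r r'
  have hq0 : ((curve H.v s).1, y) ∈ S := by
    refine ⟨?_, ?_⟩
    · rw [Metric.mem_ball, Prod.dist_eq, max_lt_iff, Real.dist_eq, Real.dist_eq]
      refine ⟨hsd.1, ?_⟩
      simp only [hydef, add_sub_cancel_left]
      rw [abs_of_pos (by positivity)]; linarith
    · simp only [mem_ofPred_eq, hydef, add_sub_cancel_left]; linarith
  have hw := (h2 y (by linarith) (by linarith)).2
  refine ⟨r, hr, fun q hq1 hq2 => ?_⟩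
  have hqS : q ∈ S := ⟨hq1, by simp only [mem_ofPred_eq]; linarith⟩
  exact ⟨hSJ hqS, by rw [H.w_eq_of_isPreconnected hS hSJ hqS hq0, hw]⟩

/-- If both edges at a vertex lie above it, the points below it lie on the lower side of the
horizontal edge. -/
theorem w_below_vertex {j e : ℤ} (he : e = j ∨ e = j - 1) (hh : Horizontal H.v e)
    (hb : ∀ t ∈ Icc (j - 1 : ℝ) (j + 1), (H.v j).2 ≤ (curve H.v t).2) :
    ∃ r > 0, ∀ q, dist q (H.v j) < r → q.2 < (H.v j).2 →
      q ∉ H.boundary ∧ H.w q = ind (Rightward H.v e) := by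
  obtain ⟨r, hr, h⟩ := H.boundary_near_vertex j
  set S : Set Plane := {q | q ∈ Metric.ball (H.v j) r ∧ q ∈ {q : Plane | 0 < (q.2 - (H.v j).2) * -1}}
  have hS : IsPreconnected S := isPreconnected_ball_inter (convex_snd_pos _ _)
  have hSJ : S ⊆ H.boundaryᶜ := by
    rintro q ⟨hq1, hq2⟩ hq
    obtain ⟨t, ht, rfl⟩ := h q hq hq1
    have := hb t ht
    simp only [mem_ofPred_eq] at hq2
    linarith
  obtain ⟨s, hs, hsd⟩ := H.exists_edge_point_near he hr
  obtain ⟨r', hr', h2, -⟩ := H.w_near_horizontal hh hs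
  have hy : (curve H.v s).2 = (H.v j).2 := by
    rw [RectCurve.snd_curve_of_horizontal hh ⟨hs.1.le, hs.2.le⟩]
    rcases he with rfl | rfl
    · rfl
    · have : (H.v (j - 1)).2 = (H.v (j - 1 + 1)).2 := by rcases hh with h | h <;> exact h.1
      rwa [sub_add_cancel] at this
  rw [hy] at h2
  rw [Prod.dist_eq, max_lt_iff, Real.dist_eq] at hsd
  set y := (H.v j).2 - min r r' / 2 with hydef
  have hm : 0 < min r r' := lt_min hr hr'
  have hm1 := min_le_left r r'
  have hm2 := min_le_right r r'
  have hq0 : ((curve H.v s).1, y) ∈ S := by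
    refine ⟨?_, ?_⟩
    · rw [Metric.mem_ball, Prod.dist_eq, max_lt_iff, Real.dist_eq, Real.dist_eq]
      refine ⟨hsd.1, ?_⟩
      simp only [hydef, sub_sub_cancel_left, abs_neg]
      rw [abs_of_pos (by positivity)]; linarith
    · simp only [mem_ofPred_eq, hydef, sub_sub_cancel_left]; linarith
  have hw := (h2 y (by linarith) (by linarith)).2
  refine ⟨r, hr, fun q hq1 hq2 => ?_⟩
  have hqS : q ∈ S := ⟨hq1, by simp only [mem_ofPred_eq]; linarith⟩
  exact ⟨hSJ hqS, by rw [H.w_eq_of_isPreconnected hS hSJ hqS hq0, hw]⟩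

/-- The range of heights of an edge. -/
theorem snd_curve_mem (v : ℤ → Plane) {i : ℤ} {t : ℝ} (ht : t ∈ Icc (i : ℝ) (i + 1)) :
    (curve v t).2 ∈ uIcc (v i).2 (v (i + 1)).2 := by
  rw [curve_eq_lineMap v i ht, lineMap_snd, mem_uIcc]
  have h1 : 0 ≤ t - i := by linarith [ht.1]
  have h2 : t - i ≤ 1 := by linarith [ht.2]
  rcases le_total (v i).2 (v (i + 1)).2 with h | h
  · left; constructor <;> nlinarith
  · right; constructor <;> nlinarith

theorem vertex_mem_boundary (i : ℤ) : H.v i ∈ H.boundary := mem_trace.2 ⟨_, curve_int H.v i⟩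

variable {H}

/-- The upper end of an upward edge followed by a leftward edge, and the first boundary point
above it. -/
theorem first_hit {m : ℤ} (hU : Upward H.v m) (hL : Leftward H.v (m + 1)) :
    H.QN m ∈ H.boundary ∧ (H.QN m).1 = (H.Q m).1 ∧ (H.Q m).2 < (H.QN m).2 ∧
      ∀ y ∈ Ioo (H.Q m).2 (H.QN m).2, ((H.Q m).1, y) ∈ H.inner := by
  have X := H.rectCurve
  have hbelow : ∀ t ∈ Icc ((m + 1 : ℤ) - 1 : ℝ) ((m + 1 : ℤ) + 1), (curve H.v t).2 ≤ (H.v (m + 1)).2 := by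
    intro t ht
    push_cast at ht
    rcases le_total t (m + 1) with h | h
    · have := snd_curve_mem H.v (i := m) (t := t) ⟨by linarith [ht.1], h⟩
      rw [uIcc_of_le hU.2.le] at this
      exact this.2
    · have := RectCurve.snd_curve_of_horizontal (t := t) hL.horizontal
        ⟨by push_cast; exact h, by push_cast; exact ht.2⟩
      rw [this]
  obtain ⟨r, hr, h⟩ := H.w_above_vertex (j := m + 1) (Or.inl rfl) hL.horizontal hbelow
  rw [ind_true hL] at h
  set q := H.Q m with hq
  have hqv : H.v (m + 1) = q := rfl
  rw [hqv] at h
  have h' : ∀ y, q.2 < y → y < q.2 + r → (q.1, y) ∉ H.boundary ∧ H.w (q.1, y) = 1 := by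
    intro y h1 h2
    refine h (q.1, y) ?_ h1
    rw [Prod.dist_eq, max_lt_iff, Real.dist_eq, Real.dist_eq]
    simp only [sub_self, abs_zero]
    exact ⟨hr, by rw [abs_of_pos (by linarith)]; linarith⟩
  set A : Set ℝ := {y : ℝ | q.2 < y ∧ (q.1, y) ∈ H.boundary} with hA
  have hQN : H.QN m = (q.1, sInf A) := rfl
  have hwseg : ∀ b, (∀ y ∈ Ioo q.2 b, (q.1, y) ∉ H.boundary) → ∀ y ∈ Ioo q.2 b, H.w (q.1, y) = 1 := by
    intro b hb y hy
    set y' := min (q.2 + r / 2) y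
    have hy'1 : q.2 < y' := lt_min (by linarith) hy.1
    rw [← (h' y' hy'1 ((min_le_left _ _).trans_lt (by linarith))).2]
    refine X.wind_eq_of_vertical (p := (q.1, y)) (q := (q.1, y')) rfl fun z hz => hb z ?_
    rw [uIcc_comm, uIcc_of_le (min_le_right _ _)] at hz
    exact ⟨hy'1.trans_le hz.1, hz.2.trans_lt hy.2⟩
  -- A ray that never met the boundary would carry winding number 1 to points far away.
  have hne : A.Nonempty := by
    by_contra hc
    rw [not_nonempty_iff_eq_empty] at hc
    obtain ⟨R, hR⟩ := X.exists_far
    set y := max (q.2 + 1) (|R| + 1)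
    have hy : q.2 < y := lt_of_lt_of_le (by linarith) (le_max_left _ _)
    have hw := hwseg (y + 1) (fun z hz hzb => by
      have : z ∈ A := ⟨hz.1, hzb⟩
      rw [hc] at this; exact this) y ⟨hy, by linarith⟩
    have h0 := (hR (q.1, y) (by
      rw [Prod.dist_eq, lt_max_iff, Real.dist_eq, Real.dist_eq]
      right
      have := le_max_right (q.2 + 1) (|R| + 1)
      have h2 := le_abs_self R
      have h3 := abs_nonneg R
      simp only [Prod.snd_zero, sub_zero]
      rw [abs_of_pos (by linarith)]
      linarith)).2
    rw [w] at hw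
    omega
  have hlow : ∀ y ∈ A, q.2 + r ≤ y := by
    intro y hy
    by_contra hc
    exact (h' y hy.1 (not_le.1 hc)).1 hy.2
  -- The point `q` itself is on the boundary, so the strict inequality in `A` could spoil
  -- closedness; the gap of length `r` above `q` prevents this, and the infimum is attained.
  have hcl : IsClosed A := by
    have : A = Ici (q.2 + r) ∩ (fun y : ℝ => (q.1, y)) ⁻¹' H.boundary := by
      ext y
      constructor
      · exact fun hy => ⟨hlow y hy, hy.2⟩
      · rintro ⟨h1, h2⟩; exact ⟨by linarith [mem_Ici.1 h1], h2⟩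
    rw [this]
    exact isClosed_Ici.inter (H.isClosed_boundary.preimage (by fun_prop))
  have hbdd : BddBelow A := ⟨_, hlow⟩
  have hmem := hcl.csInf_mem hne hbdd
  rw [hQN]
  have hnot : ∀ y ∈ Ioo q.2 (sInf A), (q.1, y) ∉ H.boundary := fun y hy hyb =>
    (csInf_le hbdd ⟨hy.1, hyb⟩).not_gt hy.2
  exact ⟨hmem.2, rfl, hmem.1, fun y hy => H.mem_inner.2 ⟨hnot y hy, hwseg _ hnot y hy⟩⟩

/-- The position of a boundary point that is reached vertically from below through the inner
region. -/
theorem hit_cases {x y₀ y₁ : ℝ} (hy : y₀ < y₁) (hmem : (x, y₁) ∈ H.boundary)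
    (hin : ∀ y ∈ Ioo y₀ y₁, (x, y) ∈ H.inner) (a : ℤ) :
    ∃ j ∈ Ico a (a + H.n), (Rightward H.v j ∧ ∃ s ∈ Ioo (j : ℝ) (j + 1), curve H.v s = (x, y₁)) ∨
      (Downward H.v (j - 1) ∧ Rightward H.v j ∧ H.v j = (x, y₁)) ∨
      (Rightward H.v (j - 1) ∧ Upward H.v j ∧ H.v j = (x, y₁)) := by
  have X := H.rectCurve
  rw [boundary, X.trace_eq_image a] at hmem
  obtain ⟨s, hs, hsp⟩ := hmem
  set j := ⌊s⌋ with hj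
  have hjm : j ∈ Ico a (a + H.n) := by
    constructor
    · exact Int.le_floor.2 hs.1
    · rw [Int.floor_lt]; push_cast; exact hs.2
  -- no vertical edge comes from below
  have hvert : ∀ i, Vertical H.v i → ∀ t ∈ Icc (i : ℝ) (i + 1), curve H.v t = (x, y₁) →
      ((H.v i).2 < y₁ ∨ (H.v (i + 1)).2 < y₁) → False := by
    intro i hi t ht htp hlt
    have hx : (H.v i).1 = x := by
      rw [← RectCurve.fst_curve_of_vertical hi ht, htp]
    have hi1 : (H.v i).1 = (H.v (i + 1)).1 := by rcases hi with h | h <;> exact h.1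
    have hm := snd_curve_mem H.v ht
    rw [htp] at hm
    simp only at hm
    obtain ⟨y, hy1, hy2⟩ : ∃ y ∈ Ioo y₀ y₁, y ∈ uIcc (H.v i).2 (H.v (i + 1)).2 := by
      obtain ⟨b, hb, hb'⟩ : ∃ b ∈ uIcc (H.v i).2 (H.v (i + 1)).2, b < y₁ := by
        rcases hlt with hlt | hlt
        · exact ⟨_, left_mem_uIcc, hlt⟩
        · exact ⟨_, right_mem_uIcc, hlt⟩
      have h1 : (b + y₁) / 2 ≤ max ((y₀ + y₁) / 2) ((b + y₁) / 2) := le_max_right _ _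
      have h2 : max ((y₀ + y₁) / 2) ((b + y₁) / 2) < y₁ := max_lt (by linarith) (by linarith)
      exact ⟨max ((y₀ + y₁) / 2) ((b + y₁) / 2), ⟨lt_max_of_lt_left (by linarith), h2⟩,
        (ordConnected_uIcc (a := (H.v i).2) (b := (H.v (i + 1)).2)).out hb hm ⟨by linarith, h2.le⟩⟩
    obtain ⟨t', -, ht'⟩ := exists_param_vertical hi1 hy2
    rw [← hi1, hx] at ht'
    exact (hin y hy1).1 (mem_trace.2 ⟨_, ht'⟩)
  have hbelow : ∀ r > 0, ∃ y ∈ Ioo y₀ y₁, dist ((x, y) : Plane) (x, y₁) < r := by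
    intro r hr
    refine ⟨max ((y₀ + y₁) / 2) (y₁ - r / 2), ⟨lt_max_of_lt_left (by linarith), max_lt (by linarith) (by linarith)⟩, ?_⟩
    rw [Prod.dist_eq, max_lt_iff, Real.dist_eq, Real.dist_eq]
    simp only [sub_self, abs_zero]
    refine ⟨hr, ?_⟩
    have h1 := le_max_right ((y₀ + y₁) / 2) (y₁ - r / 2)
    have h2 : max ((y₀ + y₁) / 2) (y₁ - r / 2) < y₁ := max_lt (by linarith) (by linarith)
    rw [abs_lt]; constructor <;> linarith
  refine ⟨j, hjm, ?_⟩
  rcases (Int.floor_le s).lt_or_eq with h | h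
  · have hsj : s ∈ Ioo (j : ℝ) (j + 1) := ⟨h, Int.lt_floor_add_one s⟩
    left
    rcases X.horizontal_or_vertical j with hh | hv
    · refine ⟨?_, s, hsj, hsp⟩
      rcases hh with hh | hh
      · exact hh
      · exfalso
        obtain ⟨r, hr, h1, -⟩ := H.w_near_horizontal hh.horizontal hsj
        obtain ⟨y, hy1, hy2⟩ := hbelow r hr
        rw [hsp, ind_false hh.not_rightward] at h1
        rw [Prod.dist_eq, max_lt_iff, Real.dist_eq, Real.dist_eq, abs_lt, abs_lt] at hy2
        simp only at h1 hy2
        have := (h1 y (by linarith [hy2.2.1]) hy1.2).2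
        have := (H.mem_inner.1 (hin y hy1)).2
        omega
    · exfalso
      refine hvert j hv s ⟨hsj.1.le, hsj.2.le⟩ hsp ?_
      have hc : (curve H.v s).2 = (H.v j).2 + (s - j) * ((H.v (j + 1)).2 - (H.v j).2) := by
        rw [curve_eq_lineMap H.v j ⟨hsj.1.le, hsj.2.le⟩, lineMap_snd]
      rw [hsp] at hc
      simp only at hc
      have h1 : 0 < s - j := by linarith [hsj.1]
      have h2 : s - j < 1 := by linarith [hsj.2]
      rcases hv with hv | hv
      · left; nlinarith [hv.2]
      · right; nlinarith [hv.2]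
  · right
    have hvj : H.v j = (x, y₁) := by rw [← curve_int H.v j, h, hsp]
    have e := sub_add_cancel j 1
    -- Points below a leftward edge have winding number 0, whereas the ray arrives from below
    -- through the inner region.
    have hbv : ∀ i, (i = j ∨ i = j - 1) → Leftward H.v i →
        (∀ t ∈ Icc (j - 1 : ℝ) (j + 1), (H.v j).2 ≤ (curve H.v t).2) → False := by
      intro i hi hL hb
      obtain ⟨r, hr, h1⟩ := H.w_below_vertex hi hL.horizontal hb
      obtain ⟨y, hy1, hy2⟩ := hbelow r hr
      rw [hvj, ind_false hL.not_rightward] at h1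
      have := (h1 (x, y) hy2 hy1.2).2
      have := (H.mem_inner.1 (hin y hy1)).2
      omega
    have hsplit : ∀ t ∈ Icc (j - 1 : ℝ) (j + 1), t ∈ Icc (j : ℝ) (j + 1) ∨
        t ∈ Icc ((j - 1 : ℤ) : ℝ) ((j - 1 : ℤ) + 1) := by
      intro t ht
      push_cast
      rcases le_total t j with h | h
      · right; exact ⟨ht.1, by linarith⟩
      · left; exact ⟨h, ht.2⟩
    rcases X.horizontal_or_vertical j with hh | hv
    · left
      have hv := X.vertical_pred.2 hh
      have hD : Downward H.v (j - 1) := by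
        rcases hv with hv | hv
        · exfalso
          refine hvert (j - 1) hv.vertical j (by push_cast; constructor <;> linarith) (by rw [curve_int, hvj]) ?_
          left
          have := hv.2
          rw [e, hvj] at this; exact this
        · exact hv
      refine ⟨hD, ?_, hvj⟩
      rcases hh with hh | hh
      · exact hh
      · exfalso
        refine hbv j (Or.inl rfl) hh fun t ht => ?_
        rcases hsplit t ht with ht | ht
        · rw [RectCurve.snd_curve_of_horizontal hh.horizontal ht]
        · have := snd_curve_mem H.v ht
          rw [e, uIcc_comm, uIcc_of_le (by have := hD.2; rw [e] at this; exact this.le)] at this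
          exact this.1
    · right
      have hh := X.horizontal_pred.2 hv
      have hU : Upward H.v j := by
        rcases hv with hv | hv
        · exact hv
        · exfalso
          refine hvert j hv.vertical j ⟨le_rfl, by linarith⟩ (by rw [curve_int, hvj]) ?_
          right
          have := hv.2
          rw [hvj] at this; exact this
      refine ⟨?_, hU, hvj⟩
      rcases hh with hh | hh
      · exact hh
      · exfalso
        refine hbv (j - 1) (Or.inr rfl) hh fun t ht => ?_
        rcases hsplit t ht with ht | ht
        · have := snd_curve_mem H.v ht
          rw [uIcc_of_le hU.2.le] at this
          exact this.1
        · rw [RectCurve.snd_curve_of_horizontal hh.horizontal ht]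
          have := hh.1
          rw [e] at this; exact this.ge

end Hole

/-! ### Closing an arc of the curve by two segments -/

/-- The closed polygon through `v p, …, v q` and `z`, as a periodic sequence. -/
def closeArc (v : ℤ → Plane) (p q : ℤ) (z : Plane) (i : ℤ) : Plane :=
  if i % (q - p + 2) ≤ q - p then v (p + i % (q - p + 2)) else z

/-- The number of vertices of `closeArc v p q z`. -/
def arcLen (p q : ℤ) : ℕ := (q - p + 2).toNat

/-- The crossing number of the upward ray from `P` with the segment from `a` to `b`. -/
def crossSeg (a b P : Plane) : ℤ := ind (P.2 < a.2) * (ind (P.1 < b.1) - ind (P.1 < a.1))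

theorem crossing_eq (v : ℤ → Plane) (P : Plane) (i : ℤ) : crossing v P i = crossSeg (v i) (v (i + 1)) P := rfl

section closeArc

variable {v : ℤ → Plane} {p q : ℤ} {z : Plane}

theorem arcLen_cast (h : p ≤ q) : (arcLen p q : ℤ) = q - p + 2 := by
  rw [arcLen, Int.toNat_of_nonneg (by omega)]

theorem arcLen_cast_real (h : p ≤ q) : (arcLen p q : ℝ) = q - p + 2 := by
  have := arcLen_cast h
  exact_mod_cast this

theorem closeArc_periodic (h : p ≤ q) (i : ℤ) :
    closeArc v p q z (i + arcLen p q) = closeArc v p q z i := by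
  rw [closeArc, closeArc, arcLen_cast h, Int.add_emod_right]

theorem closeArc_arc {j : ℤ} (h0 : 0 ≤ j) (h1 : j ≤ q - p) : closeArc v p q z j = v (p + j) := by
  rw [closeArc, Int.emod_eq_of_lt h0 (by omega), if_pos h1]

theorem closeArc_last (h : p ≤ q) : closeArc v p q z (q - p + 1) = z := by
  rw [closeArc, Int.emod_eq_of_lt (by omega) (by omega), if_neg (by omega)]

theorem closeArc_neg_one (h : p ≤ q) : closeArc v p q z (-1) = z := by
  rw [← closeArc_periodic h, arcLen_cast h, show (-1 : ℤ) + (q - p + 2) = q - p + 1 by ring,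
    closeArc_last h]

theorem closeArc_wrap (h : p ≤ q) : closeArc v p q z (q - p + 2) = v p := by
  have := closeArc_periodic (v := v) (z := z) h 0
  rw [arcLen_cast h, zero_add] at this
  rw [this, closeArc_arc le_rfl (by omega), add_zero]

theorem closeArc_end (h : p ≤ q) : closeArc v p q z (q - p) = v q := by
  rw [closeArc_arc (by omega) le_rfl]; congr 1; ring

theorem curve_closeArc {t : ℝ} (h0 : 0 ≤ t) (h1 : t ≤ q - p) :
    curve (closeArc v p q z) t = curve v (p + t) := by
  rcases h1.lt_or_eq with h1 | h1
  · have hj0 : 0 ≤ ⌊t⌋ := Int.floor_nonneg.2 h0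
    have hj1 : ⌊t⌋ < q - p := by
      rw [Int.floor_lt]; push_cast; exact h1
    have hf := Int.floor_le t
    have hf' := Int.lt_floor_add_one t
    rw [curve_eq_lineMap _ ⌊t⌋ ⟨hf, hf'.le⟩, curve_eq_lineMap v (p + ⌊t⌋)
      ⟨by push_cast; linarith, by push_cast; linarith⟩, closeArc_arc hj0 hj1.le,
      closeArc_arc (by omega) (by omega), add_assoc]
    push_cast
    congr 1
    ring
  · have e : t = ((q - p : ℤ) : ℝ) := by push_cast; exact h1
    have hpq : p ≤ q := by
      have : (p : ℝ) ≤ q := by linarith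
      exact_mod_cast this
    rw [e, curve_int, closeArc_end hpq, show (p : ℝ) + ((q - p : ℤ) : ℝ) = (q : ℤ) by push_cast; ring, curve_int]

theorem curve_closeArc_fst (h : p ≤ q) {t : ℝ} (ht : t ∈ Icc (0 : ℝ) 1) :
    curve (closeArc v p q z) (q - p + t) = AffineMap.lineMap (v q) z t := by
  have := curve_add (closeArc v p q z) (q - p) ht.1 ht.2
  rw [closeArc_end h, closeArc_last h] at this
  push_cast at this
  exact this

theorem curve_closeArc_snd (h : p ≤ q) {t : ℝ} (ht : t ∈ Icc (0 : ℝ) 1) :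
    curve (closeArc v p q z) (q - p + 1 + t) = AffineMap.lineMap z (v p) t := by
  have := curve_add (closeArc v p q z) (q - p + 1) ht.1 ht.2
  rw [show q - p + 1 + 1 = q - p + 2 by ring, closeArc_last h, closeArc_wrap h] at this
  push_cast at this
  exact this

theorem wind_closeArc (h : p ≤ q) (P : Plane) : wind (arcLen p q) (closeArc v p q z) P =
    ∑ i ∈ Finset.Ico p q, crossing v P i + crossSeg (v q) z P + crossSeg z (v p) P := by
  rw [wind, arcLen_cast h, show q - p + 2 = q - p + 1 + 1 by ring,
    sum_Ico_succ_right _ (by omega), sum_Ico_succ_right _ (by omega), crossing_eq, crossing_eq,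
    closeArc_end h, closeArc_last h, show q - p + 1 + 1 = q - p + 2 by ring, closeArc_wrap h]
  congr 2
  have := sum_Ico_shift (crossing v P) 0 (q - p) p
  rw [zero_add, sub_add_cancel] at this
  rw [← this]
  refine Finset.sum_congr rfl fun j hj => ?_
  rw [Finset.mem_Ico] at hj
  rw [crossing_eq, crossing_eq, closeArc_arc hj.1 hj.2.le, closeArc_arc (by omega) (by omega),
    show p + j = j + p by ring, show p + (j + 1) = j + p + 1 by ring]

theorem exists_mem_Ico_cases {L t : ℝ} (ht : t ∈ Ico (0 : ℝ) (L + 2)) : t < L ∨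
    (∃ r ∈ Ico (0 : ℝ) 1, t = L + r) ∨ ∃ r ∈ Ico (0 : ℝ) 1, t = L + 1 + r := by
  rcases lt_or_ge t L with h | h
  · exact Or.inl h
  rcases lt_or_ge t (L + 1) with h' | h'
  · exact Or.inr (Or.inl ⟨t - L, ⟨by linarith, by linarith⟩, by ring⟩)
  · exact Or.inr (Or.inr ⟨t - (L + 1), ⟨by linarith, by linarith [ht.2]⟩, by ring⟩)

/-- The closing segments may run along the old curve, as long as they use parameters outside the
retained arc: the first those in `[q, e)`, the second those in `[e, p + n)`. Injectivity of the old
curve then excludes every coincidence on the trace. By `h₂₃` one of the segments lies on the trace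
up to its last point, so the two cannot meet off the trace either. -/
theorem closeArc_rectCurve {n : ℕ} (X : RectCurve n v) (hpq : p < q) (hqn : q < p + n) {e : ℝ}
    (he1 : q ≤ e) (he2 : e ≤ p + n)
    (hori : (Horizontal v q ∧ Horizontal (closeArc v p q z) (q - p) ∧
        Vertical (closeArc v p q z) (q - p + 1) ∧ Horizontal v p) ∨
      (Vertical v q ∧ Vertical (closeArc v p q z) (q - p) ∧
        Horizontal (closeArc v p q z) (q - p + 1) ∧ Vertical v p))
    (h₂ : ∀ t ∈ Ico (0 : ℝ) 1, AffineMap.lineMap (v q) z t ∉ trace v ∨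
      ∃ s ∈ Ico (q : ℝ) e, curve v s = AffineMap.lineMap (v q) z t)
    (h₃ : ∀ t ∈ Ico (0 : ℝ) 1, AffineMap.lineMap z (v p) t ∉ trace v ∨
      ∃ s ∈ Ico e (p + n), curve v s = AffineMap.lineMap z (v p) t)
    (h₂₃ : (∀ t ∈ Ico (0 : ℝ) 1, AffineMap.lineMap (v q) z t ∈ trace v) ∨
      ∀ t ∈ Ico (0 : ℝ) 1, AffineMap.lineMap z (v p) t ∈ trace v) :
    RectCurve (arcLen p q) (closeArc v p q z) := by
  set u := closeArc v p q z with hu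
  have hpq' : p ≤ q := hpq.le
  have hN := arcLen_cast hpq'
  have hper : ∀ i, u (i + arcLen p q) = u i := closeArc_periodic hpq'
  have hedge : ∀ j, 0 ≤ j → j < q - p → u j = v (p + j) ∧ u (j + 1) = v (p + j + 1) := fun j h0 h1 =>
    ⟨closeArc_arc h0 h1.le, by rw [hu, closeArc_arc (by omega) (by omega), add_assoc]⟩
  have hHor : ∀ j, 0 ≤ j → j < q - p → (Horizontal u j ↔ Horizontal v (p + j)) := by
    intro j h0 h1
    obtain ⟨e1, e2⟩ := hedge j h0 h1
    simp only [Horizontal, Rightward, Leftward, e1, e2]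
  have hVer : ∀ j, 0 ≤ j → j < q - p → (Vertical u j ↔ Vertical v (p + j)) := by
    intro j h0 h1
    obtain ⟨e1, e2⟩ := hedge j h0 h1
    simp only [Vertical, Upward, Downward, e1, e2]
  have hp0 := hHor 0 le_rfl (by omega)
  have hp1 := hVer 0 le_rfl (by omega)
  rw [add_zero] at hp0 hp1
  have hpN : ∀ j, (Horizontal u (j + arcLen p q) ↔ Horizontal u j) ∧
      (Vertical u (j + arcLen p q) ↔ Vertical u j) := by
    intro j
    simp only [Horizontal, Vertical, Rightward, Leftward, Upward, Downward,
      show j + (arcLen p q : ℤ) + 1 = j + 1 + arcLen p q by ring, hper, and_self]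
  have halt0 : ∀ i ∈ Ico 0 (arcLen p q : ℤ),
      (Horizontal u i ∧ Vertical u (i + 1)) ∨ (Vertical u i ∧ Horizontal u (i + 1)) := by
    intro i hi
    rw [hN] at hi
    obtain ⟨hi0, hi1⟩ := hi
    rcases lt_or_ge (i + 1) (q - p) with h | h
    · rw [hHor i hi0 (by omega), hVer i hi0 (by omega), hHor (i + 1) (by omega) h,
        hVer (i + 1) (by omega) h, ← add_assoc]
      exact X.alternating (p + i)
    · rcases (show i = q - p - 1 ∨ i = q - p ∨ i = q - p + 1 by omega) with h | h | h
      · rw [hHor i hi0 (by omega), hVer i hi0 (by omega)]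
        rw [show i + 1 = q - p by omega, show p + i = q - 1 by omega]
        rcases hori with ⟨k1, k2, k3, k4⟩ | ⟨k1, k2, k3, k4⟩
        · exact Or.inr ⟨X.vertical_pred.2 k1, k2⟩
        · exact Or.inl ⟨X.horizontal_pred.2 k1, k2⟩
      · rw [h]
        rcases hori with ⟨k1, k2, k3, k4⟩ | ⟨k1, k2, k3, k4⟩
        · exact Or.inl ⟨k2, k3⟩
        · exact Or.inr ⟨k2, k3⟩
      · have := hpN 0
        rw [zero_add, hN] at this
        rw [h, show q - p + 1 + 1 = q - p + 2 by ring, this.1, this.2, hp0, hp1]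
        rcases hori with ⟨k1, k2, k3, k4⟩ | ⟨k1, k2, k3, k4⟩
        · exact Or.inr ⟨k3, k4⟩
        · exact Or.inl ⟨k3, k4⟩
  have hNpos : 0 < arcLen p q := by
    have : (0 : ℤ) < arcLen p q := by omega
    exact_mod_cast this
  have hne1 : v q ≠ z := by
    intro h
    have hh : Horizontal u (q - p) ∨ Vertical u (q - p) := by
      rcases hori with ⟨k1, k2, k3, k4⟩ | ⟨k1, k2, k3, k4⟩ <;> simp [k2]
    simp only [Horizontal, Vertical, Rightward, Leftward, Upward, Downward, hu, closeArc_end hpq',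
      closeArc_last hpq', h, lt_irrefl, and_false, or_self] at hh
  have hne2 : z ≠ v p := by
    intro h
    have hh : Horizontal u (q - p + 1) ∨ Vertical u (q - p + 1) := by
      rcases hori with ⟨k1, k2, k3, k4⟩ | ⟨k1, k2, k3, k4⟩ <;> simp [k3]
    simp only [Horizontal, Vertical, Rightward, Leftward, Upward, Downward, hu,
      show q - p + 1 + 1 = q - p + 2 by ring, closeArc_wrap hpq',
      closeArc_last hpq', h, lt_irrefl, and_false, or_self] at hh
  refine ⟨hNpos, hper, fun i => ?_, ?_⟩
  · obtain ⟨k, hk⟩ := RectCurve.exists_int_mem_Ico hNpos 0 i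
    rw [zero_add] at hk
    have hP : Function.Periodic (fun i => (Horizontal u i ∧ Vertical u (i + 1)) ∨
        (Vertical u i ∧ Horizontal u (i + 1))) (arcLen p q : ℤ) := by
      intro j
      simp only [show j + (arcLen p q : ℤ) + 1 = j + 1 + arcLen p q by ring, hpN]
    have := hP.int_mul k i
    simp only [Int.cast_id] at this
    rw [← this]
    exact halt0 _ hk
  · have hpR : (p : ℝ) < q := by exact_mod_cast hpq
    have hqnR : (q : ℝ) < p + n := by exact_mod_cast hqn
    intro t ht t' ht' heq
    rw [arcLen_cast_real hpq'] at ht ht'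
    wlog hle : t ≤ t' generalizing t t'
    · exact (this ht' ht heq.symm (not_le.1 hle).le).symm
    have addr : ∀ {s s' : ℝ}, s ∈ Ico (p : ℝ) (p + n) → s' ∈ Ico (p : ℝ) (p + n) →
        curve v s = curve v s' → s = s' := fun hs hs' h => X.eq_of_curve_eq h hs hs'
    rcases exists_mem_Ico_cases ht with h | ⟨r, hr, rfl⟩ | ⟨r, hr, rfl⟩ <;>
      rcases exists_mem_Ico_cases ht' with h' | ⟨r', hr', rfl⟩ | ⟨r', hr', rfl⟩
    · rw [hu, curve_closeArc ht.1 h.le, curve_closeArc ht'.1 h'.le] at heq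
      have := addr (s := p + t) (s' := p + t') ⟨by linarith [ht.1], by linarith⟩
        ⟨by linarith [ht'.1], by linarith⟩ heq
      linarith
    · exfalso
      rw [hu, curve_closeArc ht.1 h.le, curve_closeArc_fst hpq' ⟨hr'.1, hr'.2.le⟩] at heq
      rcases h₂ r' hr' with h2 | ⟨s, hs, h2⟩
      · exact h2 (heq ▸ curve_mem_trace v _)
      · have := addr (s := p + t) (s' := s) ⟨by linarith [ht.1], by linarith⟩
          ⟨by linarith [hs.1], by linarith [hs.2]⟩ (heq.trans h2.symm)
        linarith [hs.1]
    · exfalso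
      rw [hu, curve_closeArc ht.1 h.le, curve_closeArc_snd hpq' ⟨hr'.1, hr'.2.le⟩] at heq
      rcases h₃ r' hr' with h2 | ⟨s, hs, h2⟩
      · exact h2 (heq ▸ curve_mem_trace v _)
      · have := addr (s := p + t) (s' := s) ⟨by linarith [ht.1], by linarith⟩
          ⟨by linarith [hs.1], by linarith [hs.2]⟩ (heq.trans h2.symm)
        linarith [hs.1]
    · linarith [hr.1]
    · rw [hu, curve_closeArc_fst hpq' ⟨hr.1, hr.2.le⟩, curve_closeArc_fst hpq' ⟨hr'.1, hr'.2.le⟩] at heq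
      rw [AffineMap.lineMap_injective ℝ hne1 heq]
    · exfalso
      rw [hu, curve_closeArc_fst hpq' ⟨hr.1, hr.2.le⟩, curve_closeArc_snd hpq' ⟨hr'.1, hr'.2.le⟩] at heq
      have hT : AffineMap.lineMap (v q) z r ∈ trace v := by
        rcases h₂₃ with h | h
        · exact h r hr
        · rw [heq]; exact h r' hr'
      rcases h₂ r hr with h2 | ⟨s, hs, h2⟩
      · exact h2 hT
      rcases h₃ r' hr' with h3 | ⟨s', hs', h3⟩
      · exact h3 (heq ▸ hT)
      have := addr ⟨by linarith [hs.1], by linarith [hs.2]⟩ ⟨by linarith [hs'.1], by linarith [hs'.2]⟩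
        (h2.trans (heq.trans h3.symm))
      linarith [hs.2, hs'.1]
    · linarith [hr.1, ht'.1]
    · linarith [hr.1, hr'.2]
    · rw [hu, curve_closeArc_snd hpq' ⟨hr.1, hr.2.le⟩, curve_closeArc_snd hpq' ⟨hr'.1, hr'.2.le⟩] at heq
      rw [AffineMap.lineMap_injective ℝ hne2 heq]

theorem mem_trace_closeArc {n : ℕ} (hN : RectCurve n (closeArc v p q z)) (hn : n = arcLen p q)
    (hpq : p ≤ q) {P : Plane} : P ∈ trace (closeArc v p q z) ↔ (∃ s ∈ Icc (p : ℝ) q, curve v s = P) ∨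
      P ∈ segment ℝ (v q) z ∨ P ∈ segment ℝ z (v p) := by
  have hpR : (p : ℝ) ≤ q := by exact_mod_cast hpq
  constructor
  · intro hP
    rw [hN.trace_eq_image 0, hn, arcLen_cast_real hpq, zero_add] at hP
    obtain ⟨t, ht, rfl⟩ := hP
    rcases exists_mem_Ico_cases ht with h | ⟨r, hr, rfl⟩ | ⟨r, hr, rfl⟩
    · left
      exact ⟨p + t, ⟨by linarith [ht.1], by linarith⟩, (curve_closeArc ht.1 h.le).symm⟩
    · right; left
      rw [curve_closeArc_fst hpq ⟨hr.1, hr.2.le⟩, segment_eq_image_lineMap]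
      exact ⟨r, ⟨hr.1, hr.2.le⟩, rfl⟩
    · right; right
      rw [curve_closeArc_snd hpq ⟨hr.1, hr.2.le⟩, segment_eq_image_lineMap]
      exact ⟨r, ⟨hr.1, hr.2.le⟩, rfl⟩
  · rintro (⟨s, hs, rfl⟩ | h | h)
    · refine mem_trace.2 ⟨s - p, ?_⟩
      rw [curve_closeArc (by linarith [hs.1]) (by linarith [hs.2]), add_sub_cancel]
    · rw [segment_eq_image_lineMap] at h
      obtain ⟨r, hr, rfl⟩ := h
      exact mem_trace.2 ⟨_, curve_closeArc_fst hpq hr⟩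
    · rw [segment_eq_image_lineMap] at h
      obtain ⟨r, hr, rfl⟩ := h
      exact mem_trace.2 ⟨_, curve_closeArc_snd hpq hr⟩

end closeArc


/-! ### Vertical cuts above left notches -/

theorem crossSeg_add {a b c P : Plane} (h : a.2 = b.2) :
    crossSeg a b P + crossSeg b c P = crossSeg a c P := by
  simp only [crossSeg, h]; ring

theorem crossSeg_vertical {a b P : Plane} (h : a.1 = b.1) : crossSeg a b P = 0 := by
  simp only [crossSeg, h, sub_self, mul_zero]

theorem crossing_vertical {v : ℤ → Plane} {i : ℤ} (h : Vertical v i) (P : Plane) :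
    crossing v P i = 0 := by
  rw [crossing_eq, crossSeg_vertical]
  rcases h with h | h <;> exact h.1

theorem RectCurve.eq_add_of_vertex_eq_curve {n : ℕ} {v : ℤ → Plane} (X : RectCurve n v) {s : ℝ} {i : ℤ}
    (h : v i = curve v s) : ∃ k : ℤ, s = i + k * n :=
  X.inj (by rw [curve_int, h])

theorem RectCurve.eq_add_of_vertex_eq {n : ℕ} {v : ℤ → Plane} (X : RectCurve n v) {i j : ℤ}
    (h : v i = v j) : ∃ k : ℤ, j = i + k * n := by
  rw [← curve_int v j] at h
  obtain ⟨k, hk⟩ := X.eq_add_of_vertex_eq_curve h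
  exact ⟨k, by exact_mod_cast hk⟩

/-- The data of a vertical cut of a hole that goes upward from the vertex `v a`, the upper end of a
left notch. The part of the boundary from `v a` to `v m` followed by `zA` bounds the western piece,
the part from `v pB` to `v (a - 1 + n)` followed by `zB` bounds the eastern one. -/
structure Cut (H : Hole) (a : ℤ) where
  m : ℤ
  pB : ℤ
  zA : Plane
  zB : Plane
  sA : ℝ
  sB : ℝ
  yN : ℝ
  up : Upward H.v (a - 1)
  left : Leftward H.v a
  right : Rightward H.v (a - 2)
  lt_m : a + 1 < m
  m_lt : m < pB
  pB_lt : pB < a - 1 + H.n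
  right_m : Rightward H.v m
  zA_snd : (H.v m).2 = zA.2
  lt_zA : (H.v m).1 < zA.1
  zA_fst : zA.1 = (H.v a).1
  yN_le_zA : yN ≤ zA.2
  zB_fst : zB.1 = (H.v a).1
  zB_snd : zB.2 = (H.v pB).2
  yN_le_zB : yN ≤ zB.2
  dir_zB : (Rightward H.v (pB - 1) ∧ zB.1 < (H.v pB).1) ∨
    (Leftward H.v (pB - 1) ∧ (H.v pB).1 < zB.1)
  lt_yN : (H.v a).2 < yN
  sA_mem : sA ∈ Ioc (m : ℝ) (m + 1)
  curve_sA : curve H.v sA = zA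
  sB_mem : sB ∈ Ico (pB - 1 : ℝ) pB
  curve_sB : curve H.v sB = zB
  sA_le : sA ≤ sB
  crossing_sum : ∀ P, ∑ i ∈ Finset.Ico m pB, crossing H.v P i =
    crossSeg (H.v m) zA P + crossSeg zB (H.v pB) P
  inner_of_mem : ∀ y ∈ Ioo (H.v a).2 yN, ((H.v a).1, y) ∈ H.inner
  mid_zA : ∀ y ∈ Icc yN zA.2, ∃ s ∈ Icc sA sB, curve H.v s = ((H.v a).1, y)
  mid_zB : ∀ y ∈ Ico yN zB.2, ∃ s ∈ Ico sA sB, curve H.v s = ((H.v a).1, y)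
  mid : ∀ s ∈ Icc sA sB, (curve H.v s).1 = (H.v a).1 ∧ yN ≤ (curve H.v s).2 ∧
    ((curve H.v s).2 ≤ zA.2 ∨ (curve H.v s).2 ≤ zB.2)
  mid_types : ∀ i ∈ Ioo m pB, ¬ RM H.v i ∧ ¬ LM H.v i
  mid_down : ∀ i ∈ Ioo m pB, Downward H.v i → H.v (i + 1) = ((H.v a).1, yN)
  mid_notch : Leftward H.v (pB - 1) → m < pB - 2 ∧ LN H.v (pB - 2)

namespace Hole
variable {H : Hole}

theorem lineMap_horizontal_fst {v : ℤ → Plane} {j : ℤ} (h : Rightward v j) {s : ℝ} (hs : s ∈ Ioo (j : ℝ) (j + 1)) :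
    (v j).1 < (curve v s).1 ∧ (curve v s).1 < (v (j + 1)).1 := by
  rw [curve_eq_lineMap v j ⟨hs.1.le, hs.2.le⟩, lineMap_fst]
  have h1 : 0 < s - j := by linarith [hs.1]
  have h2 : s - j < 1 := by linarith [hs.2]
  have := h.2
  constructor <;> nlinarith

theorem QNstar_of_downward {i m : ℤ} (hi : Downward H.v i) (h : H.v (i + 1) = H.QN m) :
    H.QNstar m = H.v i := by
  have hex : ∃ i, Downward H.v i ∧ H.v (i + 1) = H.QN m := ⟨i, hi, h⟩
  rw [QNstar, dif_pos hex]
  obtain ⟨k, hk⟩ := H.rectCurve.eq_add_of_vertex_eq (h.trans hex.choose_spec.2.symm)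
  rw [show hex.choose = i + k * H.n by omega, H.rectCurve.periodic_int]

theorem QNstar_of_not_downward {m : ℤ} (h : ∀ i, Downward H.v i → H.v (i + 1) ≠ H.QN m) :
    H.QNstar m = H.QN m := by
  rw [QNstar, dif_neg]
  rintro ⟨i, h1, h2⟩
  exact h i h1 h2

/-- The three cases of `hit_cases` become three choices of data. Inside a rightward edge, both
pieces use the point `N` as extra vertex. At a falling corner, the downward edge is attached to the
cut on the western side, so `zA` is its upper vertex and `zB` is `N`. At a corner from rightward to
upward, the upward edge is attached to the cut on the eastern side, so `zA` is `N` and `zB` is the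
upper vertex of that edge. -/
theorem exists_cut (hBLS : H.IsBLS) {m₀ a : ℤ} (ha : a = m₀ + 1) (hN : H.IsLeftNotch m₀) :
    ∃ c : Cut H a, c.yN = (H.QN m₀).2 ∧ c.zA = H.QNstar m₀ := by
  have X := H.rectCurve
  subst ha
  obtain ⟨hR, hU, hL⟩ := hN
  obtain ⟨hmem, hfst, hlt, hin⟩ := first_hit hU hL
  set a := m₀ + 1 with ha
  have hQ : H.Q m₀ = H.v a := rfl
  rw [hQ] at hfst hlt hin
  set N := H.QN m₀ with hNdef
  have hNeq : ((H.v a).1, N.2) = N := by rw [← hfst]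
  obtain ⟨j, hj, hcase⟩ := hit_cases hlt (by rwa [hNeq]) hin a
  rw [hNeq] at hcase
  have pn : ∀ i, H.v (i + H.n) = H.v i := H.periodic
  have dn : ∀ i, (Rightward H.v (i + H.n) ↔ Rightward H.v i) ∧ (Leftward H.v (i + H.n) ↔ Leftward H.v i) ∧
      (Upward H.v (i + H.n) ↔ Upward H.v i) ∧ (Downward H.v (i + H.n) ↔ Downward H.v i) := fun i => by
    have := X.dir_periodic i 1
    rwa [one_mul] at this
  have hU1 : Upward H.v (a - 1) := by rw [ha, add_sub_cancel_right]; exact hU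
  have hR2 : Rightward H.v (a - 2) := by rw [ha, show m₀ + 1 - 2 = m₀ - 1 by ring]; exact hR
  have e1 : a - 2 + 1 = a - 1 := by ring
  have e0 : a - 1 + 1 = a := by ring
  have low1 : (H.v (a - 1)).2 < (H.v a).2 := by have := hU1.2; rwa [e0] at this
  have low2 : (H.v (a - 2)).2 < (H.v a).2 := by have := hR2.1; rw [e1] at this; rwa [this]
  have hj1 := hj.1
  have hj2 := hj.2
  rcases hcase with ⟨hjR, s, hs, hsN⟩ | ⟨hjD, hjR, hvj⟩ | ⟨hjR, hjU, hvj⟩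
  · have g1 : j ≠ a := by rintro rfl; exact hL.not_rightward hjR
    have g2 : j ≠ a + 1 := by
      rintro rfl
      exact (X.vertical_succ.2 hL.horizontal).not_horizontal hjR.horizontal
    have g3 : j ≠ a - 1 + H.n := by
      rintro rfl
      exact ((dn _).2.2.1.2 hU1).vertical.not_horizontal hjR.horizontal
    have hjN : (H.v j).2 = N.2 := by
      rw [← hsN, RectCurve.snd_curve_of_horizontal hjR.horizontal ⟨hs.1.le, hs.2.le⟩]
    have g4 : j ≠ a - 2 + H.n := by
      rintro rfl
      rw [pn] at hjN
      linarith
    have hb := lineMap_horizontal_fst hjR hs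
    rw [hsN] at hb
    refine ⟨⟨j, j + 1, N, N, s, s, N.2, hU1, hL, hR2, by omega, by omega, by omega, hjR, hjN,
      hb.1, hfst, le_rfl, hfst, ?_, le_rfl, Or.inl ⟨by rwa [add_sub_cancel_right], hb.2⟩, hlt,
      ⟨hs.1, hs.2.le⟩, hsN, ⟨?_, ?_⟩, hsN, le_rfl, ?_, hin, ?_, ?_, ?_, fun i hi => ?_,
      fun i hi hD => ?_, fun h => ?_⟩, rfl, ?_⟩
    · rw [← hjN, hjR.1]
    · push_cast; linarith [hs.1]
    · push_cast; exact hs.2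
    · intro P
      rw [sum_Ico_succ_right _ le_rfl, Finset.Ico_self, Finset.sum_empty, zero_add, crossing_eq,
        crossSeg_add hjN]
    · intro y hy
      rw [le_antisymm hy.2 hy.1, hNeq]
      exact ⟨s, ⟨le_rfl, le_rfl⟩, hsN⟩
    · intro y hy
      exact absurd hy.1 (not_le.2 hy.2)
    · intro t ht
      rw [le_antisymm ht.2 ht.1, hsN]
      exact ⟨hfst, le_rfl, Or.inl le_rfl⟩
    · have := hi.1; have := hi.2; omega
    · have := hi.1; have := hi.2; omega
    · rw [add_sub_cancel_right] at h; exact absurd hjR h.not_rightward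
    -- `N` is an interior point of an edge, hence not a vertex at which a downward edge could end.
    · refine (QNstar_of_not_downward fun i hi h => ?_).symm
      rw [← hNdef, ← hsN] at h
      obtain ⟨k, hk⟩ := H.rectCurve.eq_add_of_vertex_eq_curve h
      have h1 := hs.1
      have h2 := hs.2
      rw [hk] at h1 h2
      have h1' : j < i + 1 + k * H.n := by exact_mod_cast h1
      have h2' : i + 1 + k * H.n < j + 1 := by exact_mod_cast h2
      omega
  · have e2 : j - 1 + 1 = j := by ring
    have e3 : j - 2 + 1 = j - 1 := by ring
    -- The absence of right notches enters here: the edge before the downward one cannot come from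
    -- the right.
    have hRm : Rightward H.v (j - 2) := by
      have : Horizontal H.v (j - 2) := by
        rw [show j - 2 = j - 1 - 1 by ring]; exact X.horizontal_pred.2 hjD.vertical
      rcases this with h | h
      · exact h
      · exfalso
        refine hBLS.1 (j - 1) ⟨?_, hjD, ?_⟩
        · rw [show j - 1 - 1 = j - 2 by ring]; exact h
        · rw [e2]; exact hjR
    have g1 : j ≠ a := by rintro rfl; exact hL.not_rightward hjR
    have g2 : j ≠ a + 1 := by
      rintro rfl
      exact (X.vertical_succ.2 hL.horizontal).not_horizontal hjR.horizontal
    have g2' : j ≠ a + 2 := by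
      rintro rfl
      rw [add_sub_cancel_right] at hRm
      exact hL.not_rightward hRm
    have g2'' : j ≠ a + 3 := by
      rintro rfl
      rw [show a + 3 - 2 = a + 1 by ring] at hRm
      exact (X.vertical_succ.2 hL.horizontal).not_horizontal hRm.horizontal
    have g3 : j ≠ a - 1 + H.n := by
      rintro rfl
      exact ((dn _).2.2.1.2 hU1).vertical.not_horizontal hjR.horizontal
    have g4 : j ≠ a - 2 + H.n := by
      rintro rfl
      rw [pn] at hvj
      rw [hvj] at low2
      linarith
    have hx1 : (H.v (j - 1)).1 = N.1 := by rw [hjD.1, e2, hvj]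
    have hy1 : N.2 < (H.v (j - 1)).2 := by have := hjD.2; rwa [e2, hvj] at this
    have hRm1 := hRm.1
    have hRm2 := hRm.2
    rw [e3] at hRm1 hRm2
    refine ⟨⟨j - 2, j + 1, H.v (j - 1), N, (j - 1 : ℤ), j, N.2, hU1, hL, hR2, by omega, by omega,
      by omega, hRm, hRm1, hRm2, hx1.trans hfst, hy1.le, hfst, ?_, le_rfl,
      Or.inl ⟨by rwa [add_sub_cancel_right], ?_⟩, hlt, ⟨?_, ?_⟩, curve_int _ _, ⟨?_, ?_⟩,
      by rw [curve_int, hvj], ?_, ?_, hin, ?_, ?_, ?_, fun i hi => ?_, fun i hi hD => ?_,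
      fun h => ?_⟩, rfl, ?_⟩
    · rw [← hvj, hjR.1]
    · rw [← hvj]; exact hjR.2
    · push_cast; linarith
    · push_cast; linarith
    · push_cast; linarith
    · push_cast; linarith
    · push_cast; linarith
    · intro P
      rw [show j + 1 = j - 2 + 1 + 1 + 1 by ring, sum_Ico_succ_right _ (by omega),
        sum_Ico_succ_right _ (by omega), sum_Ico_succ_right _ le_rfl, Finset.Ico_self,
        Finset.sum_empty, zero_add, e3, e2, crossing_vertical hjD.vertical, crossing_eq, crossing_eq,
        e3, hvj, add_zero]
    · intro y hy
      obtain ⟨t, ht, h⟩ := exists_param_vertical (v := H.v) (i := j - 1) (y := y) hjD.1 (by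
        rw [e2, hvj, uIcc_comm, uIcc_of_le hy1.le]; exact hy)
      refine ⟨_, ⟨?_, ?_⟩, h.trans ?_⟩
      · linarith [ht.1]
      · push_cast; linarith [ht.2]
      · rw [e2, hvj, hfst]
    · intro y hy
      exact absurd hy.1 (not_le.2 hy.2)
    · intro t ht
      have ht' : t ∈ Icc ((j - 1 : ℤ) : ℝ) ((j - 1 : ℤ) + 1) := ⟨ht.1, by push_cast; linarith [ht.2]⟩
      rw [RectCurve.fst_curve_of_vertical hjD.vertical ht', hx1]
      have := snd_curve_mem H.v ht'
      rw [e2, hvj, uIcc_comm, uIcc_of_le hy1.le] at this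
      exact ⟨hfst, this.1, Or.inl this.2⟩
    · have := hi.1
      have := hi.2
      rcases (show i = j - 1 ∨ i = j by omega) with rfl | rfl
      · refine ⟨fun h => ?_, fun h => hjD.not_upward h.2.1⟩
        have := h.2.2
        rw [e2] at this
        exact this.not_rightward hjR
      · exact ⟨fun h => h.2.1.vertical.not_horizontal hjR.horizontal,
          fun h => h.2.1.vertical.not_horizontal hjR.horizontal⟩
    · have := hi.1
      have := hi.2
      rcases (show i = j - 1 ∨ i = j by omega) with rfl | rfl
      · rw [e2, hvj, hNeq]
      · exact absurd hjR.horizontal hD.vertical.not_horizontal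
    · rw [add_sub_cancel_right] at h; exact absurd hjR h.not_rightward
    · exact (QNstar_of_downward hjD (by rw [e2, hvj])).symm
  · have e2 : j - 1 + 1 = j := by ring
    have g1 : j ≠ a := by rintro rfl; exact hjU.vertical.not_horizontal hL.horizontal
    have g2 : j ≠ a + 1 := by
      rintro rfl
      rw [add_sub_cancel_right] at hjR
      exact hL.not_rightward hjR
    have g2' : j ≠ a + 2 := by
      rintro rfl
      rw [show a + 2 - 1 = a + 1 by ring] at hjR
      exact (X.vertical_succ.2 hL.horizontal).not_horizontal hjR.horizontal
    have g3 : j ≠ a - 1 + H.n := by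
      rintro rfl
      rw [pn] at hvj
      rw [hvj] at low1
      linarith
    have g4 : j ≠ a - 2 + H.n := by
      rintro rfl
      exact ((dn _).1.2 hR2).horizontal.not_vertical hjU.vertical
    have hjU1 := hjU.1
    have hjU2 := hjU.2
    rw [hvj] at hjU1 hjU2
    have g5 : j ≠ a - 3 + H.n := by
      rintro rfl
      rw [show a - 3 + (H.n : ℤ) + 1 = a - 2 + H.n by ring, pn] at hjU2
      linarith
    have hRm1 := hjR.1
    have hRm2 := hjR.2
    rw [e2, hvj] at hRm1 hRm2
    have hH : Horizontal H.v (j + 1) := X.horizontal_succ.2 hjU.vertical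
    have e4 : j + 2 - 1 = j + 1 := by ring
    have e5 : j + 1 + 1 = j + 2 := by ring
    have hH2 : (H.v (j + 1)).2 = (H.v (j + 2)).2 := by
      rw [← e5]
      rcases hH with h | h <;> exact h.1
    refine ⟨⟨j - 1, j + 2, N, H.v (j + 1), j, (j + 1 : ℤ), N.2, hU1, hL, hR2, by omega, by omega,
      by omega, hjR, hRm1, hRm2, hfst, le_rfl, hjU1.symm.trans hfst, hH2, hjU2.le,
      ?_, hlt, ⟨?_, ?_⟩, by rw [curve_int, hvj], ⟨?_, ?_⟩,
      curve_int _ _, ?_, ?_, hin, ?_, ?_, ?_, fun i hi => ?_, fun i hi hD => ?_,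
      fun h => ?_⟩, rfl, ?_⟩
    · rw [e4]
      rcases hH with h | h
      · exact Or.inl ⟨h, by have := h.2; rwa [e5] at this⟩
      · exact Or.inr ⟨h, by have := h.2; rwa [e5] at this⟩
    · push_cast; linarith
    · push_cast; linarith
    · push_cast; linarith
    · push_cast; linarith
    · push_cast; linarith
    · intro P
      rw [show j + 2 = j - 1 + 1 + 1 + 1 by ring, sum_Ico_succ_right _ (by omega),
        sum_Ico_succ_right _ (by omega), sum_Ico_succ_right _ le_rfl, Finset.Ico_self,
        Finset.sum_empty, zero_add, e2, crossing_vertical hjU.vertical, crossing_eq, crossing_eq,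
        e2, hvj, add_zero]
    · intro y hy
      rw [le_antisymm hy.2 hy.1, hNeq]
      exact ⟨j, ⟨le_rfl, by push_cast; linarith⟩, by rw [curve_int, hvj]⟩
    · intro y hy
      obtain ⟨t, ht, h⟩ := exists_param_vertical (v := H.v) (i := j) (y := y) hjU.1 (by
        rw [hvj, uIcc_of_le hjU2.le]; exact ⟨hy.1, hy.2.le⟩)
      rw [← hjU1, hfst] at h
      refine ⟨_, ⟨?_, ?_⟩, h⟩
      · linarith [ht.1]
      · push_cast
        have : t ≠ 1 := by
          rintro rfl
          rw [show (j : ℝ) + 1 = ((j + 1 : ℤ) : ℝ) by push_cast; ring, curve_int] at h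
          have h' := hy.2
          rw [h] at h'
          exact lt_irrefl _ h'
        linarith [lt_of_le_of_ne ht.2 this]
    · intro t ht
      have ht' : t ∈ Icc (j : ℝ) (j + 1) := ⟨ht.1, by have := ht.2; push_cast at this; linarith⟩
      rw [RectCurve.fst_curve_of_vertical hjU.vertical ht', hvj]
      have := snd_curve_mem H.v ht'
      rw [hvj, uIcc_of_le hjU2.le] at this
      exact ⟨hfst, this.1, Or.inr this.2⟩
    · have := hi.1
      have := hi.2
      rcases (show i = j ∨ i = j + 1 by omega) with rfl | rfl
      · exact ⟨fun h => hjU.not_downward h.2.1, fun h => h.1.not_rightward hjR⟩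
      · exact ⟨fun h => h.2.1.vertical.not_horizontal hH, fun h => h.2.1.vertical.not_horizontal hH⟩
    · have := hi.1
      have := hi.2
      rcases (show i = j ∨ i = j + 1 by omega) with rfl | rfl
      · exact absurd hD hjU.not_downward
      · exact absurd hH hD.vertical.not_horizontal
    · rw [e4] at h
      exact ⟨by omega, by rw [add_sub_cancel_right]; exact ⟨hjR, hjU, h⟩⟩
    -- The only edge that ends at `N` is the rightward edge `j - 1`.
    · refine (QNstar_of_not_downward fun i hi h => ?_).symm
      rw [← hNdef, ← hvj] at h
      obtain ⟨k, hk⟩ := H.rectCurve.eq_add_of_vertex_eq h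
      have := (X.dir_periodic i k).2.2.2.2 hi
      rw [show i + k * (H.n : ℤ) = j - 1 by rw [hk]; ring] at this
      exact this.vertical.not_horizontal hjR.horizontal

end Hole

/-! ### The two pieces as simple closed curves -/

theorem mem_segment_vertical {a b P : Plane} (h : a.1 = b.1) :
    P ∈ segment ℝ a b ↔ P.1 = a.1 ∧ P.2 ∈ uIcc a.2 b.2 := by
  obtain ⟨x, y₁⟩ := a
  obtain ⟨x', y₂⟩ := b
  obtain ⟨p, q⟩ := P
  obtain rfl : x = x' := h
  rw [← Prod.image_mk_segment_right, segment_eq_uIcc]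
  simp only [mem_image, Prod.mk.injEq]
  constructor
  · rintro ⟨y, hy, rfl, rfl⟩
    exact ⟨rfl, hy⟩
  · rintro ⟨rfl, h⟩
    exact ⟨q, h, rfl, rfl⟩

theorem lineMap_curve (v : ℤ → Plane) {i : ℤ} {s s' t : ℝ} (hs : s ∈ Icc (i : ℝ) (i + 1))
    (hs' : s' ∈ Icc (i : ℝ) (i + 1)) (ht : t ∈ Icc (0 : ℝ) 1) :
    AffineMap.lineMap (curve v s) (curve v s') t = curve v (s + t * (s' - s)) := by
  have h1 := hs.1
  have h2 := hs.2
  have h1' := hs'.1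
  have h2' := hs'.2
  have h3 := ht.1
  have h4 : 0 ≤ 1 - t := by linarith [ht.2]
  have hm : s + t * (s' - s) ∈ Icc (i : ℝ) (i + 1) := by constructor <;> nlinarith
  rw [curve_eq_lineMap v i hs, curve_eq_lineMap v i hs', curve_eq_lineMap v i hm]
  refine Prod.ext ?_ ?_
  · simp only [lineMap_fst]; ring
  · simp only [lineMap_snd]; ring

theorem segment_curve (v : ℤ → Plane) {i : ℤ} {s s' : ℝ} (hs : s ∈ Icc (i : ℝ) (i + 1))
    (hs' : s' ∈ Icc (i : ℝ) (i + 1)) (h : s ≤ s') :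
    segment ℝ (curve v s) (curve v s') = curve v '' Icc s s' := by
  rw [segment_eq_image_lineMap, ← segment_eq_Icc h, segment_eq_image_lineMap, image_image]
  refine image_congr fun t ht => ?_
  rw [lineMap_curve v hs hs' ht, AffineMap.lineMap_apply_module']
  congr 1
  simp only [smul_eq_mul]; ring

namespace Cut

variable {H : Hole} {a : ℤ} (c : Cut H a)

theorem lt_m_real : (a : ℝ) + 1 < c.m := by exact_mod_cast c.lt_m

theorem pB_lt_real : (c.pB : ℝ) < a - 1 + H.n := by exact_mod_cast c.pB_lt

include c in
theorem fst_low : (H.v (a - 1)).1 = (H.v a).1 := by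
  have := c.up.1; rwa [sub_add_cancel] at this

include c in
theorem low_lt : (H.v (a - 1)).2 < (H.v a).2 := by
  have := c.up.2; rwa [sub_add_cancel] at this

theorem v_m_eq : H.v c.m = curve H.v c.m := (curve_int _ _).symm

theorem mem_zA (s : ℝ) (hs : s ∈ Icc (c.m : ℝ) c.sA) : s ∈ Icc (c.m : ℝ) (c.m + 1) :=
  ⟨hs.1, hs.2.trans c.sA_mem.2⟩

theorem mem_zB (s : ℝ) (hs : s ∈ Icc c.sB c.pB) : s ∈ Icc ((c.pB - 1 : ℤ) : ℝ) ((c.pB - 1 : ℤ) + 1) := by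
  push_cast
  exact ⟨c.sB_mem.1.trans hs.1, by linarith [hs.2]⟩

theorem segment_west : segment ℝ (H.v c.m) c.zA = curve H.v '' Icc (c.m : ℝ) c.sA := by
  rw [← c.curve_sA, v_m_eq]
  exact segment_curve _ (c.mem_zA _ ⟨le_rfl, c.sA_mem.1.le⟩) (c.mem_zA _ ⟨c.sA_mem.1.le, le_rfl⟩)
    c.sA_mem.1.le

theorem segment_east : segment ℝ c.zB (H.v c.pB) = curve H.v '' Icc c.sB c.pB := by
  rw [← c.curve_sB, ← curve_int H.v c.pB]
  exact segment_curve _ (c.mem_zB _ ⟨le_rfl, c.sB_mem.2.le⟩) (c.mem_zB _ ⟨c.sB_mem.2.le, le_rfl⟩)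
    c.sB_mem.2.le

theorem not_mem_of_mem {y : ℝ} (hy : y ∈ Ioo (H.v a).2 c.yN) : ((H.v a).1, y) ∉ trace H.v :=
  (c.inner_of_mem y hy).1

/-- The separating parameter is `sA`. The last part of the western top edge uses parameters before
it; the vertical segment back to `v a` uses parameters from `sA` to `sB` above height `yN` and runs
through the inner region below. -/
theorem rectCurve_west : RectCurve (arcLen a c.m) (closeArc H.v a c.m c.zA) := by
  have l1 := c.lt_m
  have l2 := c.m_lt
  have l3 := c.pB_lt
  have r1 := c.lt_m_real
  have r3 := c.pB_lt_real
  have hq := c.lt_yN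
  have hzA := c.yN_le_zA
  refine closeArc_rectCurve (e := c.sA) H.rectCurve (by omega) (by omega) c.sA_mem.1.le ?_ ?_ ?_ ?_ ?_
  · linarith [c.sA_le, c.sB_mem.2]
  · left
    refine ⟨c.right_m.horizontal, Or.inl ?_, Or.inr ?_, c.left.horizontal⟩
    · rw [Rightward, closeArc_end (by omega), closeArc_last (by omega)]
      exact ⟨c.zA_snd, c.lt_zA⟩
    · rw [Downward, closeArc_last (by omega), show c.m - a + 1 + 1 = c.m - a + 2 by ring,
        closeArc_wrap (by omega)]
      exact ⟨c.zA_fst, by linarith⟩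
  · intro t ht
    right
    have hd : 0 < c.sA - c.m := by linarith [c.sA_mem.1]
    refine ⟨c.m + t * (c.sA - c.m), ⟨?_, ?_⟩, ?_⟩
    · nlinarith [ht.1]
    · nlinarith [ht.2]
    · rw [← lineMap_curve _ (c.mem_zA _ ⟨le_rfl, c.sA_mem.1.le⟩)
        (c.mem_zA _ ⟨c.sA_mem.1.le, le_rfl⟩) ⟨ht.1, ht.2.le⟩, c.curve_sA, curve_int]
  · intro t ht
    have e : (AffineMap.lineMap c.zA (H.v a) t : Plane) = ((H.v a).1, c.zA.2 + t * ((H.v a).2 - c.zA.2)) := by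
      refine Prod.ext ?_ ?_
      · simp only [lineMap_fst, c.zA_fst]; ring
      · simp only [lineMap_snd]
    rw [e]
    set y := c.zA.2 + t * ((H.v a).2 - c.zA.2) with hy
    have hy1 : (H.v a).2 < y := by nlinarith [ht.2]
    have hy2 : y ≤ c.zA.2 := by nlinarith [ht.1]
    rcases lt_or_ge y c.yN with h | h
    · exact Or.inl (c.not_mem_of_mem ⟨hy1, h⟩)
    · obtain ⟨s, hs, h'⟩ := c.mid_zA y ⟨h, hy2⟩
      exact Or.inr ⟨s, ⟨hs.1, by linarith [hs.2, c.sB_mem.2]⟩, h'⟩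
  · left
    intro t ht
    rw [show (AffineMap.lineMap (H.v c.m) c.zA t : Plane) = curve H.v (c.m + t * (c.sA - c.m)) by
      rw [← lineMap_curve _ (c.mem_zA _ ⟨le_rfl, c.sA_mem.1.le⟩)
        (c.mem_zA _ ⟨c.sA_mem.1.le, le_rfl⟩) ⟨ht.1, ht.2.le⟩, c.curve_sA, curve_int]]
    exact curve_mem_trace _ _

theorem lineMap_east {t : ℝ} (ht : t ∈ Icc (0 : ℝ) 1) :
    AffineMap.lineMap c.zB (H.v c.pB) t = curve H.v (c.sB + t * (c.pB - c.sB)) := by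
  rw [← lineMap_curve _ (c.mem_zB _ ⟨le_rfl, c.sB_mem.2.le⟩)
    (c.mem_zB _ ⟨c.sB_mem.2.le, le_rfl⟩) ht, c.curve_sB, curve_int]

/-- The separating parameter is `sB + H.n`. The new upward edge consists of the old notch edge, the
cut through the inner region and possibly a further upward edge, whose parameters lie before `sB`;
this is why `mid_zB` is half-open. The horizontal closing segment uses parameters from `sB` on. -/
theorem rectCurve_east : RectCurve (arcLen c.pB (a - 1 + H.n)) (closeArc H.v c.pB (a - 1 + H.n) c.zB) := by
  have X := H.rectCurve
  have l1 := c.lt_m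
  have l2 := c.m_lt
  have l3 := c.pB_lt
  have l3' := c.pB_lt.le
  have r1 := c.lt_m_real
  have r3 := c.pB_lt_real
  have hq := c.lt_yN
  have hzB := c.yN_le_zB
  have hlow := c.low_lt
  have hper := fun t => X.curve_periodic t 1
  simp only [Int.cast_one, one_mul] at hper
  have r2 : (c.m : ℝ) + 1 ≤ c.pB := by exact_mod_cast l2
  have hsB := c.sB_mem
  have hHp : Horizontal H.v (c.pB - 1) := by
    rcases c.dir_zB with h | h
    · exact h.1.horizontal
    · exact h.1.horizontal
  have hup : Upward H.v (a - 1 + H.n) := by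
    have := (X.dir_periodic (a - 1) 1).2.2.1
    rw [one_mul] at this
    exact this.2 c.up
  refine closeArc_rectCurve (e := c.sB + H.n) X l3 (by omega) ?_ ?_ ?_ ?_ ?_ ?_
  · push_cast; linarith [hsB.1]
  · linarith [hsB.2]
  · right
    refine ⟨hup.vertical, Or.inl ?_, ?_, ?_⟩
    · rw [Upward, closeArc_end l3', closeArc_last l3', H.periodic (a - 1)]
      exact ⟨c.fst_low.trans c.zB_fst.symm, by linarith⟩
    · rw [Horizontal, Rightward, Leftward, closeArc_last l3',
        show a - 1 + (H.n : ℤ) - c.pB + 1 + 1 = a - 1 + H.n - c.pB + 2 by ring, closeArc_wrap l3']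
      rcases c.dir_zB with h | h
      · exact Or.inl ⟨c.zB_snd, h.2⟩
      · exact Or.inr ⟨c.zB_snd, h.2⟩
    · have := X.vertical_succ.2 hHp
      rwa [sub_add_cancel] at this
  · intro t ht
    have e : (AffineMap.lineMap (H.v (a - 1 + H.n)) c.zB t : Plane) =
        ((H.v a).1, (H.v (a - 1)).2 + t * (c.zB.2 - (H.v (a - 1)).2)) := by
      rw [H.periodic (a - 1)]
      refine Prod.ext ?_ ?_
      · simp only [lineMap_fst, c.zB_fst, c.fst_low]; ring
      · simp only [lineMap_snd]
    rw [e]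
    set y := (H.v (a - 1)).2 + t * (c.zB.2 - (H.v (a - 1)).2) with hy
    have hy1 : (H.v (a - 1)).2 ≤ y := by nlinarith [ht.1]
    have hy2 : y < c.zB.2 := by nlinarith [ht.2]
    push_cast
    rcases le_or_gt y (H.v a).2 with h0 | h0
    · right
      obtain ⟨t', ht', h⟩ := exists_param_vertical (v := H.v) (i := a - 1) c.up.1 (y := y) (by
        rw [uIcc_of_le c.up.2.le, sub_add_cancel]; exact ⟨hy1, h0⟩)
      rw [sub_add_cancel] at h
      refine ⟨_, ⟨?_, ?_⟩, (hper _).trans h⟩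
      · push_cast; linarith [ht'.1]
      · push_cast; linarith [ht'.2, hsB.1]
    rcases lt_or_ge y c.yN with h | h
    · exact Or.inl (c.not_mem_of_mem ⟨h0, h⟩)
    · obtain ⟨s, hs, h'⟩ := c.mid_zB y ⟨h, hy2⟩
      refine Or.inr ⟨s + H.n, ⟨?_, by linarith [hs.2]⟩, (hper s).trans h'⟩
      linarith [hs.1, c.sA_mem.1]
  · intro t ht
    right
    have hd : 0 < c.pB - c.sB := by linarith [hsB.2]
    refine ⟨c.sB + t * (c.pB - c.sB) + H.n, ⟨?_, ?_⟩, ?_⟩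
    · nlinarith [ht.1]
    · nlinarith [ht.2]
    · rw [hper, c.lineMap_east ⟨ht.1, ht.2.le⟩]
  · right
    intro t ht
    rw [c.lineMap_east ⟨ht.1, ht.2.le⟩]
    exact curve_mem_trace _ _

theorem mem_trace_west {P : Plane} : P ∈ trace (closeArc H.v a c.m c.zA) ↔
    (∃ s ∈ Icc (a : ℝ) c.sA, curve H.v s = P) ∨ P.1 = (H.v a).1 ∧ P.2 ∈ Icc (H.v a).2 c.zA.2 := by
  rw [mem_trace_closeArc c.rectCurve_west rfl (by linarith [c.lt_m]), c.segment_west,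
    mem_segment_vertical c.zA_fst, c.zA_fst, uIcc_comm, uIcc_of_le (by linarith [c.lt_yN, c.yN_le_zA]),
    ← or_assoc]
  refine or_congr_left ?_
  have h1 := c.lt_m_real
  have h2 := c.sA_mem.1
  constructor
  · rintro (⟨s, hs, h⟩ | ⟨s, hs, h⟩)
    · exact ⟨s, ⟨hs.1, by linarith [hs.2]⟩, h⟩
    · exact ⟨s, ⟨by linarith [hs.1], hs.2⟩, h⟩
  · rintro ⟨s, hs, h⟩
    rcases le_total s c.m with h' | h'
    · exact Or.inl ⟨s, ⟨hs.1, h'⟩, h⟩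
    · exact Or.inr ⟨s, ⟨h', hs.2⟩, h⟩

theorem mem_trace_east {P : Plane} : P ∈ trace (closeArc H.v c.pB (a - 1 + H.n) c.zB) ↔
    (∃ s ∈ Icc c.sB (a + H.n), curve H.v s = P) ∨ P.1 = (H.v a).1 ∧ P.2 ∈ Icc (H.v a).2 c.zB.2 := by
  have hn := c.pB_lt_real
  have hlow := c.low_lt
  have hq := c.lt_yN
  have hzB := c.yN_le_zB
  rw [mem_trace_closeArc c.rectCurve_east rfl c.pB_lt.le, c.segment_east, H.periodic (a - 1),
    mem_segment_vertical (c.fst_low.trans c.zB_fst.symm), c.fst_low, uIcc_of_le (by linarith)]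
  have hper := fun t => H.rectCurve.curve_periodic t 1
  simp only [Int.cast_one, one_mul] at hper
  have hsB := c.sB_mem
  push_cast
  have hedge : ∀ s ∈ Icc (a - 1 + H.n : ℝ) (a + H.n), (curve H.v s).1 = (H.v a).1 ∧
      (curve H.v s).2 ∈ Icc (H.v (a - 1)).2 (H.v a).2 := by
    intro s hs
    have hs' : s - H.n ∈ Icc ((a - 1 : ℤ) : ℝ) ((a - 1 : ℤ) + 1) := by
      push_cast; constructor <;> linarith [hs.1, hs.2]
    have e := hper (s - H.n)
    rw [sub_add_cancel] at e
    have := Hole.snd_curve_mem H.v hs'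
    rw [uIcc_of_le c.up.2.le, sub_add_cancel] at this
    rw [e, RectCurve.fst_curve_of_vertical c.up.vertical hs']
    exact ⟨c.fst_low, this⟩
  constructor
  · rintro (⟨s, hs, h⟩ | ⟨h1, h2⟩ | ⟨s, hs, h⟩)
    · exact Or.inl ⟨s, ⟨by linarith [hs.1, hsB.2], by linarith [hs.2]⟩, h⟩
    · rcases le_total P.2 (H.v a).2 with h | h
      · left
        obtain ⟨t', ht', h'⟩ := exists_param_vertical (v := H.v) (i := a - 1) c.up.1 (y := P.2) (by
          rw [uIcc_of_le c.up.2.le, sub_add_cancel]; exact ⟨h2.1, h⟩)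
        rw [sub_add_cancel, ← h1] at h'
        refine ⟨_, ⟨?_, ?_⟩, (hper _).trans h'⟩
        · push_cast; linarith [ht'.1, hsB.2]
        · push_cast; linarith [ht'.2]
      · exact Or.inr ⟨h1, h, h2.2⟩
    · exact Or.inl ⟨s, ⟨hs.1, by linarith [hs.2]⟩, h⟩
  · rintro (⟨s, hs, h⟩ | ⟨h1, h2⟩)
    · rcases le_total s c.pB with h' | h'
      · exact Or.inr (Or.inr ⟨s, ⟨hs.1, h'⟩, h⟩)
      rcases le_total s (a - 1 + H.n) with h'' | h''
      · exact Or.inl ⟨s, ⟨h', h''⟩, h⟩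
      · obtain ⟨k1, k2⟩ := hedge s ⟨h'', hs.2⟩
        rw [h] at k1 k2
        exact Or.inr (Or.inl ⟨k1, k2.1, by linarith [k2.2]⟩)
    · exact Or.inr (Or.inl ⟨h1, by linarith [h2.1], h2.2⟩)

/-- Vertical segments contribute nothing to the crossing count of the upward ray, and by
`crossing_sum` the edges at the top of the cut contribute the same before and after cutting. The
identity therefore holds at every point, even on the curves. -/
theorem wind_add (P : Plane) : wind (arcLen a c.m) (closeArc H.v a c.m c.zA) P +
    wind (arcLen c.pB (a - 1 + H.n)) (closeArc H.v c.pB (a - 1 + H.n) c.zB) P = H.w P := by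
  have l1 := c.lt_m
  have l2 := c.m_lt
  have l3 := c.pB_lt
  rw [wind_closeArc (by omega), wind_closeArc l3.le, Hole.w, H.rectCurve.wind_eq_sum a,
    ← sum_Ico_append _ (show a ≤ c.m by omega) (show c.m ≤ a + H.n by omega),
    ← sum_Ico_append _ l2.le (show c.pB ≤ a + H.n by omega),
    show a + (H.n : ℤ) = a - 1 + H.n + 1 by ring, sum_Ico_succ_right _ l3.le, c.crossing_sum P,
    crossSeg_vertical (c.zA_fst), crossSeg_vertical (a := H.v (a - 1 + H.n)) (b := c.zB)
      (by rw [H.periodic (a - 1), c.fst_low, c.zB_fst]), crossing_eq, crossSeg_vertical (a := H.v (a - 1 + H.n))]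
  · ring
  · rw [show a - 1 + (H.n : ℤ) + 1 = a + H.n by ring, H.periodic (a - 1), H.periodic, c.fst_low]

end Cut

/-! ### The pieces as holes that partition the given one -/

namespace Cut

variable {H : Hole} {a : ℤ} (c : Cut H a)

theorem not_mem_trace_east {P : Plane} (h : P ∉ H.boundary) (hx : P.1 ≠ (H.v a).1) :
    P ∉ trace (closeArc H.v c.pB (a - 1 + H.n) c.zB) := by
  rw [c.mem_trace_east]
  rintro (⟨s, -, rfl⟩ | ⟨h1, -⟩)
  · exact h (curve_mem_trace _ _)
  · exact hx h1

/-- Both pieces are traversed clockwise. -/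
theorem wind_nonneg :
    (∀ p ∉ trace (closeArc H.v a c.m c.zA), 0 ≤ wind (arcLen a c.m) (closeArc H.v a c.m c.zA) p) ∧
    ∀ p ∉ trace (closeArc H.v c.pB (a - 1 + H.n) c.zB),
      0 ≤ wind (arcLen c.pB (a - 1 + H.n)) (closeArc H.v c.pB (a - 1 + H.n) c.zB) p := by
  obtain ⟨cA, hcA, hvA, -, -⟩ := c.rectCurve_west.jordan
  obtain ⟨cB, hcB, hvB, -, -⟩ := c.rectCurve_east.jordan
  have hm : a ≤ c.m := by linarith [c.lt_m]
  set u := closeArc H.v a c.m c.zA with hu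
  have hq := c.lt_yN
  have hzA := c.yN_le_zA
  -- The midpoint of the open cut. Points slightly to its left and right are inner points of `H`,
  -- are separated by the western curve, and lie off the eastern one.
  set M : Plane := ((H.v a).1, ((H.v a).2 + c.yN) / 2) with hM
  have hMin : M ∈ H.inner := c.inner_of_mem _ ⟨by linarith, by linarith⟩
  have e1 : u (c.m - a + 1) = c.zA := closeArc_last hm
  have e2 : u (c.m - a + 1 + 1) = H.v a := by
    rw [show c.m - a + 1 + 1 = c.m - a + 2 by ring]; exact closeArc_wrap hm
  obtain ⟨t, ht, htM⟩ := exists_param_vertical (v := u) (i := c.m - a + 1)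
    (by rw [e1, e2, c.zA_fst]) (y := ((H.v a).2 + c.yN) / 2) (by
      rw [e1, e2, uIcc_comm, uIcc_of_le (by linarith)]; constructor <;> linarith)
  rw [e2] at htM
  have ht0 : t ≠ 0 := by
    rintro rfl
    rw [add_zero, curve_int, e1] at htM
    have := congrArg Prod.snd htM
    simp only at this
    linarith
  have ht1 : t ≠ 1 := by
    rintro rfl
    rw [show ((c.m - a + 1 : ℤ) : ℝ) + 1 = ((c.m - a + 1 + 1 : ℤ) : ℝ) by push_cast; ring, curve_int,
      e2] at htM
    have := congrArg Prod.snd htM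
    simp only at this
    linarith
  have X : RectCurve (arcLen a c.m) u := c.rectCurve_west
  obtain ⟨r, hr, hj⟩ := X.jump (i := c.m - a + 1) (s := (c.m - a + 1 : ℤ) + t)
    ⟨by linarith [lt_of_le_of_ne ht.1 (Ne.symm ht0)], by linarith [lt_of_le_of_ne ht.2 ht1]⟩
  rw [htM, ← hM] at hj
  set d := rightNormal (u (c.m - a + 1 + 1) - u (c.m - a + 1)) with hd
  have hd1 : d.1 = (H.v a).2 - c.zA.2 := by rw [hd, e1, e2, rightNormal]; rfl
  have key : ∀ᶠ ε in 𝓝[>] (0 : ℝ), M + ε • d ∈ H.inner ∧ M - ε • d ∈ H.inner := by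
    refine Filter.Eventually.filter_mono nhdsWithin_le_nhds (Filter.Eventually.and ?_ ?_)
    · have : ContinuousAt (fun ε : ℝ => M + ε • d) 0 := by fun_prop
      exact this.eventually_mem (H.isOpen_inner.mem_nhds (by simpa using hMin))
    · have : ContinuousAt (fun ε : ℝ => M - ε • d) 0 := by fun_prop
      exact this.eventually_mem (H.isOpen_inner.mem_nhds (by simpa using hMin))
  have hIoo : ∀ᶠ ε in 𝓝[>] (0 : ℝ), ε ∈ Ioo 0 r := Ioo_mem_nhdsGT hr
  obtain ⟨ε, ⟨hin1, hin2⟩, hε⟩ := (key.and hIoo).exists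
  obtain ⟨j1, j2, j3⟩ := hj ε hε
  have hne : ε * d.1 ≠ 0 := by
    rw [hd1]; exact mul_ne_zero hε.1.ne' (by linarith)
  have o1 := c.not_mem_trace_east hin1.1 (by
    change M.1 + ε * d.1 ≠ _
    intro h; exact hne (by simp only [hM] at h; linarith))
  have o2 := c.not_mem_trace_east hin2.1 (by
    change M.1 - ε * d.1 ≠ _
    intro h; exact hne (by simp only [hM] at h; linarith))
  have s1 := c.wind_add (M + ε • d)
  have s2 := c.wind_add (M - ε • d)
  rw [(H.mem_inner.1 hin1).2] at s1
  rw [(H.mem_inner.1 hin2).2] at s2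
  have v1 := hvA _ j1
  have v2 := hvA _ j2
  have v3 := hvB _ o1
  have v4 := hvB _ o2
  rw [← hu] at s1 s2
  -- At the two points the western values are `cA + 1` and `cA`, and the total is 1, so the eastern
  -- values are `-cA` and `1 - cA`. Hence `cB = -cA`, and since both are 0 or -1, both vanish.
  have : cA = 0 ∧ cB = 0 := by omega
  obtain ⟨rfl, rfl⟩ := this
  exact ⟨fun p hp => by have := hvA p hp; omega, fun p hp => by have := hvB p hp; omega⟩

/-- The piece to the west of the cut. -/
def west : Hole where
  n := arcLen a c.m
  v := closeArc H.v a c.m c.zA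
  n_pos := c.rectCurve_west.n_pos
  periodic := c.rectCurve_west.periodic
  alternating := c.rectCurve_west.alternating
  simple := c.rectCurve_west.simple
  clockwise := c.rectCurve_west.clockwise_of_nonneg c.wind_nonneg.1

/-- The piece to the east of the cut. -/
def east : Hole where
  n := arcLen c.pB (a - 1 + H.n)
  v := closeArc H.v c.pB (a - 1 + H.n) c.zB
  n_pos := c.rectCurve_east.n_pos
  periodic := c.rectCurve_east.periodic
  alternating := c.rectCurve_east.alternating
  simple := c.rectCurve_east.simple
  clockwise := c.rectCurve_east.clockwise_of_nonneg c.wind_nonneg.2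

theorem west_n : (c.west.n : ℤ) = c.m - a + 2 := arcLen_cast (by linarith [c.lt_m])

theorem east_n : (c.east.n : ℤ) = a - 1 + H.n - c.pB + 2 := arcLen_cast c.pB_lt.le

/-- The pieces have `H.n + 3 - (pB - m)` vertices together, and `m < pB`. -/
theorem n_add_n_le : c.west.n + c.east.n ≤ H.n + 2 := by
  have h1 := c.west_n
  have h2 := c.east_n
  have := c.m_lt
  omega

theorem w_add (P : Plane) : c.west.w P + c.east.w P = H.w P := c.wind_add P

theorem mem_boundary_west {P : Plane} : P ∈ c.west.boundary ↔
    (∃ s ∈ Icc (a : ℝ) c.sA, curve H.v s = P) ∨ P.1 = (H.v a).1 ∧ P.2 ∈ Icc (H.v a).2 c.zA.2 :=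
  c.mem_trace_west

theorem mem_boundary_east {P : Plane} : P ∈ c.east.boundary ↔
    (∃ s ∈ Icc c.sB (a + H.n), curve H.v s = P) ∨ P.1 = (H.v a).1 ∧ P.2 ∈ Icc (H.v a).2 c.zB.2 :=
  c.mem_trace_east

/-- The segment along which the hole is cut. -/
def slit : Set Plane := segment ℝ (H.v a) ((H.v a).1, c.yN)

theorem mem_slit {P : Plane} : P ∈ c.slit ↔ P.1 = (H.v a).1 ∧ P.2 ∈ Icc (H.v a).2 c.yN := by
  rw [slit, mem_segment_vertical (a := H.v a) (b := ((H.v a).1, c.yN)) rfl, uIcc_of_le c.lt_yN.le]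

theorem boundary_subset : H.boundary ⊆ c.west.boundary ∪ c.east.boundary := by
  intro P hP
  rw [Hole.boundary, H.rectCurve.trace_eq_image a] at hP
  obtain ⟨s, hs, rfl⟩ := hP
  rcases le_total s c.sA with h | h
  · exact Or.inl (c.mem_boundary_west.2 (Or.inl ⟨s, ⟨hs.1, h⟩, rfl⟩))
  rcases le_total s c.sB with h' | h'
  · obtain ⟨h1, h2, h3 | h3⟩ := c.mid s ⟨h, h'⟩
    · exact Or.inl (c.mem_boundary_west.2 (Or.inr ⟨h1, by linarith [c.lt_yN], h3⟩))
    · exact Or.inr (c.mem_boundary_east.2 (Or.inr ⟨h1, by linarith [c.lt_yN], h3⟩))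
  · exact Or.inr (c.mem_boundary_east.2 (Or.inl ⟨s, ⟨h', hs.2.le⟩, rfl⟩))

theorem mem_boundary_of_mid {P : Plane} (h1 : P.1 = (H.v a).1) (h2 : c.yN ≤ P.2)
    (h3 : P.2 ≤ c.zA.2 ∨ P.2 ≤ c.zB.2) : ∃ s ∈ Icc c.sA c.sB, curve H.v s = P := by
  have hP : P = ((H.v a).1, P.2) := by rw [← h1]
  rcases h3 with h3 | h3
  · rw [hP]; exact c.mid_zA P.2 ⟨h2, h3⟩
  · rcases h3.lt_or_eq with h4 | h4
    · obtain ⟨s, hs, h⟩ := c.mid_zB P.2 ⟨h2, h4⟩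
      exact ⟨s, ⟨hs.1, hs.2.le⟩, h.trans hP.symm⟩
    · exact ⟨c.sB, ⟨c.sA_le, le_rfl⟩, by rw [c.curve_sB, hP, ← c.zB_fst, h4]⟩

theorem boundary_west_subset : c.west.boundary ⊆ H.boundary ∪ c.slit := by
  intro P hP
  rcases c.mem_boundary_west.1 hP with ⟨s, -, rfl⟩ | ⟨h1, h2⟩
  · exact Or.inl (curve_mem_trace _ _)
  · rcases le_total P.2 c.yN with h | h
    · exact Or.inr (c.mem_slit.2 ⟨h1, h2.1, h⟩)
    · obtain ⟨s, -, rfl⟩ := c.mem_boundary_of_mid h1 h (Or.inl h2.2)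
      exact Or.inl (curve_mem_trace _ _)

theorem boundary_east_subset : c.east.boundary ⊆ H.boundary ∪ c.slit := by
  intro P hP
  rcases c.mem_boundary_east.1 hP with ⟨s, -, rfl⟩ | ⟨h1, h2⟩
  · exact Or.inl (curve_mem_trace _ _)
  · rcases le_total P.2 c.yN with h | h
    · exact Or.inr (c.mem_slit.2 ⟨h1, h2.1, h⟩)
    · obtain ⟨s, -, rfl⟩ := c.mem_boundary_of_mid h1 h (Or.inr h2.2)
      exact Or.inl (curve_mem_trace _ _)

theorem slit_subset_west : c.slit ⊆ c.west.boundary := fun _ hP =>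
  have h := c.mem_slit.1 hP
  c.mem_boundary_west.2 (Or.inr ⟨h.1, h.2.1, h.2.2.trans c.yN_le_zA⟩)

theorem slit_subset_east : c.slit ⊆ c.east.boundary := fun _ hP =>
  have h := c.mem_slit.1 hP
  c.mem_boundary_east.2 (Or.inr ⟨h.1, h.2.1, h.2.2.trans c.yN_le_zB⟩)

theorem w_le_one {P : Plane} (h : P ∉ c.west.boundary) (h' : P ∉ c.east.boundary) :
    c.west.w P + c.east.w P ≤ 1 := by
  rw [c.w_add]
  have := H.w_facts.1 P fun hP => by
    rcases c.boundary_subset hP with h1 | h1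
    · exact h h1
    · exact h' h1
  omega

/-- Every neighbourhood of an eastern boundary point contains a point of eastern winding number 1.
Inside the open western region both winding numbers would be 1 there, although their sum is at most
1. -/
theorem disjoint_inner_west_boundary : Disjoint c.west.inner c.east.boundary := by
  rw [Set.disjoint_left]
  intro P hP hPB
  obtain ⟨⟨q, hq, hq1, hq2⟩, -⟩ := c.east.w_facts.2.2 P hPB _ (c.west.isOpen_inner.mem_nhds hP)
  have := c.w_le_one hq.1 hq1
  have := (c.west.mem_inner.1 hq).2
  omega

theorem disjoint_inner_east_boundary : Disjoint c.east.inner c.west.boundary := by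
  rw [Set.disjoint_left]
  intro P hP hPB
  obtain ⟨⟨q, hq, hq1, hq2⟩, -⟩ := c.west.w_facts.2.2 P hPB _ (c.east.isOpen_inner.mem_nhds hP)
  have := c.w_le_one hq1 hq.1
  have := (c.east.mem_inner.1 hq).2
  omega

theorem disjoint_inner : Disjoint c.west.inner c.east.inner := by
  rw [Set.disjoint_left]
  intro P hP hP'
  have := c.w_le_one hP.1 hP'.1
  have := (c.west.mem_inner.1 hP).2
  have := (c.east.mem_inner.1 hP').2
  omega

/-- Off both boundaries the two winding numbers are 0 or 1 and add up to that of the hole, so an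
inner point of the hole is inner to exactly one piece. -/
theorem inner_diff_slit : H.inner \ c.slit = c.west.inner ∪ c.east.inner := by
  ext P
  constructor
  · rintro ⟨h1, h2⟩
    have hA : P ∉ c.west.boundary := fun h => (c.boundary_west_subset h).elim h1.1 h2
    have hB : P ∉ c.east.boundary := fun h => (c.boundary_east_subset h).elim h1.1 h2
    have := c.w_add P
    rw [(H.mem_inner.1 h1).2] at this
    have k1 := c.west.w_facts.1 P hA
    have k2 := c.east.w_facts.1 P hB
    rcases k1 with k1 | k1
    · exact Or.inr (c.east.mem_inner.2 ⟨hB, by omega⟩)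
    · exact Or.inl (c.west.mem_inner.2 ⟨hA, k1⟩)
  · intro h
    have hoff : P ∉ c.west.boundary ∧ P ∉ c.east.boundary := by
      rcases h with h | h
      · exact ⟨h.1, Set.disjoint_left.1 c.disjoint_inner_west_boundary h⟩
      · exact ⟨Set.disjoint_left.1 c.disjoint_inner_east_boundary h, h.1⟩
    have hP : P ∉ H.boundary := fun h' => (c.boundary_subset h').elim hoff.1 hoff.2
    refine ⟨H.mem_inner.2 ⟨hP, ?_⟩, fun h' => hoff.1 (c.slit_subset_west h')⟩
    have k0 := H.w_facts.1 P hP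
    have k1 := c.west.w_facts.1 P hoff.1
    have k2 := c.east.w_facts.1 P hoff.2
    have := c.w_add P
    rcases h with h | h
    · have := (c.west.mem_inner.1 h).2
      omega
    · have := (c.east.mem_inner.1 h).2
      omega

theorem slit_subset_carrier : c.slit ⊆ H.carrier := by
  intro P hP
  obtain ⟨h1, h2⟩ := c.mem_slit.1 hP
  have hPe : P = ((H.v a).1, P.2) := by rw [← h1]
  rcases h2.1.lt_or_eq with h | h
  · rcases h2.2.lt_or_eq with h' | h'
    · right; rw [hPe]; exact c.inner_of_mem _ ⟨h, h'⟩
    · left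
      obtain ⟨s, -, rfl⟩ := c.mem_boundary_of_mid h1 h'.ge (Or.inl (h'.le.trans c.yN_le_zA))
      exact curve_mem_trace _ _
  · left
    rw [hPe, ← h]
    exact H.vertex_mem_boundary a

theorem carrier_union : c.west.carrier ∪ c.east.carrier = H.carrier := by
  have h := c.inner_diff_slit
  apply Subset.antisymm
  · have hin : c.west.inner ∪ c.east.inner ⊆ H.carrier := by
      rw [← h]; exact fun P hP => Or.inr hP.1
    have hb : H.boundary ∪ c.slit ⊆ H.carrier :=
      union_subset subset_union_left c.slit_subset_carrier
    exact union_subset (union_subset (c.boundary_west_subset.trans hb) (subset_union_left.trans hin))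
      (union_subset (c.boundary_east_subset.trans hb) (subset_union_right.trans hin))
  · rintro P (hP | hP)
    · exact (c.boundary_subset hP).imp (fun h => Or.inl h) fun h => Or.inl h
    · by_cases hs : P ∈ c.slit
      · exact Or.inl (Or.inl (c.slit_subset_west hs))
      · have : P ∈ c.west.inner ∪ c.east.inner := h ▸ ⟨hP, hs⟩
        exact this.imp (fun h => Or.inr h) fun h => Or.inr h

/-- On the vertical line through the cut, points strictly below `yN` are inner points, points from
`yN` upwards already have a parameter in `[sA, sB]`, and `v a` has the parameter `a`. Injectivity
leaves no other parameter. -/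
theorem curve_not_mem_of_slit {s : ℝ} (hs : s ∈ Ioo (a : ℝ) (a + H.n)) (hs' : s ∉ Icc c.sA c.sB)
    (h1 : (curve H.v s).1 = (H.v a).1) (h2 : (H.v a).2 ≤ (curve H.v s).2)
    (h3 : (curve H.v s).2 ≤ c.zA.2 ∨ (curve H.v s).2 ≤ c.zB.2) : False := by
  have X := H.rectCurve
  have hA := c.sA_mem
  have hB := c.sB_mem
  have := c.lt_m_real
  have := c.pB_lt_real
  have hP : curve H.v s = ((H.v a).1, (curve H.v s).2) := by rw [← h1]
  rcases h2.lt_or_eq with h | h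
  · rcases lt_or_ge (curve H.v s).2 c.yN with h' | h'
    · have := c.not_mem_of_mem ⟨h, h'⟩
      rw [← hP] at this
      exact this (curve_mem_trace _ _)
    · obtain ⟨t, ht, he⟩ := c.mem_boundary_of_mid h1 h' h3
      have := X.eq_of_curve_eq he (a := a) ⟨by linarith [ht.1, hA.1], by linarith [ht.2, hB.2]⟩
        ⟨hs.1.le, hs.2⟩
      exact hs' (this ▸ ht)
  · rw [← h, ← Prod.mk.eta (p := H.v a)] at hP
    have hP' : curve H.v s = curve H.v a := by rw [curve_int]; exact hP
    have := X.eq_of_curve_eq hP' (a := a) ⟨hs.1.le, hs.2⟩ ⟨le_rfl, by linarith [hs.1, hs.2]⟩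
    linarith [hs.1]

theorem curve_not_mem_east {s : ℝ} (hs : s ∈ Ioo (a : ℝ) c.sA) : curve H.v s ∉ c.east.boundary := by
  have hA := c.sA_mem
  have hB := c.sB_mem
  have hAB := c.sA_le
  have := c.lt_m_real
  have := c.pB_lt_real
  have X := H.rectCurve
  intro h
  have hs' : s ∈ Ioo (a : ℝ) (a + H.n) := ⟨hs.1, by linarith [hs.2, hB.2]⟩
  rcases c.mem_boundary_east.1 h with ⟨t, ht, he⟩ | ⟨h1, h2⟩
  · rcases ht.2.lt_or_eq with h' | h'
    · have := X.eq_of_curve_eq he (a := a) ⟨by linarith [ht.1, hA.1], h'⟩ ⟨hs'.1.le, hs'.2⟩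
      linarith [hs.2, ht.1]
    · have hp := X.curve_periodic a 1
      rw [Int.cast_one, one_mul, ← h', he] at hp
      have := X.eq_of_curve_eq hp (a := a) ⟨hs'.1.le, hs'.2⟩ ⟨le_rfl, by linarith [hs'.1, hs'.2]⟩
      linarith [hs.1]
  · exact c.curve_not_mem_of_slit hs' (fun h' => by linarith [h'.1, hs.2]) h1 h2.1 (Or.inr h2.2)

theorem curve_not_mem_west {s : ℝ} (hs : s ∈ Ioo c.sB (a + H.n)) : curve H.v s ∉ c.west.boundary := by
  have hA := c.sA_mem
  have hB := c.sB_mem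
  have hAB := c.sA_le
  have := c.lt_m_real
  have := c.pB_lt_real
  have X := H.rectCurve
  intro h
  have hs' : s ∈ Ioo (a : ℝ) (a + H.n) := ⟨by linarith [hs.1, hA.1], hs.2⟩
  rcases c.mem_boundary_west.1 h with ⟨t, ht, he⟩ | ⟨h1, h2⟩
  · have := X.eq_of_curve_eq he (a := a) ⟨ht.1, by linarith [ht.2, hB.2]⟩ ⟨hs'.1.le, hs'.2⟩
    linarith [hs.1, ht.2]
  · exact c.curve_not_mem_of_slit hs' (fun h' => by linarith [h'.2, hs.1]) h1 h2.1 (Or.inl h2.2)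

end Cut

/-! ### Edge directions and edge types of the pieces -/

/-- The edges `j` of `u` and `i` of `v` have the same direction. -/
def SameDir (u : ℤ → Plane) (j : ℤ) (v : ℤ → Plane) (i : ℤ) : Prop :=
  (Rightward u j ↔ Rightward v i) ∧ (Leftward u j ↔ Leftward v i) ∧ (Upward u j ↔ Upward v i) ∧
    (Downward u j ↔ Downward v i)

section

variable {u v : ℤ → Plane} {i j : ℤ}

theorem SameDir.of_eq (h1 : u j = v i) (h2 : u (j + 1) = v (i + 1)) : SameDir u j v i := by
  simp only [SameDir, Rightward, Leftward, Upward, Downward, h1, h2, and_self]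

theorem Rightward.sameDir (h : Rightward u j) (h' : Rightward v i) : SameDir u j v i := by
  have h1 := h.1
  have h2 := h'.1
  have h3 := h.2
  have h4 := h'.2
  simp only [SameDir, Rightward, Leftward, Upward, Downward, h1, h2, h3, h4, h3.le.not_gt, h4.le.not_gt,
    lt_irrefl, and_false, and_self]

theorem Leftward.sameDir (h : Leftward u j) (h' : Leftward v i) : SameDir u j v i := by
  have h1 := h.1
  have h2 := h'.1
  have h3 := h.2
  have h4 := h'.2
  simp only [SameDir, Rightward, Leftward, Upward, Downward, h1, h2, h3, h4, h3.le.not_gt, h4.le.not_gt,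
    lt_irrefl, and_false, and_self]

theorem Upward.sameDir (h : Upward u j) (h' : Upward v i) : SameDir u j v i := by
  have h1 := h.1
  have h2 := h'.1
  have h3 := h.2
  have h4 := h'.2
  simp only [SameDir, Rightward, Leftward, Upward, Downward, h1, h2, h3, h4, h3.le.not_gt, h4.le.not_gt,
    lt_irrefl, and_false, and_self]

theorem SameDir.types (h0 : SameDir u (j - 1) v (i - 1)) (h1 : SameDir u j v i)
    (h2 : SameDir u (j + 1) v (i + 1)) : (LM u j ↔ LM v i) ∧ (RM u j ↔ RM v i) ∧
      (LN u j ↔ LN v i) ∧ (RN u j ↔ RN v i) := by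
  simp only [LM, RM, LN, RN, h0.1, h0.2.1, h1.2.2.1, h1.2.2.2, h2.1, h2.2.1, and_self]

end

/-- The conditions on the turns of a BLS-hole have to be checked in one period only. -/
theorem Hole.isBLS_of_period (H : Hole) (b : ℤ) (h1 : ∀ i ∈ Ico b (b + H.n), ¬ RN H.v i)
    (h2 : ∀ i ∈ Ico b (b + H.n), ¬ H.IsTopNotch i)
    (h3 : ∀ i ∈ Ico b (b + H.n), ∀ j ∈ Ico b (b + H.n), H.IsFallingCorner i → H.IsFallingCorner j →
      H.v i = H.v j) : H.IsBLS := by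
  have X := H.rectCurve
  have hper : ∀ i k : ℤ, (H.IsTopNotch (i + k * H.n) ↔ H.IsTopNotch i) ∧
      (H.IsFallingCorner (i + k * H.n) ↔ H.IsFallingCorner i) := by
    intro i k
    have e0 := X.dir_periodic i k
    have e1 := X.dir_periodic (i + 1) k
    have e2 := X.dir_periodic (i - 1) k
    simp only [IsTopNotch, IsFallingCorner, show i + k * (H.n : ℤ) + 1 = i + 1 + k * H.n by ring,
      show i + k * (H.n : ℤ) - 1 = i - 1 + k * H.n by ring, e0, e1, e2, and_self]
  refine ⟨fun i hi => ?_, fun i hi => ?_, fun i j hi hj => ?_⟩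
  · obtain ⟨k, hk⟩ := RectCurve.exists_int_mem_Ico X.n_pos b i
    exact h1 _ hk ((X.types_periodic i k).2.2.2.2 hi)
  · obtain ⟨k, hk⟩ := RectCurve.exists_int_mem_Ico X.n_pos b i
    exact h2 _ hk ((hper i k).1.2 hi)
  · obtain ⟨k, hk⟩ := RectCurve.exists_int_mem_Ico X.n_pos b i
    obtain ⟨l, hl⟩ := RectCurve.exists_int_mem_Ico X.n_pos b j
    have := h3 _ hk _ hl ((hper i k).2.2 hi) ((hper j l).2.2 hj)
    rwa [X.periodic_int, X.periodic_int] at this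

namespace Cut

variable {H : Hole} {a : ℤ} (c : Cut H a)

theorem west_v {j : ℤ} (h0 : 0 ≤ j) (h1 : j ≤ c.m - a) : c.west.v j = H.v (a + j) := closeArc_arc h0 h1

theorem west_v_last : c.west.v (c.m - a + 1) = c.zA := closeArc_last (by linarith [c.lt_m])

theorem west_v_neg_one : c.west.v (-1) = c.zA := closeArc_neg_one (by linarith [c.lt_m])

theorem west_v_zero : c.west.v 0 = H.v a := by
  rw [c.west_v le_rfl (by linarith [c.lt_m]), add_zero]

theorem east_v {j : ℤ} (h0 : 0 ≤ j) (h1 : j ≤ a - 1 + H.n - c.pB) : c.east.v j = H.v (c.pB + j) :=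
  closeArc_arc h0 h1

theorem east_v_last : c.east.v (a - 1 + H.n - c.pB + 1) = c.zB := closeArc_last c.pB_lt.le

theorem east_v_neg_one : c.east.v (-1) = c.zB := closeArc_neg_one c.pB_lt.le

theorem west_sameDir {j : ℤ} (h0 : 0 ≤ j) (h1 : j ≤ c.m - a) : SameDir c.west.v j H.v (a + j) := by
  rcases h1.lt_or_eq with h | rfl
  · exact .of_eq (c.west_v h0 h1) (by rw [c.west_v (by omega) (by omega), add_assoc])
  · rw [show a + (c.m - a) = c.m by ring]
    refine Rightward.sameDir ?_ c.right_m
    rw [Rightward, c.west_v h0 le_rfl, c.west_v_last, show a + (c.m - a) = c.m by ring]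
    exact ⟨c.zA_snd, c.lt_zA⟩

theorem west_neg_one : Downward c.west.v (-1) := by
  rw [Downward, c.west_v_neg_one, show (-1 : ℤ) + 1 = 0 by ring, c.west_v_zero]
  exact ⟨c.zA_fst, by linarith [c.lt_yN, c.yN_le_zA]⟩

theorem west_zero : Leftward c.west.v 0 := by
  have := c.west_sameDir le_rfl (by linarith [c.lt_m])
  rw [add_zero] at this
  exact this.2.1.2 c.left

theorem west_last : Rightward c.west.v (c.m - a) := by
  have := c.west_sameDir (j := c.m - a) (by linarith [c.lt_m]) le_rfl
  rw [show a + (c.m - a) = c.m by ring] at this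
  exact this.1.2 c.right_m

include c in
theorem up_wrap : Upward H.v (a - 1 + H.n) := by
  have := (H.rectCurve.dir_periodic (a - 1) 1).2.2.1
  rw [one_mul] at this
  exact this.2 c.up

include c in
theorem right_wrap : Rightward H.v (a - 2 + H.n) := by
  have := (H.rectCurve.dir_periodic (a - 2) 1).1
  rw [one_mul] at this
  exact this.2 c.right

/-- Besides the common edges this covers the two modified ones: index `-1` is the rest of the edge
`pB - 1`, and the last index is the notch edge prolonged upward to `zB`. Shortening or prolonging
keeps the direction. -/
theorem east_sameDir {j : ℤ} (h0 : -1 ≤ j) (h1 : j ≤ a - 1 + H.n - c.pB) :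
    SameDir c.east.v j H.v (c.pB + j) := by
  have h := c.pB_lt
  rcases h0.lt_or_eq with h0 | rfl
  · rcases h1.lt_or_eq with h1' | rfl
    · exact .of_eq (c.east_v (by omega) h1) (by rw [c.east_v (by omega) (by omega), add_assoc])
    · rw [show c.pB + (a - 1 + H.n - c.pB) = a - 1 + H.n by ring]
      refine Upward.sameDir ?_ c.up_wrap
      rw [Upward, c.east_v (by omega) le_rfl, c.east_v_last,
        show c.pB + (a - 1 + H.n - c.pB) = a - 1 + H.n by ring, H.periodic]
      exact ⟨c.fst_low.trans c.zB_fst.symm, by linarith [c.low_lt, c.lt_yN, c.yN_le_zB]⟩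
  · have e0 : c.east.v (-1 + 1) = H.v c.pB := by
      rw [show (-1 : ℤ) + 1 = 0 by ring, c.east_v le_rfl (by omega), add_zero]
    rw [← sub_eq_add_neg]
    rcases c.dir_zB with h | h
    · refine Rightward.sameDir ?_ h.1
      rw [Rightward, c.east_v_neg_one, e0]
      exact ⟨c.zB_snd, h.2⟩
    · refine Leftward.sameDir ?_ h.1
      rw [Leftward, c.east_v_neg_one, e0]
      exact ⟨c.zB_snd, h.2⟩

theorem west_cases {i : ℤ} (hi : i ∈ Ico (-1 : ℤ) (-1 + c.west.n)) :
    i = -1 ∨ i = 0 ∨ i = c.m - a ∨ i ∈ Ioo 0 (c.m - a) := by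
  have h1 := hi.1
  have h2 := hi.2
  rw [c.west_n] at h2
  simp only [mem_Ioo]
  omega

theorem west_types {i : ℤ} (hi : i ∈ Ioo 0 (c.m - a)) :
    (LM c.west.v i ↔ LM H.v (a + i)) ∧ (RM c.west.v i ↔ RM H.v (a + i)) ∧
      (LN c.west.v i ↔ LN H.v (a + i)) ∧ (RN c.west.v i ↔ RN H.v (a + i)) := by
  have h1 := hi.1
  have h2 := hi.2
  refine SameDir.types ?_ (c.west_sameDir h1.le h2.le) ?_
  · rw [show a + i - 1 = a + (i - 1) by ring]; exact c.west_sameDir (by omega) (by omega)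
  · rw [add_assoc]; exact c.west_sameDir (by omega) (by omega)

theorem west_types_end {i : ℤ} (hi : i = -1 ∨ i = 0 ∨ i = c.m - a) :
    ¬ LM c.west.v i ∧ ¬ LN c.west.v i ∧ ¬ RN c.west.v i := by
  rcases hi with rfl | rfl | rfl
  · refine ⟨fun h => c.west_neg_one.not_upward h.2.1, fun h => c.west_neg_one.not_upward h.2.1,
      fun h => ?_⟩
    exact c.west_zero.not_rightward h.2.2
  · exact ⟨fun h => h.2.1.vertical.not_horizontal c.west_zero.horizontal,
      fun h => h.2.1.vertical.not_horizontal c.west_zero.horizontal,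
      fun h => h.2.1.vertical.not_horizontal c.west_zero.horizontal⟩
  · exact ⟨fun h => h.2.1.vertical.not_horizontal c.west_last.horizontal,
      fun h => h.2.1.vertical.not_horizontal c.west_last.horizontal,
      fun h => h.2.1.vertical.not_horizontal c.west_last.horizontal⟩

theorem west_RM : RM c.west.v (-1) := by
  refine ⟨?_, c.west_neg_one, c.west_zero⟩
  have := (c.west.rectCurve.dir_periodic (-2) 1).1
  rw [c.west_n, show (-2 : ℤ) + 1 * (c.m - a + 2) = c.m - a by ring] at this
  exact this.1 c.west_last

theorem east_cases {i : ℤ} (hi : i ∈ Ico (-1 : ℤ) (-1 + c.east.n)) :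
    i = -1 ∨ i = a - 1 + H.n - c.pB ∨ i ∈ Ico 0 (a - 1 + H.n - c.pB) := by
  have h1 := hi.1
  have h2 := hi.2
  rw [c.east_n] at h2
  simp only [mem_Ico]
  omega

theorem east_types {i : ℤ} (hi : i ∈ Ico 0 (a - 1 + H.n - c.pB)) :
    (LM c.east.v i ↔ LM H.v (c.pB + i)) ∧ (RM c.east.v i ↔ RM H.v (c.pB + i)) ∧
      (LN c.east.v i ↔ LN H.v (c.pB + i)) ∧ (RN c.east.v i ↔ RN H.v (c.pB + i)) := by
  have h1 := hi.1
  have h2 := hi.2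
  refine SameDir.types ?_ (c.east_sameDir (by omega) h2.le) ?_
  · rw [show c.pB + i - 1 = c.pB + (i - 1) by ring]; exact c.east_sameDir (by omega) (by omega)
  · rw [add_assoc]; exact c.east_sameDir (by omega) (by omega)

theorem east_horizontal : Horizontal c.east.v (-1) := by
  have h := c.east_sameDir (j := -1) le_rfl (by linarith [c.pB_lt])
  rw [← sub_eq_add_neg] at h
  rw [Horizontal, h.1, h.2.1]
  rcases c.dir_zB with h | h
  · exact Or.inl h.1
  · exact Or.inr h.1

theorem east_up : Upward c.east.v (a - 1 + H.n - c.pB) := by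
  have := c.east_sameDir (j := a - 1 + H.n - c.pB) (by linarith [c.pB_lt]) le_rfl
  rw [show c.pB + (a - 1 + H.n - c.pB) = a - 1 + H.n by ring] at this
  exact this.2.2.1.2 c.up_wrap

/-- The prolonged upward edge still comes after a rightward edge. Whether it is a left notch depends
only on the direction of the edge `pB - 1`. -/
theorem east_types_end {i : ℤ} (hi : i = -1 ∨ i = a - 1 + H.n - c.pB) :
    ¬ LM c.east.v i ∧ (Rightward H.v (c.pB - 1) → ¬ LN c.east.v i) ∧ ¬ RN c.east.v i := by
  have hp := c.pB_lt
  rcases hi with rfl | rfl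
  · exact ⟨fun h => h.2.1.vertical.not_horizontal c.east_horizontal,
      fun _ h => h.2.1.vertical.not_horizontal c.east_horizontal,
      fun h => h.2.1.vertical.not_horizontal c.east_horizontal⟩
  · refine ⟨fun h => ?_, fun h h' => ?_, fun h => c.east_up.not_downward h.2.1⟩
    · have := c.east_sameDir (j := a - 1 + H.n - c.pB - 1) (by omega) (by omega)
      rw [show c.pB + (a - 1 + H.n - c.pB - 1) = a - 2 + H.n by ring] at this
      exact h.1.not_rightward (this.1.2 c.right_wrap)
    · have h1 := c.east_sameDir (j := -1) le_rfl (by omega)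
      rw [← sub_eq_add_neg] at h1
      have h2 := (c.east.rectCurve.dir_periodic (-1) 1).1
      rw [c.east_n, show (-1 : ℤ) + 1 * (a - 1 + H.n - c.pB + 2) = a - 1 + H.n - c.pB + 1 by ring] at h2
      exact h'.2.2.not_rightward (h2.2 (h1.1.2 h))

/-- At both ends of the new downward edge the boundary turns right, at `zA` from a rightward edge
and at `v a` into a leftward one. So no falling corner arises there; all others are falling corners
of `H` at the same points. -/
theorem west_isBLS (hH : H.IsBLS) : c.west.IsBLS := by
  have key : ∀ i ∈ Ico (-1 : ℤ) (-1 + c.west.n), c.west.IsFallingCorner i →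
      0 ≤ i ∧ i ≤ c.m - a ∧ H.IsFallingCorner (a + i) := by
    intro i hi h
    rcases c.west_cases hi with rfl | rfl | hi
    · exact absurd c.west_neg_one.vertical h.2.horizontal.not_vertical
    · exact absurd h.2 c.west_zero.not_rightward
    · have h1 : 0 < i ∧ i ≤ c.m - a := by
        rcases hi with rfl | hi
        · exact ⟨by linarith [c.lt_m], le_rfl⟩
        · exact ⟨hi.1, hi.2.le⟩
      refine ⟨h1.1.le, h1.2, ?_, (c.west_sameDir h1.1.le h1.2).1.1 h.2⟩
      have := (c.west_sameDir (j := i - 1) (by omega) (by omega)).2.2.2.1 h.1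
      rwa [← add_sub_assoc] at this
  refine c.west.isBLS_of_period (-1) (fun i hi => ?_) (fun i hi h => ?_) fun i hi j hj h h' => ?_
  · rcases c.west_cases hi with h | h | h | h
    · exact (c.west_types_end (Or.inl h)).2.2
    · exact (c.west_types_end (Or.inr (Or.inl h))).2.2
    · exact (c.west_types_end (Or.inr (Or.inr h))).2.2
    · rw [(c.west_types h).2.2.2]; exact hH.1 _
  · obtain ⟨h0, h1, h2⟩ := key i hi ⟨h.1, h.2.1⟩
    rcases h1.lt_or_eq with h1 | rfl
    · refine hH.2.1 (a + i) ⟨h2.1, h2.2, ?_⟩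
      rw [add_assoc]
      exact (c.west_sameDir (by omega) (by omega)).2.2.1.1 h.2.2
    · have := (c.west.rectCurve.dir_periodic (-1) 1).2.2.2
      rw [c.west_n, show (-1 : ℤ) + 1 * (c.m - a + 2) = c.m - a + 1 by ring] at this
      exact h.2.2.not_downward (this.2 c.west_neg_one)
  · obtain ⟨h0, h1, h2⟩ := key i hi h
    obtain ⟨k0, k1, k2⟩ := key j hj h'
    rw [c.west_v h0 h1, c.west_v k0 k1]
    exact hH.2.2 _ _ h2 k2

theorem east_isBLS (hH : H.IsBLS) : c.east.IsBLS := by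
  have key : ∀ i ∈ Ico (-1 : ℤ) (-1 + c.east.n), c.east.IsFallingCorner i →
      i ∈ Ico 0 (a - 1 + H.n - c.pB) ∧ H.IsFallingCorner (c.pB + i) := by
    intro i hi h
    rcases c.east_cases hi with rfl | rfl | hi
    · have := (c.east.rectCurve.dir_periodic (-2) 1).2.2.1
      rw [c.east_n, show (-2 : ℤ) + 1 * (a - 1 + H.n - c.pB + 2) = a - 1 + H.n - c.pB by ring] at this
      exact absurd h.1 (this.1 c.east_up).not_downward
    · exact absurd h.2.horizontal c.east_up.vertical.not_horizontal
    · have h1 := hi.1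
      have h2 := hi.2
      refine ⟨hi, ?_, (c.east_sameDir (by omega) h2.le).1.1 h.2⟩
      have := (c.east_sameDir (j := i - 1) (by omega) (by omega)).2.2.2.1 h.1
      rwa [← add_sub_assoc] at this
  refine c.east.isBLS_of_period (-1) (fun i hi => ?_) (fun i hi h => ?_) fun i hi j hj h h' => ?_
  · rcases c.east_cases hi with h | h | h
    · exact (c.east_types_end (Or.inl h)).2.2
    · exact (c.east_types_end (Or.inr h)).2.2
    · rw [(c.east_types h).2.2.2]; exact hH.1 _
  · obtain ⟨h1, h2⟩ := key i hi ⟨h.1, h.2.1⟩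
    refine hH.2.1 (c.pB + i) ⟨h2.1, h2.2, ?_⟩
    have := h1.1
    have := h1.2
    rw [add_assoc]
    exact (c.east_sameDir (by omega) (by omega)).2.2.1.1 h.2.2
  · obtain ⟨h1, h2⟩ := key i hi h
    obtain ⟨k1, k2⟩ := key j hj h'
    rw [c.east_v h1.1 h1.2.le, c.east_v k1.1 k1.2.le]
    exact hH.2.2 _ _ h2 k2

/-- The western piece has the rightmost edge that lies on the cut, hence no other one. -/
theorem not_RM_of_mem (hH : H.IsBLS) {i : ℤ} (hi : i ∈ Ico a c.pB) : ¬ RM H.v i := by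
  intro h
  have h1 := hi.1
  have h2 := hi.2
  rcases lt_trichotomy i c.m with h3 | rfl | h3
  · rcases h1.lt_or_eq with h1 | rfl
    · have hi' : i - a ∈ Ioo 0 (c.m - a) := ⟨by omega, by omega⟩
      have := (c.west_types hi').2.1
      rw [add_sub_cancel] at this
      have := c.west.rectCurve.rm_unique (c.west_isBLS hH).1 (a := -1) (this.2 h) c.west_RM
        ⟨by omega, by rw [c.west_n]; omega⟩ ⟨le_rfl, by rw [c.west_n]; linarith [c.lt_m]⟩
      omega
    · exact h.2.1.vertical.not_horizontal c.left.horizontal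
  · exact h.2.1.vertical.not_horizontal c.right_m.horizontal
  · exact (c.mid_types i ⟨h3, h2⟩).1 h

end Cut

/-! ### Cutting at the last left notch of a canonical ordering -/

namespace Hole

variable {H : Hole}

theorem edge_periodic (i k : ℤ) : H.edge (i + k * H.n) = H.edge i := by
  have X := H.rectCurve
  rw [edge, edge, show i + k * (H.n : ℤ) + 1 = i + 1 + k * H.n by ring, X.periodic_int, X.periodic_int]

theorem leftmostEdges_eq (b : ℤ) :
    H.leftmostEdges = {e | ∃ i ∈ Ico b (b + H.n), LM H.v i ∧ e = H.edge i} := by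
  ext e
  constructor
  · rintro ⟨i, hi, rfl⟩
    obtain ⟨k, hk⟩ := RectCurve.exists_int_mem_Ico H.n_pos b i
    exact ⟨_, hk, (H.rectCurve.types_periodic i k).1.2 hi, (edge_periodic i k).symm⟩
  · rintro ⟨i, -, hi, rfl⟩
    exact ⟨i, hi, rfl⟩

theorem rightmostEdges_eq (hH : H.IsBLS) {r : ℤ} (hr : RM H.v r) : H.rightmostEdges = {H.edge r} := by
  ext e
  constructor
  · rintro ⟨i, hi, rfl⟩
    obtain ⟨k, hk⟩ := RectCurve.exists_int_mem_Ico H.n_pos r i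
    have := H.rectCurve.rm_unique hH.1 ((H.rectCurve.types_periodic i k).2.1.2 hi) hr hk
      ⟨le_rfl, by have := H.n_pos; omega⟩
    rw [mem_singleton_iff, ← this, edge_periodic]
  · rintro rfl
    exact ⟨r, hr, rfl⟩

theorem IsCanonicalOrdering.not_RM {k : ℕ} {r : ℤ} {ℓ ν : ℕ → ℤ}
    (h : H.IsCanonicalOrdering k r ℓ ν) (hH : H.IsBLS) {i : ℤ} (hi : i ∈ Ioo r (r + H.n)) :
    ¬ RM H.v i := by
  intro h'
  have h1 := hi.1
  have := H.rectCurve.rm_unique hH.1 h' h.rightmost ⟨h1.le, hi.2⟩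
    ⟨le_rfl, by have := H.n_pos; omega⟩
  omega

end Hole

open Hole

namespace Cut

variable {H : Hole} {a : ℤ} (c : Cut H a)

theorem west_edge {i : ℤ} (h0 : 0 ≤ i) (h1 : i < c.m - a) : c.west.edge i = H.edge (a + i) := by
  rw [edge, edge, c.west_v h0 h1.le, c.west_v (by omega) (by omega), add_assoc]

theorem east_edge {i : ℤ} (h0 : 0 ≤ i) (h1 : i < a - 1 + H.n - c.pB) :
    c.east.edge i = H.edge (c.pB + i) := by
  rw [edge, edge, c.east_v h0 h1.le, c.east_v (by omega) (by omega), add_assoc]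

variable {k : ℕ} {r : ℤ} {ℓ ν : ℕ → ℤ}

/-- The position of the cut at the last left notch. -/
theorem last_cut (hH : H.IsBLS) (h : H.IsCanonicalOrdering k r ℓ ν) (hk : 2 ≤ k) (ha : a = ν k + 1) :
    r + H.n ∈ Ico c.pB (a - 1 + H.n) ∧ (∀ i ∈ Ico a (r + H.n), ¬ LN H.v i) ∧
      (∀ i ∈ Ico c.m (r + H.n), ¬ LM H.v i) ∧ ℓ k ∈ Ioo a c.m ∧ ∀ i ∈ Icc 1 (k - 1), ℓ i < a - 1 := by
  have X := H.rectCurve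
  have l1 := c.lt_m
  have l2 := c.m_lt
  have l3 := c.pB_lt
  have hνk : ν k ∈ {m | m ∈ Ioo r (r + H.n) ∧ H.IsLeftNotch m} := by
    rw [← h.notch_eq]; exact mem_image_of_mem _ ⟨hk, le_rfl⟩
  obtain ⟨⟨hν1, hν2⟩, hνN⟩ := hνk
  have hLN : ∀ i ∈ Ico a (r + H.n), ¬ LN H.v i := by
    intro i hi hi'
    have h1 := hi.1
    have : i ∈ {m | m ∈ Ioo r (r + H.n) ∧ H.IsLeftNotch m} := ⟨⟨by omega, hi.2⟩, hi'⟩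
    rw [← h.notch_eq] at this
    obtain ⟨j, hj, rfl⟩ := this
    have := h.notch_mono.monotoneOn hj ⟨hk, le_rfl⟩ hj.2
    omega
  have hRMw : RM H.v (r + H.n) := by
    have := (X.types_periodic r 1).2.1
    rw [one_mul] at this
    exact this.2 h.rightmost
  -- The western piece has its only rightmost edge on the cut, so the rightmost edge of `H` comes
  -- after the western arc.
  have hr : r + H.n ∈ Ico c.pB (a - 1 + H.n) := by
    refine ⟨?_, by omega⟩
    by_contra hc
    exact c.not_RM_of_mem hH ⟨by omega, not_le.1 hc⟩ hRMw
  have hr1 := hr.1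
  have hr2 := hr.2
  have hRM : ∀ i ∈ Ico a (r + H.n), ¬ RM H.v i := fun i hi =>
    h.not_RM hH ⟨by have := hi.1; omega, hi.2⟩
  -- Between `a` and `r + H.n` there are no left notches, right notches or rightmost edges, so each
  -- leftmost edge switches the horizontal direction from left to right for good. The count starts
  -- at 0 on the leftward edge `a` and equals 1 both at `m` and at `r + H.n`: exactly one leftmost
  -- edge occurs, and it lies before `m`.
  have hsum : ∀ b ∈ Icc a (r + H.n), ∑ i ∈ Finset.Ico a b, ind (LM H.v i) =
      ind (Rightward H.v b) + ind (Rightward H.v (b - 1)) := by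
    intro b hb
    have := X.word_sum hb.1
    rw [ind_false c.left.not_rightward,
      ind_false (fun h' : Rightward H.v (a - 1) => h'.horizontal.not_vertical c.up.vertical), add_zero,
      sub_zero] at this
    rw [← this]
    refine Finset.sum_congr rfl fun i hi => ?_
    rw [Finset.mem_Ico] at hi
    have hi' : i ∈ Ico a (r + H.n) := ⟨hi.1, hi.2.trans_le hb.2⟩
    rw [ind_false (hLN i hi'), ind_false (hRM i hi'), ind_false (show ¬ RN H.v i from hH.1 i)]
    ring
  have s1 := hsum (r + H.n) ⟨by omega, le_rfl⟩
  rw [ind_false (fun h' : Rightward H.v (r + H.n) => h'.horizontal.not_vertical hRMw.2.1.vertical),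
    ind_true hRMw.1, zero_add] at s1
  have s2 := hsum c.m ⟨by omega, by omega⟩
  have hv : Vertical H.v (c.m - 1) := X.vertical_pred.2 c.right_m.horizontal
  rw [ind_true c.right_m, ind_false (fun h' : Rightward H.v (c.m - 1) =>
    h'.horizontal.not_vertical hv), add_zero] at s2
  obtain ⟨p, hp, hpL⟩ := RectCurve.exists_of_sum_ind (P := LM H.v) (by rw [s2]; exact one_pos)
  have hp1 := hp.1
  have hp2 := hp.2
  have huniq : ∀ i ∈ Ico a (r + H.n), LM H.v i → i = p := fun i hi hi' =>
    RectCurve.eq_of_sum_ind s1.le hi ⟨hp1, by omega⟩ hi' hpL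
  have hmem : ∀ i ∈ Icc 1 k, ℓ i ∈ Ioo r (r + H.n) ∧ LM H.v (ℓ i) := fun i hi => by
    have : ℓ i ∈ {m | m ∈ Ioo r (r + H.n) ∧ H.IsLeftmost m} := by
      rw [← h.leftmost_eq]; exact mem_image_of_mem _ hi
    exact this
  have hpa : p ≠ a := by
    rintro rfl
    exact hpL.2.1.vertical.not_horizontal c.left.horizontal
  have hpk : ℓ k = p := by
    have : p ∈ {m | m ∈ Ioo r (r + H.n) ∧ H.IsLeftmost m} := ⟨⟨by omega, by omega⟩, hpL⟩
    rw [← h.leftmost_eq] at this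
    obtain ⟨j, hj, rfl⟩ := this
    have hkk : k ∈ Icc 1 k := ⟨by omega, le_rfl⟩
    have h1 := h.leftmost_mono.monotoneOn hj hkk hj.2
    exact huniq _ ⟨by omega, (hmem k hkk).1.2⟩ (hmem k hkk).2
  refine ⟨hr, hLN, fun i hi hi' => ?_, by rw [hpk]; exact ⟨by omega, hp2⟩, fun i hi => ?_⟩
  · have h1 := hi.1
    have := huniq i ⟨by omega, hi.2⟩ hi'
    omega
  · have h1 := hi.1
    have h2 := hi.2
    have hi' : i ∈ Icc 1 k := ⟨h1, by omega⟩
    have h3 := h.leftmost_mono hi' ⟨by omega, le_rfl⟩ (show i < k by omega)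
    have h4 := hmem i hi'
    by_contra hc
    rcases (not_lt.1 hc).lt_or_eq with hc | hc
    · have := huniq _ ⟨by omega, h4.1.2⟩ h4.2
      omega
    · rw [← hc] at h4
      have := h4.2.1
      rw [show a - 1 - 1 = a - 2 by ring] at this
      exact this.not_rightward c.right

/-- A leftward edge `pB - 1` would make `pB - 2` a left notch by `mid_notch`, and it would come
after the last one. -/
theorem last_cut_right (hH : H.IsBLS) (h : H.IsCanonicalOrdering k r ℓ ν) (hk : 2 ≤ k)
    (ha : a = ν k + 1) : Rightward H.v (c.pB - 1) := by
  obtain ⟨hr, hLN, -⟩ := c.last_cut hH h hk ha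
  rcases c.dir_zB with h' | h'
  · exact h'.1
  · exfalso
    obtain ⟨h1, h2⟩ := c.mid_notch h'.1
    exact hLN _ ⟨by linarith [c.lt_m], by linarith [hr.1]⟩ h2

theorem west_isNice (hH : H.IsBLS) (h : H.IsCanonicalOrdering k r ℓ ν) (hk : 2 ≤ k)
    (ha : a = ν k + 1) : c.west.IsNice := by
  obtain ⟨hr, hLN, -⟩ := c.last_cut hH h hk ha
  have hm := c.m_lt
  refine ⟨c.west_isBLS hH, fun i hi => ?_⟩
  obtain ⟨l, hl⟩ := RectCurve.exists_int_mem_Ico c.west.n_pos (-1) i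
  have hi' := (c.west.rectCurve.types_periodic i l).2.2.1.2 hi
  rcases c.west_cases hl with h' | h' | h' | h'
  · exact (c.west_types_end (Or.inl h')).2.1 hi'
  · exact (c.west_types_end (Or.inr (Or.inl h'))).2.1 hi'
  · exact (c.west_types_end (Or.inr (Or.inr h'))).2.1 hi'
  · have h1 := h'.1
    have h2 := h'.2
    have h3 := hr.1
    exact hLN _ ⟨by omega, by omega⟩ ((c.west_types h').2.2.1.1 hi')

theorem west_leftmostEdges (hH : H.IsBLS) (h : H.IsCanonicalOrdering k r ℓ ν) (hk : 2 ≤ k)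
    (ha : a = ν k + 1) : c.west.leftmostEdges = {H.edge (ℓ k)} := by
  obtain ⟨hr, -, -, hℓ, hℓ'⟩ := c.last_cut hH h hk ha
  have hm := c.m_lt
  have hr1 := hr.1
  have hr2 := hr.2
  have hℓ1 := hℓ.1
  have hℓ2 := hℓ.2
  have hkL : LM H.v (ℓ k) := by
    have : ℓ k ∈ {m | m ∈ Ioo r (r + H.n) ∧ H.IsLeftmost m} := by
      rw [← h.leftmost_eq]; exact mem_image_of_mem _ ⟨by omega, le_rfl⟩
    exact this.2
  rw [leftmostEdges_eq (-1)]
  ext e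
  simp only [mem_ofPred_eq, mem_singleton_iff]
  constructor
  · rintro ⟨i, hi, hiL, rfl⟩
    rcases c.west_cases hi with h' | h' | h' | h'
    · exact absurd hiL (c.west_types_end (Or.inl h')).1
    · exact absurd hiL (c.west_types_end (Or.inr (Or.inl h'))).1
    · exact absurd hiL (c.west_types_end (Or.inr (Or.inr h'))).1
    · have h1 := h'.1
      have h2 := h'.2
      have : a + i ∈ {m | m ∈ Ioo r (r + H.n) ∧ H.IsLeftmost m} :=
        ⟨⟨by omega, by omega⟩, (c.west_types h').1.1 hiL⟩
      rw [← h.leftmost_eq] at this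
      obtain ⟨j, hj, hji⟩ := this
      rw [c.west_edge h1.le h2, ← hji]
      rcases hj.2.lt_or_eq with hjk | rfl
      · have := hℓ' j ⟨hj.1, by omega⟩
        omega
      · rfl
  · rintro rfl
    refine ⟨ℓ k - a, ⟨by omega, by rw [c.west_n]; omega⟩, ?_, ?_⟩
    · rw [(c.west_types ⟨by omega, by omega⟩).1, add_sub_cancel]; exact hkL
    · rw [c.west_edge (by omega) (by omega), add_sub_cancel]

theorem west_rightmostEdges (hH : H.IsBLS) : c.west.rightmostEdges = {{c.zA, H.v a}} := by
  rw [rightmostEdges_eq (c.west_isBLS hH) c.west_RM, edge, c.west_v_neg_one,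
    show (-1 : ℤ) + 1 = 0 by ring, c.west_v_zero]

/-- Common bookkeeping for leftmost edges and left notches. Indices before the end of the eastern
arc are shifted by `H.n - pB`. Those past the end wrap round to edges between `pB` and the rightmost
edge, where `hnone` applies. Only the last index `f k` gets lost. -/
theorem east_image {P P' : ℤ → Prop} {f : ℕ → ℤ} {b : ℕ} (hPper : ∀ i, P (i + H.n) ↔ P i)
    (hP'per : ∀ i, P' (i + c.east.n) ↔ P' i)
    (htypes : ∀ i ∈ Ico 0 (a - 1 + H.n - c.pB), (P' i ↔ P (c.pB + i)))
    (hend : ∀ i, (i = -1 ∨ i = a - 1 + H.n - c.pB) → ¬ P' i)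
    (hr : r + H.n ∈ Ico c.pB (a - 1 + H.n)) (hnone : ∀ i ∈ Ico c.pB (r + H.n), ¬ P i)
    (hf : f '' Icc b k = {m | m ∈ Ioo r (r + H.n) ∧ P m}) (hlt : ∀ i ∈ Icc b (k - 1), f i < a - 1)
    (hk : a - 1 ≤ f k) :
    (fun i => f i + H.n - c.pB) '' Icc b (k - 1) =
      {m | m ∈ Ioo (r + H.n - c.pB) (r + H.n - c.pB + c.east.n) ∧ P' m} := by
  have hr1 := hr.1
  have hr2 := hr.2
  have hn := c.east_n
  have hm := c.lt_m
  have hm' := c.m_lt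
  ext i
  constructor
  · rintro ⟨j, hj, rfl⟩
    have hj' : f j ∈ {m | m ∈ Ioo r (r + H.n) ∧ P m} := by
      rw [← hf]; exact mem_image_of_mem _ ⟨hj.1, hj.2.trans (by omega)⟩
    obtain ⟨⟨h1, h2⟩, h3⟩ := hj'
    have h4 := hlt j hj
    change f j + H.n - c.pB ∈ _
    refine ⟨⟨by omega, by omega⟩, ?_⟩
    · rw [htypes _ ⟨by omega, by omega⟩, show c.pB + (f j + H.n - c.pB) = f j + H.n by ring, hPper]
      exact h3
  · rintro ⟨⟨h1, h2⟩, h3⟩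
    rcases lt_trichotomy i (a - 1 + H.n - c.pB) with h4 | h4 | h4
    · rw [htypes _ ⟨by omega, h4⟩, ← sub_add_cancel (c.pB + i) (H.n : ℤ), hPper] at h3
      have : c.pB + i - H.n ∈ {m | m ∈ Ioo r (r + H.n) ∧ P m} := ⟨⟨by omega, by omega⟩, h3⟩
      rw [← hf] at this
      obtain ⟨j, hj, hji⟩ := this
      refine ⟨j, ⟨hj.1, ?_⟩, ?_⟩
      · have : j ≠ k := by rintro rfl; omega
        have := hj.2
        omega
      · dsimp only; rw [hji]; ring
    · exact absurd h3 (hend i (Or.inr h4))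
    · rw [← sub_add_cancel i (c.east.n : ℤ), hP'per] at h3
      rcases (show i - c.east.n = -1 ∨ 0 ≤ i - c.east.n by omega) with h5 | h5
      · exact absurd h3 (hend _ (Or.inl h5))
      · rw [htypes _ ⟨h5, by omega⟩] at h3
        exact absurd h3 (hnone _ ⟨by omega, by omega⟩)

theorem east_canonicalOrdering (hH : H.IsBLS) (h : H.IsCanonicalOrdering k r ℓ ν) (hk : 2 ≤ k)
    (ha : a = ν k + 1) : c.east.IsCanonicalOrdering (k - 1) (r + H.n - c.pB)
      (fun i => ℓ i + H.n - c.pB) (fun i => ν i + H.n - c.pB) := by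
  obtain ⟨hr, hLN, hLM, hℓ, hℓ'⟩ := c.last_cut hH h hk ha
  have hright := c.last_cut_right hH h hk ha
  have X := H.rectCurve
  have hper := fun i => X.types_periodic i 1
  have hper' := fun i => c.east.rectCurve.types_periodic i 1
  simp only [one_mul] at hper hper'
  have hm := c.m_lt
  have hlt := c.lt_m
  refine ⟨?_, ?_, ?_, ?_, ?_⟩
  · change RM c.east.v _
    rw [(c.east_types ⟨by linarith [hr.1], by linarith [hr.2]⟩).2.1,
      show c.pB + (r + H.n - c.pB) = r + H.n by ring, (hper r).2.1]
    exact h.rightmost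
  · intro i hi j hj hij
    have := h.leftmost_mono ⟨hi.1, hi.2.trans (by omega)⟩ ⟨hj.1, hj.2.trans (by omega)⟩ hij
    dsimp only
    omega
  · exact c.east_image (P := LM H.v) (P' := LM c.east.v) (fun i => (hper i).1) (fun i => (hper' i).1)
      (fun i hi => (c.east_types hi).1) (fun i hi => (c.east_types_end hi).1) hr
      (fun i hi => hLM i ⟨hm.le.trans hi.1, hi.2⟩) h.leftmost_eq hℓ' (by linarith [hℓ.1])
  · intro i hi j hj hij
    have := h.notch_mono ⟨hi.1, hi.2.trans (by omega)⟩ ⟨hj.1, hj.2.trans (by omega)⟩ hij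
    dsimp only
    omega
  · exact c.east_image (P := LN H.v) (P' := LN c.east.v) (fun i => (hper i).2.2.1)
      (fun i => (hper' i).2.2.1) (fun i hi => (c.east_types hi).2.2.1)
      (fun i hi => (c.east_types_end hi).2.1 hright) hr
      (fun i hi => hLN i ⟨by linarith [hi.1], hi.2⟩) h.notch_eq
      (fun i hi => by
        have h1 := hi.1
        have h2 := hi.2
        have := h.notch_mono (a := i) (b := k) ⟨h1, by omega⟩ ⟨hk, le_rfl⟩ (by omega)
        omega) (by omega)

end Cut

/-! ### The remaining cuts are unchanged in the eastern piece -/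

namespace Hole

variable {H : Hole}

theorem QN_eq {m : ℤ} {y : ℝ} (hy : (H.Q m).2 < y) (hb : ((H.Q m).1, y) ∈ H.boundary)
    (hn : ∀ z ∈ Ioo (H.Q m).2 y, ((H.Q m).1, z) ∉ H.boundary) : H.QN m = ((H.Q m).1, y) := by
  have : IsLeast {y : ℝ | (H.Q m).2 < y ∧ ((H.Q m).1, y) ∈ H.boundary} y :=
    ⟨⟨hy, hb⟩, fun z hz => not_lt.1 fun h => hn z ⟨hz.1, h⟩ hz.2⟩
  rw [QN, this.csInf_eq]

theorem Q_periodic (m : ℤ) : H.Q (m + H.n) = H.Q m := by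
  rw [Q, Q, show m + (H.n : ℤ) + 1 = m + 1 + H.n by ring, H.periodic]

theorem QN_periodic (m : ℤ) : H.QN (m + H.n) = H.QN m := by
  rw [QN, QN, Q_periodic]

theorem QNstar_periodic (m : ℤ) : H.QNstar (m + H.n) = H.QNstar m := by
  by_cases hex : ∃ i, Downward H.v i ∧ H.v (i + 1) = H.QN m
  · obtain ⟨i, hi, h⟩ := hex
    rw [QNstar_of_downward hi h, QNstar_of_downward hi (h.trans (QN_periodic m).symm)]
  · rw [QNstar_of_not_downward fun i hi h => hex ⟨i, hi, h⟩,
      QNstar_of_not_downward fun i hi h => hex ⟨i, hi, h.trans (QN_periodic m)⟩, QN_periodic]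

theorem segment_subset_carrier {m : ℤ} (h : LN H.v m) : segment ℝ (H.Q m) (H.QN m) ⊆ H.carrier := by
  obtain ⟨h1, h2, h3, h4⟩ := first_hit h.2.1 h.2.2
  intro P hP
  rw [mem_segment_vertical h2.symm, uIcc_of_le h3.le] at hP
  obtain ⟨k1, k2, k3⟩ := hP
  have hPe : P = ((H.Q m).1, P.2) := by rw [← k1]
  rcases k2.lt_or_eq with k2 | k2
  · rcases k3.lt_or_eq with k3 | k3
    · right; rw [hPe]; exact h4 _ ⟨k2, k3⟩
    · left
      rwa [hPe, k3, ← h2]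
  · left
    rw [hPe, ← k2]
    exact H.vertex_mem_boundary _

end Hole

namespace Cut

variable {H : Hole} {a : ℤ} (c : Cut H a)

theorem east_inner_subset : c.east.inner ⊆ H.inner := by
  have h : c.west.inner ∪ c.east.inner ⊆ H.inner := c.inner_diff_slit ▸ sdiff_subset
  exact subset_union_right.trans h

variable {p : ℤ} (hp : p ∈ Ico 0 (a - 1 + H.n - c.pB))
include hp

theorem east_Q : c.east.Q p = H.Q (c.pB + p) := by
  have h1 := hp.1
  have h2 := hp.2
  rw [Hole.Q, Hole.Q, c.east_v (by omega) (by omega), add_assoc]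

variable (hLN : LN H.v (c.pB + p))
include hLN

/-- The cut belongs to the eastern boundary. A ray ending on it above `v a` would run along the cut
just before its end, although the open segment lies in the eastern inner region. -/
theorem east_QN_not_mem (h1 : (c.east.QN p).1 = (H.v a).1) (h2 : (H.v a).2 < (c.east.QN p).2)
    (h3 : (c.east.QN p).2 ≤ c.yN) : False := by
  have hL := (c.east_types hp).2.2.1.2 hLN
  obtain ⟨k1, k2, k3, k4⟩ := Hole.first_hit hL.2.1 hL.2.2
  set y := max ((H.v a).2) (c.east.Q p).2
  have hy : y < (c.east.QN p).2 := max_lt h2 k3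
  have hin := k4 ((y + (c.east.QN p).2) / 2)
    ⟨by linarith [le_max_right (H.v a).2 (c.east.Q p).2], by linarith⟩
  refine hin.1 (c.slit_subset_east (c.mem_slit.2 ⟨k2.symm.trans h1, ?_, ?_⟩))
  · dsimp only; linarith [le_max_left (H.v a).2 (c.east.Q p).2]
  · dsimp only; linarith

/-- The ray in the eastern piece passes only through inner points of `H`, and by `east_QN_not_mem`
it ends on the boundary of `H`, possibly at `v a`. So its end is also the first hit in `H`. -/
theorem east_QN : c.east.QN p = H.QN (c.pB + p) := by
  have hL := (c.east_types hp).2.2.1.2 hLN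
  obtain ⟨k1, k2, k3, k4⟩ := Hole.first_hit hL.2.1 hL.2.2
  have hQ := c.east_Q hp
  have hb : c.east.QN p ∈ H.boundary := by
    rcases c.boundary_east_subset k1 with h | h
    · exact h
    · obtain ⟨h1, h2, h3⟩ := c.mem_slit.1 h
      rcases h2.lt_or_eq with h2 | h2
      · exact (c.east_QN_not_mem hp hLN h1 h2 h3).elim
      · rw [show c.east.QN p = H.v a from Prod.ext h1 h2.symm]
        exact H.vertex_mem_boundary a
  rw [hQ] at k2 k3 k4
  have he : ((H.Q (c.pB + p)).1, (c.east.QN p).2) = c.east.QN p := by rw [← k2]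
  rw [Hole.QN_eq k3 (by rwa [he]) fun z hz => (c.east_inner_subset (k4 z hz)).1, he]

theorem east_QNstar : c.east.QNstar p = H.QNstar (c.pB + p) := by
  have X := H.rectCurve
  have hQN := c.east_QN hp hLN
  have hL := (c.east_types hp).2.2.1.2 hLN
  obtain ⟨k1, k2, k3, k4⟩ := Hole.first_hit hL.2.1 hL.2.2
  have hm := c.lt_m
  have hm' := c.m_lt
  have hpB := c.pB_lt
  have key : ∀ i ∈ Ico 0 (a - 1 + H.n - c.pB), Downward H.v (c.pB + i) →
      H.v (c.pB + i + 1) = H.QN (c.pB + p) → c.east.QNstar p = H.QNstar (c.pB + p) := by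
    intro i hi hD hv
    have h1 := hi.1
    have h2 := hi.2
    rw [Hole.QNstar_of_downward hD hv, Hole.QNstar_of_downward (i := i)
      ((c.east_sameDir (by omega) h2.le).2.2.2.2 hD), c.east_v h1 h2.le]
    rw [c.east_v (by omega) (by omega), hQN, ← hv, add_assoc]
  by_cases hex : ∃ i, Downward H.v i ∧ H.v (i + 1) = H.QN (c.pB + p)
  · obtain ⟨i, hD, hv⟩ := hex
    obtain ⟨l, hl⟩ := RectCurve.exists_int_mem_Ico X.n_pos a i
    have hD' := (X.dir_periodic i l).2.2.2.2 hD
    have hv' : H.v (i + l * H.n + 1) = H.QN (c.pB + p) := by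
      rw [show i + l * (H.n : ℤ) + 1 = i + 1 + l * H.n by ring, X.periodic_int, hv]
    clear hD hv
    generalize i + l * (H.n : ℤ) = i at hl hD' hv'
    have hi1 := hl.1
    have hi2 := hl.2
    -- A downward edge before `pB` is impossible. One on the western arc ends at a point off the
    -- eastern boundary; one between `m` and `pB` ends at the top of the cut by `mid_down`, which
    -- `east_QN_not_mem` excludes.
    rcases lt_or_ge i c.pB with h1 | h1
    · exfalso
      rcases lt_trichotomy i c.m with h2 | rfl | h2
      · rw [← hQN] at hv'
        have : curve H.v ((i + 1 : ℤ) : ℝ) ∉ c.east.boundary := by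
          refine c.curve_not_mem_east ⟨by exact_mod_cast (by omega), ?_⟩
          refine lt_of_le_of_lt ?_ c.sA_mem.1
          exact_mod_cast (by omega)
        rw [curve_int, hv'] at this
        exact this k1
      · exact hD'.vertical.not_horizontal c.right_m.horizontal
      · rw [← hQN, c.mid_down i ⟨h2, h1⟩ hD'] at hv'
        exact c.east_QN_not_mem hp hLN (by rw [← hv']) (by rw [← hv']; exact c.lt_yN) (by rw [← hv'])
    · have hne : i ≠ a - 1 + H.n := by
        rintro rfl
        exact hD'.not_upward c.up_wrap
      have e : c.pB + (i - c.pB) = i := by ring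
      refine key (i - c.pB) ⟨by omega, by omega⟩ ?_ ?_
      · rwa [e]
      · rwa [e]
  · rw [Hole.QNstar_of_not_downward fun i hi hv => hex ⟨i, hi, hv⟩, ← hQN]
    refine Hole.QNstar_of_not_downward fun i hi hv => ?_
    obtain ⟨l, hl⟩ := RectCurve.exists_int_mem_Ico c.east.n_pos (-1) i
    have hD' := (c.east.rectCurve.dir_periodic i l).2.2.2.2 hi
    rcases c.east_cases hl with h | h | h
    · rw [h] at hD'
      exact hD'.vertical.not_horizontal c.east_horizontal
    · rw [h] at hD'
      exact hD'.not_upward c.east_up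
    · have h1 := h.1
      have h2 := h.2
      refine hex ⟨_, (c.east_sameDir (by omega) h2.le).2.2.2.1 hD', ?_⟩
      rw [add_assoc, ← c.east_v (by omega) (by omega), ← hQN, ← hv,
        show i + l * (c.east.n : ℤ) + 1 = i + 1 + l * c.east.n by ring, c.east.rectCurve.periodic_int]

end Cut

/-! ### Connected regions of a union of separated sets -/

theorem connectedComponentIn_union_left {A B A' B' : Set Plane} (hA : IsOpen A) (hB : IsOpen B)
    (hAB : Disjoint A B) (hA' : A' ⊆ A) (hB' : B' ⊆ B) {p : Plane} (hp : p ∈ A') :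
    connectedComponentIn (A' ∪ B') p = connectedComponentIn A' p := by
  apply Subset.antisymm
  · have hsub := connectedComponentIn_subset (A' ∪ B') p
    have hmem : p ∈ connectedComponentIn (A' ∪ B') p := mem_connectedComponentIn (Or.inl hp)
    have h : connectedComponentIn (A' ∪ B') p ⊆ A :=
      isPreconnected_connectedComponentIn.subset_left_of_subset_union hA hB hAB
        (hsub.trans (union_subset_union hA' hB')) ⟨p, hmem, hA' hp⟩
    refine isPreconnected_connectedComponentIn.subset_connectedComponentIn hmem fun q hq => ?_
    rcases hsub hq with h' | h'
    · exact h'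
    · exact (Set.disjoint_left.1 hAB (h hq) (hB' h')).elim
  · exact connectedComponentIn_mono p subset_union_left

theorem regions_union {A B A' B' : Set Plane} (hA : IsOpen A) (hB : IsOpen B)
    (hAB : Disjoint A B) (hA' : A' ⊆ A) (hB' : B' ⊆ B) :
    regions (A' ∪ B') = regions A' ∪ regions B' := by
  have h1 := fun {p} => connectedComponentIn_union_left hA hB hAB hA' hB' (p := p)
  have h2 := fun {p} => connectedComponentIn_union_left hB hA hAB.symm hB' hA' (p := p)
  rw [union_comm B'] at h2
  ext C
  constructor
  · rintro ⟨p, hp | hp, rfl⟩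
    · exact Or.inl ⟨p, hp, h1 hp⟩
    · exact Or.inr ⟨p, hp, h2 hp⟩
  · rintro (⟨p, hp, rfl⟩ | ⟨p, hp, rfl⟩)
    · exact ⟨p, Or.inl hp, (h1 hp).symm⟩
    · exact ⟨p, Or.inr hp, (h2 hp).symm⟩

theorem regions_of_isPreconnected {A : Set Plane} (hA : IsPreconnected A) (hne : A.Nonempty) :
    regions A = {A} := by
  ext C
  constructor
  · rintro ⟨p, hp, rfl⟩
    exact hA.connectedComponentIn hp
  · rintro rfl
    obtain ⟨p, hp⟩ := hne
    exact ⟨p, hp, (hA.connectedComponentIn hp).symm⟩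

theorem subset_of_mem_regions {A C : Set Plane} (h : C ∈ regions A) : C ⊆ A := by
  obtain ⟨p, -, rfl⟩ := h
  exact connectedComponentIn_subset A p

/-! ### Assembling the pieces -/

namespace Hole

variable {H : Hole}

/-- Edges of different holes are compared only as pairs of end points. The midpoint turns this into
a statement about points: a hole whose boundary misses the midpoint does not have the edge. -/
theorem midpoint_mem_boundary {A B : Plane} (h : ({A, B} : Set Plane) ∈ H.edges) :
    midpoint ℝ A B ∈ H.boundary := by
  obtain ⟨i, hi⟩ := h
  have : midpoint ℝ A B = midpoint ℝ (H.v i) (H.v (i + 1)) := by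
    rcases Set.pair_eq_pair_iff.1 hi with ⟨h1, h2⟩ | ⟨h1, h2⟩
    · rw [h1, h2]
    · rw [h1, h2, midpoint_comm]
  rw [this]
  exact mem_iUnion.2 ⟨i, midpoint_mem_segment _ _⟩

theorem midpoint_eq_curve (i : ℤ) :
    midpoint ℝ (H.v i) (H.v (i + 1)) = curve H.v (i + 1 / 2) := by
  rw [curve_add H.v i (by norm_num) (by norm_num), midpoint]
  norm_num

theorem curve_mem_boundary_of_edge_mem {S : Hole} {i : ℤ} (h : H.edge i ∈ S.edges) :
    curve H.v (i + 1 / 2) ∈ S.boundary := by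
  rw [← midpoint_eq_curve]
  exact midpoint_mem_boundary h

/-- The pieces into which the cuts divide the hole. -/
structure IsPieces (H : Hole) (k : ℕ) (r : ℤ) (ℓ ν : ℕ → ℤ) (S : ℕ → Hole) : Prop where
  nice : ∀ i ∈ Icc 1 k, (S i).IsNice
  inner_inj : InjOn (fun i => (S i).inner) (Icc 1 k)
  regions_eq : (fun i => (S i).inner) '' Icc 1 k = regions (H.inner \ H.cuts k ν)
  carrier_eq : ⋃ i ∈ Icc 1 k, (S i).carrier = H.carrier
  leftmost : ∀ i ∈ Icc 1 k, (S i).leftmostEdges = {H.edge (ℓ i)}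
  edge_mem : ∀ i ∈ Icc 1 k, ∀ j ∈ Icc 1 k, H.edge (ℓ i) ∈ (S j).edges → i = j
  rightmost_one : (S 1).rightmostEdges = {H.edge r}
  rightmost : ∀ i ∈ Icc 2 k, (S i).rightmostEdges = {{H.QNstar (ν i), H.Q (ν i)}}
  sum_le : ∑ i ∈ Finset.Icc 1 k, (S i).n + 2 ≤ H.n + 2 * k

variable {k : ℕ} {r : ℤ} {ℓ ν : ℕ → ℤ}

theorem IsCanonicalOrdering.pos (h : H.IsCanonicalOrdering k r ℓ ν) (hH : H.IsBLS) : 1 ≤ k := by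
  by_contra hk
  have h1 := (H.rectCurve.counts hH.1 r).2
  have h2 : 0 ≤ ∑ i ∈ Finset.Ico r (r + H.n), ind (LN H.v i) :=
    Finset.sum_nonneg fun i _ => ind_nonneg _
  obtain ⟨p, hp, hpL⟩ := RectCurve.exists_of_sum_ind (P := LM H.v) (a := r) (b := r + H.n) (by omega)
  have hpr : p ≠ r := by
    rintro rfl
    exact h.rightmost.2.1.not_upward hpL.2.1
  have h3 := hp.1
  have : p ∈ {m | m ∈ Ioo r (r + H.n) ∧ H.IsLeftmost m} := ⟨⟨by omega, hp.2⟩, hpL⟩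
  rw [← h.leftmost_eq] at this
  obtain ⟨j, hj, -⟩ := this
  have := hj.1
  have := hj.2
  omega

theorem isPieces_one (h : H.IsCanonicalOrdering 1 r ℓ ν) (hH : H.IsBLS) :
    H.IsPieces 1 r ℓ ν fun _ => H := by
  have e1 : Icc 1 1 = ({1} : Set ℕ) := Icc_self 1
  have e2 : Icc 2 1 = (∅ : Set ℕ) := Icc_eq_empty (by omega)
  have hper := fun i k => H.rectCurve.types_periodic i k
  have hcuts : H.cuts 1 ν = ∅ := by
    rw [cuts, e2]
    simp
  refine ⟨fun i hi => ⟨hH, fun m hm => ?_⟩, ?_, ?_, ?_, fun i hi => ?_, ?_, ?_, ?_, ?_⟩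
  · obtain ⟨l, hl⟩ := RectCurve.exists_int_mem_Ico H.n_pos r m
    have hm' := (hper m l).2.2.1.2 hm
    have hne : m + l * H.n ≠ r := by
      intro h'
      rw [h'] at hm'
      exact h.rightmost.2.1.not_upward hm'.2.1
    have h1 := hl.1
    have : m + l * H.n ∈ {m | m ∈ Ioo r (r + H.n) ∧ H.IsLeftNotch m} := ⟨⟨by omega, hl.2⟩, hm'⟩
    rw [← h.notch_eq, e2, image_empty] at this
    exact this
  · rw [e1]; exact injOn_singleton _ _
  · rw [hcuts, sdiff_empty, regions_of_isPreconnected H.isPreconnected_inner H.inner_nonempty, e1,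
      image_singleton]
  · simp
  · rw [e1, mem_singleton_iff] at hi
    subst hi
    have himg := h.leftmost_eq
    rw [e1, image_singleton] at himg
    ext e
    constructor
    · rintro ⟨m, hm, rfl⟩
      obtain ⟨l, hl⟩ := RectCurve.exists_int_mem_Ico H.n_pos r m
      have hm' := (hper m l).1.2 hm
      have hne : m + l * H.n ≠ r := by
        intro h'
        rw [h'] at hm'
        exact h.rightmost.2.1.not_upward hm'.2.1
      have h1 := hl.1
      have : m + l * H.n ∈ {m | m ∈ Ioo r (r + H.n) ∧ H.IsLeftmost m} := ⟨⟨by omega, hl.2⟩, hm'⟩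
      rw [← himg] at this
      rw [mem_singleton_iff, ← edge_periodic m l, this]
    · rintro rfl
      have : ℓ 1 ∈ {m | m ∈ Ioo r (r + H.n) ∧ H.IsLeftmost m} := himg ▸ rfl
      exact ⟨_, this.2, rfl⟩
  · intro i hi j hj _
    rw [e1, mem_singleton_iff] at hi hj
    rw [hi, hj]
  · exact rightmostEdges_eq hH h.rightmost
  · rw [e2]; exact fun i hi => hi.elim
  · simp

end Hole

namespace Cut

variable {H : Hole} {a : ℤ} (c : Cut H a) {k : ℕ} {r : ℤ} {ℓ ν : ℕ → ℤ}

theorem disjoint_inner_west_carrier : Disjoint c.west.inner c.east.carrier :=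
  c.disjoint_inner_west_boundary.union_right c.disjoint_inner

theorem disjoint_boundary_west_inner : Disjoint c.west.boundary c.east.inner :=
  c.disjoint_inner_east_boundary.symm

theorem east_cuts (h : ∀ i ∈ Icc 2 k, ν i + H.n - c.pB ∈ Ico 0 (a - 1 + H.n - c.pB) ∧ LN H.v (ν i)) :
    c.east.cuts k (fun i => ν i + H.n - c.pB) = H.cuts k ν ∧
      ∀ i ∈ Icc 2 k, c.east.QNstar (ν i + H.n - c.pB) = H.QNstar (ν i) ∧
        c.east.Q (ν i + H.n - c.pB) = H.Q (ν i) := by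
  have key : ∀ i ∈ Icc 2 k, c.east.QN (ν i + H.n - c.pB) = H.QN (ν i) ∧
      c.east.QNstar (ν i + H.n - c.pB) = H.QNstar (ν i) ∧
        c.east.Q (ν i + H.n - c.pB) = H.Q (ν i) := by
    intro i hi
    obtain ⟨h1, h2⟩ := h i hi
    have e : c.pB + (ν i + H.n - c.pB) = ν i + H.n := by ring
    have hper := (H.rectCurve.types_periodic (ν i) 1).2.2.1
    rw [one_mul] at hper
    have h3 : LN H.v (c.pB + (ν i + H.n - c.pB)) := by rw [e]; exact hper.2 h2
    rw [c.east_QN h1 h3, c.east_QNstar h1 h3, c.east_Q h1, e, Hole.QN_periodic, Hole.QNstar_periodic,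
      Hole.Q_periodic]
    exact ⟨rfl, rfl, rfl⟩
  refine ⟨?_, fun i hi => (key i hi).2⟩
  refine iUnion₂_congr fun i hi => ?_
  rw [(key i hi).1, (key i hi).2.2]

/-- The western piece takes the last index, and the pieces of the eastern hole keep theirs. The
western leftmost edge has its midpoint off the eastern carrier, and the other leftmost edges have
theirs off the western boundary, so no leftmost edge is shared. -/
theorem isPieces_succ (hk : 1 ≤ k) (hH : H.IsBLS) (h : H.IsCanonicalOrdering (k + 1) r ℓ ν)
    (ha : a = ν (k + 1) + 1) (hyN : c.yN = (H.QN (ν (k + 1))).2) (hzA : c.zA = H.QNstar (ν (k + 1)))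
    {S : ℕ → Hole} (hS : c.east.IsPieces k (r + H.n - c.pB) (fun i => ℓ i + H.n - c.pB)
      (fun i => ν i + H.n - c.pB) S) :
    H.IsPieces (k + 1) r ℓ ν (Function.update S (k + 1) c.west) := by
  have hk2 : 2 ≤ k + 1 := by omega
  obtain ⟨hr, hLN, hLM, hℓk, hℓ⟩ := c.last_cut hH h hk2 ha
  rw [Nat.add_sub_cancel] at hℓ
  have hr1 := hr.1
  have hr2 := hr.2
  have hm := c.lt_m
  have hm' := c.m_lt
  have hpB := c.pB_lt
  have hℓmem : ∀ i ∈ Icc 1 (k + 1), ℓ i ∈ Ioo r (r + H.n) ∧ LM H.v (ℓ i) := fun i hi => by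
    have : ℓ i ∈ {m | m ∈ Ioo r (r + H.n) ∧ H.IsLeftmost m} := by
      rw [← h.leftmost_eq]; exact mem_image_of_mem _ hi
    exact this
  have hνmem : ∀ i ∈ Icc 2 (k + 1), ν i ∈ Ioo r (r + H.n) ∧ LN H.v (ν i) := fun i hi => by
    have : ν i ∈ {m | m ∈ Ioo r (r + H.n) ∧ H.IsLeftNotch m} := by
      rw [← h.notch_eq]; exact mem_image_of_mem _ hi
    exact this
  have hℓ' : ∀ i ∈ Icc 1 k, ℓ i + H.n - c.pB ∈ Ico 0 (a - 1 + H.n - c.pB) := by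
    intro i hi
    have h1 := hℓ i hi
    have h2 := (hℓmem i ⟨hi.1, hi.2.trans (by omega)⟩).1.1
    exact ⟨by omega, by omega⟩
  have hν' : ∀ i ∈ Icc 2 k, ν i + H.n - c.pB ∈ Ico 0 (a - 1 + H.n - c.pB) ∧ LN H.v (ν i) := by
    intro i hi
    have hi1 := hi.1
    have hi2 := hi.2
    have h1 := h.notch_mono (a := i) (b := k + 1) ⟨hi1, by omega⟩ ⟨hk2, le_rfl⟩ (by omega)
    have h2 := hνmem i ⟨hi1, by omega⟩
    have h3 := h2.1.1
    exact ⟨⟨by omega, by omega⟩, h2.2⟩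
  have hedge : ∀ i ∈ Icc 1 k, c.east.edge (ℓ i + H.n - c.pB) = H.edge (ℓ i) := by
    intro i hi
    have h1 := hℓ' i hi
    have := Hole.edge_periodic (H := H) (ℓ i) 1
    rw [one_mul] at this
    rw [c.east_edge h1.1 h1.2, show c.pB + (ℓ i + H.n - c.pB) = ℓ i + H.n by ring, this]
  obtain ⟨hcuts, hQ⟩ := c.east_cuts hν'
  have hQk : H.Q (ν (k + 1)) = H.v a := by rw [Hole.Q, ha]
  have hslit : c.slit = segment ℝ (H.Q (ν (k + 1))) (H.QN (ν (k + 1))) := by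
    rw [slit, hyN, ← hQk]; rfl
  have hIcc2 : Icc 2 (k + 1) = insert (k + 1) (Icc 2 k) := by
    ext i; simp only [mem_Icc, mem_insert_iff]; omega
  have hIcc1 : Icc 1 (k + 1) = insert (k + 1) (Icc 1 k) := by
    ext i; simp only [mem_Icc, mem_insert_iff]; omega
  have hHcuts : H.cuts (k + 1) ν = c.slit ∪ H.cuts k ν := by
    rw [Hole.cuts, hIcc2, biUnion_insert, ← hslit]; rfl
  have hsub : H.cuts k ν ⊆ c.east.carrier := by
    rw [← hcuts]
    refine iUnion₂_subset fun i hi => ?_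
    have h1 := hν' i hi
    have hper := (H.rectCurve.types_periodic (ν i) 1).2.2.1
    rw [one_mul] at hper
    refine Hole.segment_subset_carrier ((c.east_types h1.1).2.2.1.2 ?_)
    rw [show c.pB + (ν i + H.n - c.pB) = ν i + H.n by ring, hper]
    exact h1.2
  -- The remaining cuts lie in the eastern carrier, which is disjoint from the western inner region,
  -- so removing them affects the east only.
  have hdiff : H.inner \ H.cuts (k + 1) ν = c.west.inner ∪ (c.east.inner \ H.cuts k ν) := by
    rw [hHcuts, ← sdiff_sdiff, c.inner_diff_slit, union_sdiff_distrib,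
      (c.disjoint_inner_west_carrier.mono_right hsub).sdiff_eq_left]
  have hT1 : ∀ i ∈ Icc 1 k, Function.update S (k + 1) c.west i = S i := fun i hi =>
    Function.update_of_ne (by have := hi.2; omega) _ _
  have hT2 : Function.update S (k + 1) c.west (k + 1) = c.west := Function.update_self _ _ _
  have hsubE : ∀ i ∈ Icc 1 k, (S i).inner ⊆ c.east.inner := by
    intro i hi
    have : (S i).inner ∈ regions (c.east.inner \ c.east.cuts k fun i => ν i + H.n - c.pB) := by
      rw [← hS.regions_eq]; exact mem_image_of_mem _ hi
    exact (subset_of_mem_regions this).trans sdiff_subset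
  have hne : ∀ i ∈ Icc 1 k, (S i).inner ≠ c.west.inner := by
    intro i hi he
    obtain ⟨p, hp⟩ := c.west.inner_nonempty
    exact Set.disjoint_left.1 c.disjoint_inner hp (hsubE i hi (he ▸ hp))
  have hsubC : ∀ i ∈ Icc 1 k, (S i).boundary ⊆ c.east.carrier := by
    intro i hi
    rw [← hS.carrier_eq]
    exact subset_union_left.trans (subset_biUnion_of_mem (u := fun i => (S i).carrier) hi)
  have hw1 : ∀ i ∈ Icc 1 k, H.edge (ℓ i) ∉ c.west.edges := by
    intro i hi he
    have h1 := Hole.curve_mem_boundary_of_edge_mem he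
    have hper := H.rectCurve.curve_periodic (ℓ i + 1 / 2) 1
    rw [← hper] at h1
    have h2 := hℓ' i hi
    have h3 : (c.pB : ℝ) ≤ ℓ i + H.n := by exact_mod_cast (by have := h2.1; omega)
    have h4 : (ℓ i : ℝ) + 1 ≤ a := by exact_mod_cast (by have := h2.2; omega)
    have h5 := c.sB_mem.2
    refine c.curve_not_mem_west ⟨?_, ?_⟩ h1
    · push_cast; linarith
    · push_cast; linarith
  have hw2 : ∀ i ∈ Icc 1 k, H.edge (ℓ (k + 1)) ∉ (S i).edges := by
    intro i hi he
    have h1 := hsubC i hi (Hole.curve_mem_boundary_of_edge_mem he)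
    have h3 : (a : ℝ) < ℓ (k + 1) := by exact_mod_cast hℓk.1
    have h4 : (ℓ (k + 1) : ℝ) + 1 ≤ c.m := by exact_mod_cast hℓk.2
    have h5 := c.sA_mem.1
    rcases h1 with h1 | h1
    · exact c.curve_not_mem_east ⟨by linarith, by linarith⟩ h1
    · refine Set.disjoint_left.1 c.disjoint_boundary_west_inner ?_ h1
      exact c.mem_boundary_west.2 (Or.inl ⟨_, ⟨by linarith, by linarith⟩, rfl⟩)
  refine ⟨?_, ?_, ?_, ?_, ?_, ?_, ?_, ?_, ?_⟩
  · rw [hIcc1]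
    rintro i (rfl | hi)
    · rw [hT2]; exact c.west_isNice hH h hk2 ha
    · rw [hT1 i hi]; exact hS.nice i hi
  · rw [hIcc1]
    rintro i (rfl | hi) j (rfl | hj) hij
    · rfl
    · dsimp only at hij
      rw [hT2, hT1 j hj] at hij
      exact (hne j hj hij.symm).elim
    · dsimp only at hij
      rw [hT2, hT1 i hi] at hij
      exact (hne i hi hij).elim
    · dsimp only at hij
      rw [hT1 i hi, hT1 j hj] at hij
      exact hS.inner_inj hi hj hij
  · rw [hdiff, regions_union c.west.isOpen_inner c.east.isOpen_inner c.disjoint_inner subset_rfl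
      sdiff_subset, regions_of_isPreconnected c.west.isPreconnected_inner c.west.inner_nonempty,
      hIcc1, image_insert_eq, hT2, ← hcuts, ← hS.regions_eq, singleton_union]
    congr 1
    exact image_congr fun i hi => by rw [hT1 i hi]
  · rw [hIcc1, biUnion_insert, hT2, ← c.carrier_union, ← hS.carrier_eq]
    congr 1
    exact iUnion₂_congr fun i hi => by rw [hT1 i hi]
  · rw [hIcc1]
    rintro i (rfl | hi)
    · rw [hT2]; exact c.west_leftmostEdges hH h hk2 ha
    · rw [hT1 i hi, hS.leftmost i hi, hedge i hi]
  · rw [hIcc1]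
    rintro i (rfl | hi) j (rfl | hj) hij
    · rfl
    · rw [hT1 j hj] at hij
      exact (hw2 j hj hij).elim
    · rw [hT2] at hij
      exact (hw1 i hi hij).elim
    · rw [hT1 j hj, ← hedge i hi] at hij
      exact hS.edge_mem i hi j hj hij
  · have := Hole.edge_periodic (H := H) r 1
    rw [one_mul] at this
    rw [hT1 1 ⟨le_rfl, hk⟩, hS.rightmost_one, c.east_edge (by omega) (by omega),
      show c.pB + (r + H.n - c.pB) = r + H.n by ring, this]
  · rw [hIcc2]
    rintro i (rfl | hi)
    · rw [hT2, c.west_rightmostEdges hH, hzA, hQk]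
    · rw [hT1 i ⟨by have := hi.1; omega, hi.2⟩, hS.rightmost i hi, (hQ i hi).1, (hQ i hi).2]
  · have h1 := hS.sum_le
    have h2 := c.n_add_n_le
    rw [Finset.sum_Icc_succ_top (by omega), hT2,
      Finset.sum_congr rfl fun i hi => by rw [hT1 i (by simpa using hi)]]
    omega

end Cut

/-! ### The induction, and bounds for `k` -/

namespace Hole

theorem exists_isPieces {k : ℕ} (hk : 1 ≤ k) : ∀ {H : Hole} {r : ℤ} {ℓ ν : ℕ → ℤ}, H.IsBLS →
    H.IsCanonicalOrdering k r ℓ ν → ∃ S, H.IsPieces k r ℓ ν S := by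
  induction k, hk using Nat.le_induction with
  | base => exact fun hH h => ⟨_, isPieces_one h hH⟩
  | succ k hk ih =>
    intro H r ℓ ν hH h
    have hN : ν (k + 1) ∈ {m | m ∈ Ioo r (r + H.n) ∧ H.IsLeftNotch m} := by
      rw [← h.notch_eq]; exact mem_image_of_mem _ ⟨by omega, le_rfl⟩
    obtain ⟨c, hyN, hzA⟩ := exists_cut hH rfl hN.2
    have hord := c.east_canonicalOrdering hH h (by omega) rfl
    rw [Nat.add_sub_cancel] at hord
    obtain ⟨S, hS⟩ := ih (c.east_isBLS hH) hord
    exact ⟨_, c.isPieces_succ hk hH h rfl hyN hzA hS⟩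

variable {H : Hole} {k : ℕ} {r : ℤ} {ℓ ν : ℕ → ℤ}

theorem IsCanonicalOrdering.le_n (h : H.IsCanonicalOrdering k r ℓ ν) : k ≤ H.n := by
  have h1 : (Finset.Icc 1 k).card ≤ (Finset.Ioo r (r + H.n)).card := by
    refine Finset.card_le_card_of_injOn ℓ (fun i hi => ?_) ?_
    · have : ℓ i ∈ {m | m ∈ Ioo r (r + H.n) ∧ H.IsLeftmost m} := by
        rw [← h.leftmost_eq]; exact mem_image_of_mem _ (by simpa using hi)
      simpa using this.1
    · rw [Finset.coe_Icc]
      exact h.leftmost_mono.injOn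
  rw [Nat.card_Icc, Int.card_Ioo] at h1
  omega

/-- Both edges go upward, so equal pairs of end points cannot be matched crosswise; the lower
vertices agree, and within one period this determines the index. -/
theorem edge_injOn_leftmost (h : H.IsCanonicalOrdering k r ℓ ν) :
    InjOn (fun i => H.edge (ℓ i)) (Icc 1 k) := by
  intro i hi j hj hij
  have hmem : ∀ i ∈ Icc 1 k, ℓ i ∈ Ioo r (r + H.n) ∧ LM H.v (ℓ i) := fun i hi => by
    have : ℓ i ∈ {m | m ∈ Ioo r (r + H.n) ∧ H.IsLeftmost m} := by
      rw [← h.leftmost_eq]; exact mem_image_of_mem _ hi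
    exact this
  obtain ⟨⟨h1, h2⟩, h3⟩ := hmem i hi
  obtain ⟨⟨k1, k2⟩, k3⟩ := hmem j hj
  have hv : H.v (ℓ i) = H.v (ℓ j) := by
    rcases Set.pair_eq_pair_iff.1 hij with ⟨h, -⟩ | ⟨e1, e2⟩
    · exact h
    · have u1 := h3.2.1.2
      have u2 := k3.2.1.2
      rw [e1, e2] at u1
      exact (u1.not_gt u2).elim
  refine h.leftmost_mono.injOn hi hj ?_
  have := H.rectCurve.eq_of_curve_eq (s := ℓ i) (t := ℓ j) (a := r) (by rw [curve_int, curve_int, hv])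
    ⟨by exact_mod_cast h1.le, by exact_mod_cast h2⟩ ⟨by exact_mod_cast k1.le, by exact_mod_cast k2⟩
  exact_mod_cast this

end Hole

/-! ### Existence of a canonical ordering -/

theorem exists_strictMonoOn_image_eq (s : Finset ℤ) {b k : ℕ} (h : k + 1 = b + s.card) :
    ∃ f : ℕ → ℤ, StrictMonoOn f (Icc b k) ∧ f '' Icc b k = s := by
  set g := s.orderEmbOfFin rfl with hg
  set f : ℕ → ℤ := fun i => if h : i - b < s.card then g ⟨i - b, h⟩ else 0 with hf
  have hfi : ∀ i (hi : i - b < s.card), f i = g ⟨i - b, hi⟩ := fun i hi => by rw [hf]; exact dif_pos hi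
  refine ⟨f, fun i hi j hj hij => ?_, ?_⟩
  · have h1 := hi.1
    have h2 := hj.2
    rw [hfi i (by omega), hfi j (by omega), g.lt_iff_lt, Fin.mk_lt_mk]
    omega
  · ext x
    constructor
    · rintro ⟨i, hi, rfl⟩
      have h1 := hi.1
      have h2 := hi.2
      rw [hfi i (by omega)]
      exact s.orderEmbOfFin_mem rfl _
    · intro hx
      rw [← Finset.range_orderEmbOfFin s rfl] at hx
      obtain ⟨i, rfl⟩ := hx
      have hi := i.2
      refine ⟨i + b, ⟨by omega, by omega⟩, ?_⟩
      rw [hfi _ (by omega)]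
      congr 1
      ext
      simp

namespace Hole

variable {H : Hole}

open Classical in
theorem exists_canonicalOrdering (hH : H.IsBLS) :
    ∃ (k : ℕ) (r : ℤ) (ℓ ν : ℕ → ℤ), H.IsCanonicalOrdering k r ℓ ν := by
  have X := H.rectCurve
  obtain ⟨r, -, hr⟩ := RectCurve.exists_of_sum_ind (P := RM H.v) (a := 0) (b := 0 + H.n)
    (by rw [(X.counts hH.1 0).1]; exact one_pos)
  have hcard : ∀ P : ℤ → Prop, ¬ P r → ∑ i ∈ Finset.Ico r (r + H.n), ind (P i) =
      ((Finset.Ioo r (r + H.n)).filter P).card := by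
    intro P hP
    rw [Finset.card_filter, Nat.cast_sum, ← Finset.Ioo_insert_left (by have := H.n_pos; omega),
      Finset.sum_insert (by simp), ind_false hP, zero_add]
    exact Finset.sum_congr rfl fun i _ => by simp [ind]
  have hc := (X.counts hH.1 r).2
  rw [hcard (LM H.v) fun h => hr.2.1.not_upward h.2.1, hcard (LN H.v) fun h => hr.2.1.not_upward h.2.1] at hc
  set L := (Finset.Ioo r (r + H.n)).filter (LM H.v)
  set N := (Finset.Ioo r (r + H.n)).filter (LN H.v)
  -- There is one left notch fewer than leftmost edges, so starting the notches at 2 makes both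
  -- families end at the same index.
  obtain ⟨ℓ, hℓ1, hℓ2⟩ := exists_strictMonoOn_image_eq L (b := 1) (k := L.card) (by omega)
  obtain ⟨ν, hν1, hν2⟩ := exists_strictMonoOn_image_eq N (b := 2) (k := L.card) (by omega)
  refine ⟨L.card, r, ℓ, ν, hr, hℓ1, ?_, hν1, ?_⟩
  · rw [hℓ2]
    ext i
    simp only [L, Finset.coe_filter, Finset.mem_Ioo]
    rfl
  · rw [hν2]
    ext i
    simp only [N, Finset.coe_filter, Finset.mem_Ioo]
    rfl

end Hole
end BLS

end

theorem mainTheorem4 :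
    ∃ C : ℕ, ∀ H : BLS.Hole, H.IsBLS →
      (∃ (k : ℕ) (r : ℤ) (ℓ ν : ℕ → ℤ), H.IsCanonicalOrdering k r ℓ ν) ∧
      ∀ (k : ℕ) (r : ℤ) (ℓ ν : ℕ → ℤ), H.IsCanonicalOrdering k r ℓ ν →
        ∃ S : Fin k → BLS.Hole,
          -- (1) the segments partition `H` into the `k` nice holes `S j`
          ((∀ j, (S j).IsNice) ∧
            Function.Injective (fun j => (S j).inner) ∧
            Set.range (fun j => (S j).inner) = BLS.regions (H.inner \ H.cuts k ν) ∧
            ⋃ j, (S j).carrier = H.carrier) ∧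
          -- (2) the leftmost edges of `H` correspond to the pieces
          ((∀ i ∈ Set.Icc 1 k, ∃! j, H.edge (ℓ i) ∈ (S j).edges) ∧
            ∀ j, ∃! i, i ∈ Set.Icc 1 k ∧ (S j).leftmostEdges = {H.edge (ℓ i)}) ∧
          -- (3) the rightmost edge of each piece
          (∀ j,
            ((S j).leftmostEdges = {H.edge (ℓ 1)} → (S j).rightmostEdges = {H.edge r}) ∧
            ∀ i ∈ Set.Icc 2 k, (S j).leftmostEdges = {H.edge (ℓ i)} →
              (S j).rightmostEdges = {{H.QNstar (ν i), H.Q (ν i)}}) ∧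
          -- (4) the total number of vertices
          ∑ j, (S j).nv ≤ C * H.nv := by
  -- The `k - 1` cuts give a total of at most `n + 2 * (k - 1)` vertices, and `k ≤ n`.
  refine ⟨3, fun H hH => ⟨H.exists_canonicalOrdering hH, fun k r ℓ ν h => ?_⟩⟩
  have hk := h.pos hH
  obtain ⟨S, hS⟩ := BLS.Hole.exists_isPieces hk hH h
  have hj : ∀ j : Fin k, (j : ℕ) + 1 ∈ Set.Icc 1 k := fun j => ⟨by omega, j.2⟩
  have hinj := BLS.Hole.edge_injOn_leftmost h
  have hpick : ∀ {i : ℕ} (hi : i ∈ Set.Icc 1 k), ∃ j : Fin k, (j : ℕ) + 1 = i := fun {i} hi =>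
    ⟨⟨i - 1, by have := hi.1; have := hi.2; omega⟩, Nat.sub_add_cancel hi.1⟩
  have hidx : ∀ (j : Fin k) {i : ℕ}, i ∈ Set.Icc 1 k → (S (j + 1)).leftmostEdges = {H.edge (ℓ i)} →
      (j : ℕ) + 1 = i := fun j i hi he => by
    rw [hS.leftmost _ (hj j), Set.singleton_eq_singleton_iff] at he
    exact hinj (hj j) hi he
  refine ⟨fun j => S (j + 1), ⟨fun j => hS.nice _ (hj j), fun i j hij => ?_, ?_, ?_⟩,
    ⟨fun i hi => ?_, fun j => ?_⟩, fun j => ⟨fun he => ?_, fun i hi he => ?_⟩, ?_⟩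
  · have := hS.inner_inj (hj i) (hj j) hij
    ext
    omega
  · rw [← hS.regions_eq]
    ext C
    constructor
    · rintro ⟨j, rfl⟩
      exact ⟨_, hj j, rfl⟩
    · rintro ⟨i, hi, rfl⟩
      obtain ⟨j, rfl⟩ := hpick hi
      exact ⟨j, rfl⟩
  · rw [← hS.carrier_eq]
    ext p
    simp only [Set.mem_iUnion]
    constructor
    · rintro ⟨j, hp⟩
      exact ⟨_, hj j, hp⟩
    · rintro ⟨i, hi, hp⟩
      obtain ⟨j, rfl⟩ := hpick hi
      exact ⟨j, hp⟩
  · obtain ⟨j, rfl⟩ := hpick hi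
    refine ⟨j, ?_, fun j' hj' => ?_⟩
    · have : H.edge (ℓ (j + 1)) ∈ (S (j + 1)).leftmostEdges := by
        rw [hS.leftmost _ hi]; exact rfl
      obtain ⟨m, -, hm⟩ := this
      exact ⟨m, hm.symm⟩
    · have := hS.edge_mem _ hi _ (hj j') hj'
      ext
      omega
  · exact ⟨j + 1, ⟨hj j, hS.leftmost _ (hj j)⟩, fun i hi => (hidx j hi.1 hi.2).symm⟩
  · have := hidx j ⟨le_rfl, hk⟩ he
    dsimp only
    rw [this, hS.rightmost_one]
  · have := hidx j ⟨le_trans (by norm_num) hi.1, hi.2⟩ he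
    dsimp only
    rw [this, hS.rightmost i hi]
  · have h1 := hS.sum_le
    have h2 := h.le_n
    have h3 : ∑ j : Fin k, (S (j + 1)).nv = ∑ i ∈ Finset.Icc 1 k, (S i).n := by
      rw [Fin.sum_univ_eq_sum_range (fun i => (S (i + 1)).nv), Finset.range_eq_Ico,
        Finset.sum_Ico_add' (fun i => (S i).nv) 0 k 1]
      rfl
    rw [h3, BLS.Hole.nv]
    omega
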